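/- Let $R$ be a commutative Noetherian ring; all modules are finitely generated and all subcategories of $\operatorname{mod}R$ are full and closed under isomorphism. Let $K$ be a semidualizing $R$-module (the homothety map $R\to\operatorname{Hom}_R(K,K)$ is an isomorphism and $\operatorname{Ext}^i_R(K,K)=0$ for $i>0$), and let $n\ge 0$. Write $\operatorname{gr}(M)=\inf\{i\mid \operatorname{Ext}^i_R(M,R)\ne 0\}$ for the grade. For each $M$ there are the natural maps $\mu_M:M\to\operatorname{Hom}_R(K,M\otimes_RK)$ and $\nu_M:K\otimes_R\operatorname{Hom}_R(K,M)\to M$. Let $\nabla_K(R)$ (resp. $\Delta_K(R)$) be the class of $M$ with $\mu_M$ (resp. $\nu_M$) an isomorphism. The Auslander class $\mathcal A_K(R)$ consists of the $M\in\nabla_K(R)$ with $\operatorname{Tor}^R_i(M,K)=0=\operatorname{Ext}^i_R(K,M\otimes_RK)$ for all $i>0$; the Bass class $\mathcal B_K(R)$ consists of the $M\in\Delta_K(R)$ with $\operatorname{Tor}^R_i(\operatorname{Hom}_R(K,M),K)=0=\operatorname{Ext}^i_R(K,M)$ for all $i>0$. Put $\mathcal D^n_K(M)=\operatorname{Ext}^n_R(\operatorname{Hom}_R(K,M),K)$.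 For $M$ of grade $n$ and a semidualizing module $C$ there is the natural biduality map $\eta_C(M):M\to\operatorname{Ext}^n_R(\operatorname{Ext}^n_R(M,C),C)$: under the natural isomorphisms $\operatorname{Ext}^n_R(X,C)\cong\operatorname{Hom}_R(X,\operatorname{Ext}^n_R(R/\operatorname{ann}M,C))$, valid for $X$ annihilated by $\operatorname{ann}M$, it is evaluation. If moreover $M\in\Delta_K(R)$, there is the map $\xi_K(M):M\to\mathcal D^n_K\mathcal D^n_K(M)$, the composition of $\eta_K(M)$ with the isomorphism $\operatorname{Ext}^n_R(\operatorname{Ext}^n_R(M,K),K)\cong\operatorname{Ext}^n_R(\operatorname{Hom}_R(K,\mathcal D^n_K(M)),K)$ induced by the natural isomorphism $\operatorname{Ext}^n_R(M,K)\cong\operatorname{Hom}_R(K,\mathcal D^n_K(M))$, $e\mapsto(k\mapsto \operatorname{Ext}^n_R(\mathrm{ev}_k,K)(e))$, where $\mathrm{ev}_k(f)=f(k)$. A subcategory $\mathcal X$ is $n$-reflexive with respect to $C$ if each $X\in\mathcal X$ has grade $n$, $\eta_C(X)$ is an isomorphism and $\operatorname{Ext}^n_R(X,C)\in\mathcal X$.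 A subcategory $\mathcal Y$ is $n$-coreflexive with respect to $K$ if each $Y\in\mathcal Y$ has grade $n$ and lies in $\Delta_K(R)$, $\xi_K(Y)$ is an isomorphism and $\mathcal D^n_K(Y)\in\mathcal Y$. The pair $(\mathcal X,\mathcal Y)$ is $n$-adjoint with respect to $K$ if $\mathcal X$ is $n$-reflexive with respect to $R$, $\mathcal Y$ is $n$-coreflexive with respect to $K$, $\{X\otimes_RK\mid X\in\mathcal X\}\subseteq\mathcal Y\subseteq\mathcal B_K(R)$ and $\{\operatorname{Hom}_R(K,Y)\mid Y\in\mathcal Y\}\subseteq\mathcal X\subseteq\mathcal A_K(R)$. For a subcategory $\mathcal Z$ let $\operatorname{Epi}(\mathcal Z)$ be the set of surjections $\phi:Z\twoheadrightarrow M$ with $Z\in\mathcal Z$ and $\operatorname{gr}(M)=\operatorname{gr}(Z)$, and write $\phi\equiv\psi$ if $\alpha\phi=\psi\beta$ for some isomorphisms $\alpha,\beta$. For $\phi:Z\twoheadrightarrow M$ with kernel inclusion $j:\ker\phi\to Z$, let $L^n_R(\phi):\operatorname{Ext}^n_R(Z,R)\twoheadrightarrow\operatorname{im}\operatorname{Ext}^n_R(j,R)$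 and $\mathcal L^n_K(\phi):\mathcal D^n_K(Z)\twoheadrightarrow\operatorname{im}\operatorname{Ext}^n_R(\operatorname{Hom}_R(K,j),K)$ be the induced surjections. A module $M$ is linked with respect to $\mathcal X$ (over $R$) if it is the image of some $\phi\in\operatorname{Epi}(\mathcal X)$ for which there is $\psi\in\operatorname{Epi}(\mathcal X)$ with $\phi\equiv L^n_R(\psi)$ and $\psi\equiv L^n_R(\phi)$. It is colinked with respect to $\mathcal Y$ if the same holds with $\mathcal Y$ and $\mathcal L^n_K$ in place of $\mathcal X$ and $L^n_R$. **Theorem.** (a) For every $n$-adjoint pair $(\mathcal X,\mathcal Y)$ with respect to $K$, the functors $-\otimes_RK$ and $\operatorname{Hom}_R(K,-)$, with unit $\mu$ and counit $\nu$, restrict to an adjoint equivalence between the full subcategories $$\{M\in\nabla_K(R)\mid M\text{ is linked with respect to }\mathcal X\}\quad\text{and}\quad\{N\in\Delta_K(R)\mid N\text{ is colinked with respect to }\mathcal Y\}.$$ (b) Likewise, they restrict to an adjoint equivalence between $$\{M\in\mathcal A_K(R)\mid M\text{ is linked with respect to }\mathcal P^n(R)\}\quad\text{and}\quad\{N\in\mathcal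 B_K(R)\mid N\text{ is colinked with respect to }\mathcal P^n_K(R)\}.$$ Here $\mathcal P^n(R)$ consists of the perfect modules of grade $n$ (grade and projective dimension equal to $n$), and $\mathcal P^n_K(R)$ of the modules of grade $n$ whose $\mathcal P_K$-dimension equals $n$. The $\mathcal P_K$-dimension of $M$ is the least $t$ for which there is an exact sequence $0\to P_t\otimes_RK\to\cdots\to P_0\otimes_RK\to M\to0$ with all $P_i$ finitely generated projective. -/

import Mathlib

universe u

open CategoryTheory

namespace Linkage

noncomputable section

/-! Throughout, `R` is a commutative ring (Noetherian in the theorem) and modules are objects of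
`ModuleCat.{u} R`; finite generation is imposed wherever it is part of a definition. -/

section Basic

variable {R : Type u} [CommRing R]

/-- `R` as a module over itself. -/
abbrev ringMod (R : Type u) [CommRing R] : ModuleCat.{u} R := ModuleCat.of R R

/-- The `R`-module `Ext^n_R(M, K)`. -/
abbrev extMod (n : ℕ) (M K : ModuleCat.{u} R) : ModuleCat.{u} R :=
  ModuleCat.of R (Abelian.Ext M K n)

/-- The `R`-module `Hom_R(K, M)`. -/
abbrev homMod (K M : ModuleCat.{u} R) : ModuleCat.{u} R := ModuleCat.of R (K →ₗ[R] M)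

/-- The functor `Hom_R(K, -)` on `R`-modules. -/
def homFunctor (K : ModuleCat.{u} R) : ModuleCat.{u} R ⥤ ModuleCat.{u} R where
  obj M := homMod K M
  map f := ModuleCat.ofHom (LinearMap.llcomp R K _ _ f.hom)

/-- The functor `- ⊗_R K` on `R`-modules. -/
abbrev tensorFunctor (K : ModuleCat.{u} R) : ModuleCat.{u} R ⥤ ModuleCat.{u} R :=
  MonoidalCategory.tensorRight K

/-- Functoriality of `Ext^n_R(-, K)`, linear in both arguments: `f : X → Y` and
`e ∈ Ext^n_R(Y, K)` are sent to the pull-back `Ext^n_R(f, K)(e) ∈ Ext^n_R(X, K)`. -/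
def extPull (n : ℕ) (X Y K : ModuleCat.{u} R) :
    (X →ₗ[R] Y) →ₗ[R] (extMod n Y K →ₗ[R] extMod n X K) :=
  Abelian.Ext.bilinearCompOfLinear R X Y K 0 n n (zero_add n) ∘ₗ
    (Abelian.Ext.linearEquiv₀ (R := R) (X := X) (Y := Y)).symm.toLinearMap ∘ₗ
    (ModuleCat.homLinearEquiv (S := R) (M := X) (N := Y)).symm.toLinearMap

/-- The grade `gr_R(M) = inf {i | Ext^i_R(M, R) ≠ 0}`, equal to `⊤` if there is no such `i`. -/
def grade (M : ModuleCat.{u} R) : ℕ∞ :=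
  ⨅ (i : ℕ) (_ : Nontrivial (extMod i M (ringMod R))), (i : ℕ∞)

/-- `K` is a semidualizing module: it is finitely generated, the homothety map
`R → Hom_R(K, K)` is bijective, and `Ext^i_R(K, K) = 0` for all `i > 0`. -/
structure IsSemidualizing (K : ModuleCat.{u} R) : Prop where
  finite : Module.Finite R K
  homothety : Function.Bijective (LinearMap.lsmul R K : R →ₗ[R] (K →ₗ[R] K))
  ext_eq_zero : ∀ i : ℕ, 0 < i → Subsingleton (extMod i K K)

/-- The natural map `μ : M → Hom_R(K, M ⊗_R K)`, `m ↦ (k ↦ m ⊗ k)`. -/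
def mu (K M : ModuleCat.{u} R) : M →ₗ[R] homMod K ((tensorFunctor K).obj M) :=
  TensorProduct.mk R M K

/-- The evaluation map `ν : K ⊗_R Hom_R(K, M) → M`, `k ⊗ f ↦ f k`. -/
def nu (K M : ModuleCat.{u} R) : TensorProduct R K (K →ₗ[R] M) →ₗ[R] M :=
  TensorProduct.lift LinearMap.applyₗ

/-- The class `∇_K(R)` of finitely generated modules `M` with `μ_M` an isomorphism. -/
def Nabla (K : ModuleCat.{u} R) : ObjectProperty (ModuleCat.{u} R) := fun M =>
  Module.Finite R M ∧ Function.Bijective (mu K M)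

/-- The class `Δ_K(R)` of finitely generated modules `M` with `ν_M` an isomorphism. -/
def Delta (K : ModuleCat.{u} R) : ObjectProperty (ModuleCat.{u} R) := fun M =>
  Module.Finite R M ∧ Function.Bijective (nu K M)

/-- The module `Tor_i^R(M, N)` vanishes. -/
def TorVanishes (i : ℕ) (M N : ModuleCat.{u} R) : Prop :=
  Limits.IsZero (((Tor (ModuleCat.{u} R) i).obj M).obj N)

/-- The Auslander class with respect to `K`. -/
def Auslander (K : ModuleCat.{u} R) : ObjectProperty (ModuleCat.{u} R) := fun M =>
  Module.Finite R M ∧ Function.Bijective (mu K M) ∧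
    ∀ i : ℕ, 0 < i → TorVanishes i M K ∧ Subsingleton (extMod i K ((tensorFunctor K).obj M))

/-- The Bass class with respect to `K`. -/
def Bass (K : ModuleCat.{u} R) : ObjectProperty (ModuleCat.{u} R) := fun M =>
  Module.Finite R M ∧ Function.Bijective (nu K M) ∧
    ∀ i : ℕ, 0 < i → TorVanishes i (homMod K M) K ∧ Subsingleton (extMod i K M)

end Basic

section Biduality

variable {R : Type u} [CommRing R]

/-- If the ideal `I` annihilates `X`, then every `x ∈ X` gives the map `R ⧸ I → X`, `1 ↦ x`. -/
def cyclicMap (I : Ideal R) (X : ModuleCat.{u} R) (h : I ≤ Module.annihilator R X) :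
    X →ₗ[R] ((R ⧸ I) →ₗ[R] X) where
  toFun x := I.liftQ (LinearMap.toSpanSingleton R X x) fun r hr =>
    Module.mem_annihilator.mp (h hr) x
  map_add' x y := LinearMap.ext fun q => by
    obtain ⟨a, rfl⟩ := Ideal.Quotient.mk_surjective q
    exact smul_add a x y
  map_smul' r x := LinearMap.ext fun q => by
    obtain ⟨a, rfl⟩ := Ideal.Quotient.mk_surjective q
    exact smul_comm a r x

/-- For `I` annihilating `X`, the natural map
`Ext^n_R(X, K) → Hom_R(X, Ext^n_R(R ⧸ I, K))` that sends `e` to the map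
`x ↦ (the pull-back of e along R ⧸ I → X, 1 ↦ x)`. Over a Noetherian ring it is an isomorphism
when `X` is finitely generated and `Ext^i_R(R ⧸ I, K) = 0` for `i < n`, that is, when `K` is
semidualizing and `I` has grade at least `n`. -/
def extToHom (n : ℕ) (K : ModuleCat.{u} R) (I : Ideal R) (X : ModuleCat.{u} R)
    (h : I ≤ Module.annihilator R X) :
    extMod n X K →ₗ[R] (X →ₗ[R] extMod n (ModuleCat.of R (R ⧸ I)) K) :=
  (extPull n (ModuleCat.of R (R ⧸ I)) X K ∘ₗ cyclicMap I X h).flip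

/-- The annihilator of `M` annihilates `Ext^n_R(M, K)`. -/
theorem annihilator_le_annihilator_ext (n : ℕ) (K M : ModuleCat.{u} R) :
    Module.annihilator R M ≤ Module.annihilator R (extMod n M K) := by
  intro r hr
  rw [Module.mem_annihilator]
  intro e
  have h0 : r • 𝟙 M = 0 := by
    ext x
    exact Module.mem_annihilator.mp hr x
  have h1 : r • (e : Abelian.Ext M K n)
      = (Abelian.Ext.mk₀ (r • 𝟙 M)).comp e (zero_add n) := by
    simp [Abelian.Ext.mk₀_smul]
  change r • (e : Abelian.Ext M K n) = 0
  rw [h1, h0]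
  simp

open Classical in
/-- The natural biduality map `η_M : M → Ext^n_R(Ext^n_R(M, K), K)` of a module `M` of grade `n`.

Put `I = ann M`, `W = Ext^n_R(R ⧸ I, K)` and `E = Ext^n_R(M, K)`. Under the natural isomorphisms
`E ≅ Hom_R(M, W)` and `Ext^n_R(E, K) ≅ Hom_R(E, W)` of `extToHom`, the map `η_M` is the evaluation
`m ↦ (e ↦ e(m))`. (For `n = 0` this is the evaluation map into the double `K`-dual.)
When the second map is not bijective, which does not happen for `K` semidualizing and `M` finitely
generated of grade `n` over a Noetherian ring, the value is `0` by convention. -/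
def eta (n : ℕ) (K M : ModuleCat.{u} R) : M →ₗ[R] extMod n (extMod n M K) K :=
  if h : Function.Bijective (extToHom n K (Module.annihilator R M) (extMod n M K)
      (annihilator_le_annihilator_ext n K M)) then
    (LinearEquiv.ofBijective _ h).symm.toLinearMap ∘ₗ
      (extToHom n K (Module.annihilator R M) M le_rfl).flip
  else 0

/-- `D^n_K(M) = Ext^n_R(Hom_R(K, M), K)`. -/
abbrev codual (n : ℕ) (K M : ModuleCat.{u} R) : ModuleCat.{u} R := extMod n (homMod K M) K

/-- The natural map `Ext^n_R(M, K) → Hom_R(K, Ext^n_R(Hom_R(K, M), K)) = Hom_R(K, D^n_K(M))` that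
sends `e` to the map `k ↦ (the pull-back of e along Hom_R(K, M) → M, f ↦ f k)`. It is an
isomorphism for `K` semidualizing and `M` finitely generated of grade `n` in `Δ_K(R)`: modulo a
regular sequence of length `n` in `ann M` it is the adjunction isomorphism
`Hom(K ⊗ Hom(K, M), K) ≅ Hom(K, Hom(Hom(K, M), K))`, preceded by `Hom(ν_M, K)`. -/
def extToHomCodual (n : ℕ) (K M : ModuleCat.{u} R) :
    extMod n M K →ₗ[R] homMod K (codual n K M) :=
  (extPull n (homMod K M) M K ∘ₗ LinearMap.applyₗ).flip

open Classical in
/-- The map `ξ_M : M → D^n_K(D^n_K(M))` of a module `M ∈ Δ_K(R)` of grade `n`: the composition of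
`η_M : M → Ext^n_R(Ext^n_R(M, K), K)` with the isomorphism
`Ext^n_R(Ext^n_R(M, K), K) ≅ Ext^n_R(Hom_R(K, D^n_K(M)), K) = D^n_K(D^n_K(M))`
that is induced by the isomorphism `extToHomCodual`. (The value is `0` by convention when the
latter is not bijective.) -/
def xi (n : ℕ) (K M : ModuleCat.{u} R) : M →ₗ[R] codual n K (codual n K M) :=
  if h : Function.Bijective (extToHomCodual n K M) then
    extPull n (homMod K (codual n K M)) (extMod n M K) K
      (LinearEquiv.ofBijective _ h).symm.toLinearMap ∘ₗ eta n K M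
  else 0

/-- A full, isomorphism-closed subcategory of finitely generated modules is `n`-reflexive with
respect to `K` if its objects `M` have grade `n`, the map `η_M` is an isomorphism, and it is
closed under `Ext^n_R(-, K)`. -/
structure IsReflexiveSubcategory (n : ℕ) (K : ModuleCat.{u} R)
    (𝒳 : ObjectProperty (ModuleCat.{u} R)) : Prop where
  closedUnderIso : 𝒳.IsClosedUnderIsomorphisms
  finite : ∀ M, 𝒳 M → Module.Finite R M
  grade_eq : ∀ M, 𝒳 M → grade M = n
  eta_bijective : ∀ M, 𝒳 M → Function.Bijective (eta n K M)
  ext_mem : ∀ M, 𝒳 M → 𝒳 (extMod n M K)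

/-- A full, isomorphism-closed subcategory of finitely generated modules is `n`-coreflexive with
respect to `K` if its objects `M` have grade `n`, the map `ν_M` is an isomorphism (so that `ξ_M`
is defined), the map `ξ_M` is an isomorphism, and it is closed under `D^n_K`. -/
structure IsCoreflexiveSubcategory (n : ℕ) (K : ModuleCat.{u} R)
    (𝒴 : ObjectProperty (ModuleCat.{u} R)) : Prop where
  closedUnderIso : 𝒴.IsClosedUnderIsomorphisms
  finite : ∀ M, 𝒴 M → Module.Finite R M
  grade_eq : ∀ M, 𝒴 M → grade M = n
  nu_bijective : ∀ M, 𝒴 M → Function.Bijective (nu K M)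
  xi_bijective : ∀ M, 𝒴 M → Function.Bijective (xi n K M)
  codual_mem : ∀ M, 𝒴 M → 𝒴 (codual n K M)

/-- `(𝒳, 𝒴)` is an `n`-adjoint pair of subcategories with respect to `K`. -/
structure IsAdjointPair (n : ℕ) (K : ModuleCat.{u} R)
    (𝒳 𝒴 : ObjectProperty (ModuleCat.{u} R)) : Prop where
  reflexive : IsReflexiveSubcategory n (ringMod R) 𝒳
  coreflexive : IsCoreflexiveSubcategory n K 𝒴
  tensor_mem : ∀ M, 𝒳 M → 𝒴 ((tensorFunctor K).obj M)
  le_bass : 𝒴 ≤ Bass K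
  hom_mem : ∀ M, 𝒴 M → 𝒳 ((homFunctor K).obj M)
  le_auslander : 𝒳 ≤ Auslander K

end Biduality

section Links

variable {R : Type u} [CommRing R]

/-- `φ ∈ Epi(𝒳)`: an epimorphism from an object of `𝒳` onto a finitely generated module of the
same grade. -/
structure IsEpiFrom (𝒳 : ObjectProperty (ModuleCat.{u} R)) {X M : ModuleCat.{u} R}
    (φ : X ⟶ M) : Prop where
  source_mem : 𝒳 X
  finite : Module.Finite R M
  surjective : Function.Surjective φ.hom
  grade_eq : grade M = grade X

/-- Equivalence of homomorphisms: `φ ≡ ψ` if there are isomorphisms `α : M ≅ N` and `β : X ≅ Y`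
with `α ∘ φ = ψ ∘ β`. -/
def HomEquivalent {X M Y N : ModuleCat.{u} R} (φ : X ⟶ M) (ψ : Y ⟶ N) : Prop :=
  ∃ (α : M ≅ N) (β : X ≅ Y), φ ≫ α.hom = β.hom ≫ ψ

/-- For `φ : X → M` with inclusion `j : ker φ → X` of the kernel, the epimorphism
`L^n_K(φ) : Ext^n_R(X, K) → im Ext^n_R(j, K)` induced by `Ext^n_R(j, K)`. -/
def linkMap (n : ℕ) (K : ModuleCat.{u} R) {X M : ModuleCat.{u} R} (φ : X ⟶ M) :
    extMod n X K ⟶ ModuleCat.of R (LinearMap.range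
      (extPull n (ModuleCat.of R (LinearMap.ker φ.hom)) X K (LinearMap.ker φ.hom).subtype)) :=
  ModuleCat.ofHom (LinearMap.rangeRestrict
    (extPull n (ModuleCat.of R (LinearMap.ker φ.hom)) X K (LinearMap.ker φ.hom).subtype))

/-- For `φ : Y → M` with inclusion `i : ker φ → Y` of the kernel, the epimorphism
`𝓛^n_K(φ) : D^n_K(Y) = Ext^n_R(Hom_R(K, Y), K) → im Ext^n_R(Hom_R(K, i), K)` induced by
`Ext^n_R(Hom_R(K, i), K)`. -/
def colinkMap (n : ℕ) (K : ModuleCat.{u} R) {Y M : ModuleCat.{u} R} (φ : Y ⟶ M) :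
    codual n K Y ⟶ ModuleCat.of R (LinearMap.range
      (extPull n (homMod K (ModuleCat.of R (LinearMap.ker φ.hom))) (homMod K Y) K
        (LinearMap.llcomp R K _ _ (LinearMap.ker φ.hom).subtype))) :=
  ModuleCat.ofHom (LinearMap.rangeRestrict
    (extPull n (homMod K (ModuleCat.of R (LinearMap.ker φ.hom))) (homMod K Y) K
      (LinearMap.llcomp R K _ _ (LinearMap.ker φ.hom).subtype)))

/-- `M` and `N` are directly linked with respect to `𝒳` (an `n`-reflexive subcategory with
respect to `K`) by a pair `(φ, ψ)` of elements of `Epi(𝒳)` with images `M` and `N`. -/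
def DirectlyLinked (n : ℕ) (K : ModuleCat.{u} R) (𝒳 : ObjectProperty (ModuleCat.{u} R))
    (M N : ModuleCat.{u} R) : Prop :=
  ∃ (X Y : ModuleCat.{u} R) (φ : X ⟶ M) (ψ : Y ⟶ N), IsEpiFrom 𝒳 φ ∧ IsEpiFrom 𝒳 ψ ∧
    HomEquivalent φ (linkMap n K ψ) ∧ HomEquivalent ψ (linkMap n K φ)

/-- `M` is linked with respect to `𝒳`. -/
def IsLinked (n : ℕ) (K : ModuleCat.{u} R) (𝒳 : ObjectProperty (ModuleCat.{u} R)) :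
    ObjectProperty (ModuleCat.{u} R) := fun M =>
  ∃ N : ModuleCat.{u} R, DirectlyLinked n K 𝒳 M N

/-- `M` and `N` are directly colinked with respect to `𝒴` (an `n`-coreflexive subcategory with
respect to `K`) by a pair `(φ, ψ)` of elements of `Epi(𝒴)` with images `M` and `N`. -/
def DirectlyColinked (n : ℕ) (K : ModuleCat.{u} R) (𝒴 : ObjectProperty (ModuleCat.{u} R))
    (M N : ModuleCat.{u} R) : Prop :=
  ∃ (X Y : ModuleCat.{u} R) (φ : X ⟶ M) (ψ : Y ⟶ N), IsEpiFrom 𝒴 φ ∧ IsEpiFrom 𝒴 ψ ∧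
    HomEquivalent φ (colinkMap n K ψ) ∧ HomEquivalent ψ (colinkMap n K φ)

/-- `M` is colinked with respect to `𝒴`. -/
def IsColinked (n : ℕ) (K : ModuleCat.{u} R) (𝒴 : ObjectProperty (ModuleCat.{u} R)) :
    ObjectProperty (ModuleCat.{u} R) := fun M =>
  ∃ N : ModuleCat.{u} R, DirectlyColinked n K 𝒴 M N

end Links

section Perfect

variable {R : Type u} [CommRing R]

/-- `P^n(R)`: finitely generated perfect modules of grade `n`, i.e. with grade and projective
dimension both equal to `n`. -/
def PerfectModules (n : ℕ) : ObjectProperty (ModuleCat.{u} R) := fun M =>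
  Module.Finite R M ∧ grade M = n ∧ projectiveDimension M = n

/-- `P_K(R)`: the modules isomorphic to `P ⊗_R K` with `P` finitely generated projective. -/
def KProjective (K : ModuleCat.{u} R) : ObjectProperty (ModuleCat.{u} R) := fun M =>
  ∃ P : ModuleCat.{u} R, Module.Finite R P ∧ Module.Projective R P ∧
    Nonempty (M ≅ (tensorFunctor K).obj P)

/-- There is an exact sequence `0 → X_t → ⋯ → X_0 → M → 0` with all `X_i` in `P_K(R)`. -/
def HasKProjectiveResolution (K M : ModuleCat.{u} R) (t : ℕ) : Prop :=
  ∃ (X : ℕ → ModuleCat.{u} R) (d : ∀ i, X (i + 1) →ₗ[R] X i) (ε : X 0 →ₗ[R] M),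
    (∀ i, KProjective K (X i)) ∧ (∀ i, t < i → Subsingleton (X i)) ∧
    Function.Surjective ε ∧ Function.Exact (d 0) ε ∧ ∀ i, Function.Exact (d (i + 1)) (d i)

/-- The `P_K`-dimension of `M`, equal to `⊤` if there is no finite `P_K`-resolution. -/
def kProjectiveDimension (K M : ModuleCat.{u} R) : ℕ∞ :=
  ⨅ (t : ℕ) (_ : HasKProjectiveResolution K M t), (t : ℕ∞)

/-- `P^n_K(R)`: finitely generated `P_K`-perfect modules of grade `n`, i.e. with grade and
`P_K`-dimension both equal to `n`. -/
def KPerfectModules (n : ℕ) (K : ModuleCat.{u} R) : ObjectProperty (ModuleCat.{u} R) := fun M =>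
  Module.Finite R M ∧ grade M = n ∧ kProjectiveDimension K M = n

end Perfect

section Equivalences

variable {R : Type u} [CommRing R]

/-- The functors `- ⊗_R K` and `Hom_R(K, -)` restrict to functors between the full subcategories
`P` and `Q`, where they form an adjoint equivalence whose unit is `μ` and whose counit is `ν` (up
to the order of the tensor factors). -/
def RestrictsToAdjointEquivalence (K : ModuleCat.{u} R)
    (P Q : ObjectProperty (ModuleCat.{u} R)) : Prop :=
  ∃ (hF : ∀ M : P.FullSubcategory, Q ((P.ι ⋙ tensorFunctor K).obj M))
    (hG : ∀ N : Q.FullSubcategory, P ((Q.ι ⋙ homFunctor K).obj N))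
    (adj : Q.lift (P.ι ⋙ tensorFunctor K) hF ⊣ P.lift (Q.ι ⋙ homFunctor K) hG),
    (Q.lift (P.ι ⋙ tensorFunctor K) hF).IsEquivalence ∧
    (P.lift (Q.ι ⋙ homFunctor K) hG).IsEquivalence ∧
    (∀ M : P.FullSubcategory, (adj.unit.app M).hom.hom = mu K M.obj) ∧
    (∀ N : Q.FullSubcategory, (adj.counit.app N).hom.hom =
      nu K N.obj ∘ₗ (TensorProduct.comm R (K →ₗ[R] N.obj) K).toLinearMap)

end Equivalences

end

end Linkage

open Linkage

namespace Linkage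

noncomputable section

open Abelian

variable {R : Type u} [CommRing R]

/-! ### Functoriality of Ext and long exact sequences. -/

section ExtFunctoriality

variable {X Y Z K L N : ModuleCat.{u} R} {n : ℕ}

/-! Let `X` have grade `n`, `I = ann X` and `W = Ext^n(R/I, K)`. Since `Ext^i(-, K)` vanishes for `i
< n` on every module killed by `I`, the functor `Ext^n(-, K)` is left exact on the finitely
generated ones and is represented there by `W` (`extToHom_bijective`). Biduality then becomes
evaluation into a double `W`-dual, and links can be treated as if `n` were `0`.

This gives an intrinsic criterion for linkage (take `K = R`). Under `η_X`, the kernel of the double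
link of `φ : X → M` is the set of `x` killed by every map `X → W` that vanishes on `ker φ`. It
equals `ker φ` exactly when `M = X / ker φ` embeds in a product of copies of `W`. So `M` is linked
if and only if some non-injective `φ` in `Epi(𝒳)` has such an image (`IsLinked.exists_isEpiFrom`,
`isLinked_of_isEpiFrom`). Colinking sees only `Hom(K, ker φ)`. The criterion, with the `W` of `K`,
is necessary again, and it suffices for `M` in `Δ_K` if `Hom(K, φ)` is surjective, because `ker φ`
is then generated by images of `K` (`ker_le_span_range`).

The two criteria correspond because `Hom(K, Ext^n(R/I, K)) ≅ Ext^n(R/I, R)`, a consequence of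
`Hom(K, K) = R` and `Ext^j(K, K) = 0` for `j > 0` (`IsSemidualizing.nonempty_extQuot_equiv`). A
semidualizing module is faithful, so `Hom(K, L) = 0` or `K ⊗ L = 0` forces `L = 0` for finitely
generated `L`; this yields surjectivity of `Hom(K, φ)` and reflects cogeneration by `W`. On `∇_K`
and `Δ_K` the functors preserve annihilators, hence grades. The equivalence is then formal, its unit
and counit being bijective.

For (b), the perfect modules form an `n`-adjoint pair, and the exchange of (a) respects the
Auslander and Bass classes. Projective resolutions and `P_K`-resolutions correspond, since both
classes are closed under cokernels of injections. Dualizing a resolution gives `Ext^n(Ext^n(M, R),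
R) ≅ M`; an abstract isomorphism is enough, because surjective endomorphisms of Noetherian modules
are injective (`eta_bijective_of_equiv`). Coreflexivity follows through `Ext^n(X, R) ⊗ K ≅ Ext^n(X,
K)` for `X` of projective dimension at most `n`. -/

theorem extPull_apply (f : X →ₗ[R] Y) (e : extMod n Y K) :
    extPull n X Y K f e = (Ext.mk₀ (ModuleCat.ofHom f)).comp e (zero_add n) := rfl

theorem extPull_id (e : extMod n X K) : extPull n X X K LinearMap.id e = e :=
  Ext.mk₀_id_comp e

theorem extPull_comp (g : Y →ₗ[R] Z) (f : X →ₗ[R] Y) (e : extMod n Z K) :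
    extPull n X Z K (g ∘ₗ f) e = extPull n X Y K f (extPull n Y Z K g e) := by
  rw [extPull_apply, extPull_apply, extPull_apply, Ext.mk₀_comp_mk₀_assoc, ModuleCat.ofHom_comp]

/-- Functoriality of `Ext^n_R(X, -)`, linear in both arguments. -/
def extPush (n : ℕ) (X K L : ModuleCat.{u} R) :
    (K →ₗ[R] L) →ₗ[R] (extMod n X K →ₗ[R] extMod n X L) :=
  (Ext.bilinearCompOfLinear R X K L n 0 n (add_zero n)).flip ∘ₗ
    (Ext.linearEquiv₀ (R := R) (X := K) (Y := L)).symm.toLinearMap ∘ₗ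
    (ModuleCat.homLinearEquiv (S := R) (M := K) (N := L)).symm.toLinearMap

theorem extPush_apply (f : K →ₗ[R] L) (e : extMod n X K) :
    extPush n X K L f e = e.comp (Ext.mk₀ (ModuleCat.ofHom f)) (add_zero n) := rfl

theorem extPush_id (e : extMod n X K) : extPush n X K K LinearMap.id e = e :=
  Ext.comp_mk₀_id e

theorem extPush_comp (g : L →ₗ[R] N) (f : K →ₗ[R] L) (e : extMod n X K) :
    extPush n X K N (g ∘ₗ f) e = extPush n X L N g (extPush n X K L f e) := by
  rw [extPush_apply, extPush_apply, extPush_apply, ModuleCat.ofHom_comp, Ext.comp_assoc_of_third_deg_zero, Ext.mk₀_comp_mk₀]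

/-- Isomorphic modules have isomorphic `Ext` in the first variable. -/
def extPullEquiv (n : ℕ) (K : ModuleCat.{u} R) (f : X ≃ₗ[R] Y) :
    extMod n Y K ≃ₗ[R] extMod n X K :=
  LinearEquiv.ofLinearMap (extPull n X Y K f.toLinearMap) (extPull n Y X K f.symm.toLinearMap)
    (LinearMap.ext fun e => by
      rw [LinearMap.comp_apply, ← extPull_comp]; simpa using! extPull_id e)
    (LinearMap.ext fun e => by
      rw [LinearMap.comp_apply, ← extPull_comp]; simpa using! extPull_id e)

/-- Isomorphic modules have isomorphic `Ext` in the second variable. -/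
def extPushEquiv (n : ℕ) (X : ModuleCat.{u} R) (f : K ≃ₗ[R] L) :
    extMod n X K ≃ₗ[R] extMod n X L :=
  LinearEquiv.ofLinearMap (extPush n X K L f.toLinearMap) (extPush n X L K f.symm.toLinearMap)
    (LinearMap.ext fun e => by
      rw [LinearMap.comp_apply, ← extPush_comp]; simpa using! extPush_id e)
    (LinearMap.ext fun e => by
      rw [LinearMap.comp_apply, ← extPush_comp]; simpa using! extPush_id e)

/-- `Ext^0_R(X, K)` is `Hom_R(X, K)`. -/
def extZeroEquiv (X K : ModuleCat.{u} R) : extMod 0 X K ≃ₗ[R] (X →ₗ[R] K) :=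
  (Ext.linearEquiv₀ (R := R) (X := X) (Y := K)).trans ModuleCat.homLinearEquiv

theorem extZeroEquiv_symm_apply (f : X →ₗ[R] K) :
    (extZeroEquiv X K).symm f = Ext.mk₀ (ModuleCat.ofHom f) := rfl

theorem extZeroEquiv_extPull (f : X →ₗ[R] Y) (e : extMod 0 Y K) :
    extZeroEquiv X K (extPull 0 X Y K f e) = extZeroEquiv Y K e ∘ₗ f := by
  obtain ⟨g, rfl⟩ := (extZeroEquiv Y K).symm.surjective e
  apply (extZeroEquiv X K).symm.injective
  rw [LinearEquiv.symm_apply_apply, LinearEquiv.apply_symm_apply, extZeroEquiv_symm_apply,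
    extZeroEquiv_symm_apply, extPull_apply, Ext.mk₀_comp_mk₀]
  rfl

theorem extZeroEquiv_extPush (f : K →ₗ[R] L) (e : extMod 0 X K) :
    extZeroEquiv X L (extPush 0 X K L f e) = f ∘ₗ extZeroEquiv X K e := by
  obtain ⟨g, rfl⟩ := (extZeroEquiv X K).symm.surjective e
  apply (extZeroEquiv X L).symm.injective
  rw [LinearEquiv.symm_apply_apply, LinearEquiv.apply_symm_apply, extZeroEquiv_symm_apply,
    extZeroEquiv_symm_apply, extPush_apply, Ext.mk₀_comp_mk₀]
  rfl

theorem subsingleton_ext_zero_iff :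
    Subsingleton (extMod 0 X K) ↔ Subsingleton (X →ₗ[R] K) :=
  (extZeroEquiv X K).toEquiv.subsingleton_congr

theorem subsingleton_ext_of_projective [Module.Projective R X] {i : ℕ} (hi : 0 < i) :
    Subsingleton (extMod i X K) := by
  obtain ⟨i, rfl⟩ := Nat.exists_eq_succ_of_ne_zero hi.ne'
  have : Projective X := X.projective_of_categoryTheory_projective
  exact Ext.subsingleton_of_projective X K i

theorem subsingleton_ext_of_subsingleton_left [Subsingleton X] (i : ℕ) (K : ModuleCat.{u} R) :
    Subsingleton (extMod i X K) := by
  refine subsingleton_of_forall_eq 0 fun e => ?_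
  have h : (LinearMap.id : X →ₗ[R] X) = 0 := LinearMap.ext fun x => Subsingleton.elim _ _
  rw [← extPull_id e, h, map_zero, LinearMap.zero_apply]

end ExtFunctoriality

section LongExactSequences

variable {A B C : ModuleCat.{u} R} {f : A →ₗ[R] B} {g : B →ₗ[R] C}

theorem shortExact_of_exact (hf : Function.Injective f) (hfg : Function.Exact f g)
    (hg : Function.Surjective g) :
    (ModuleCat.shortComplexOfCompEqZero f g hfg.linearMap_comp_eq_zero).ShortExact :=
  ModuleCat.shortComplex_shortExact _ hfg hf hg

/-- The long exact sequence of `Ext_R(-, K)` at the middle term. -/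
theorem extPull_exact (hf : Function.Injective f) (hfg : Function.Exact f g)
    (hg : Function.Surjective g) (n : ℕ) (K : ModuleCat.{u} R) :
    Function.Exact (extPull n B C K g) (extPull n A B K f) := by
  have S := shortExact_of_exact hf hfg hg
  intro e
  constructor
  · exact fun h => Ext.contravariant_sequence_exact₂ S K e h
  · rintro ⟨e, rfl⟩
    rw [← extPull_comp, hfg.linearMap_comp_eq_zero]
    simp

/-- The connecting homomorphism of the long exact sequence of `Ext_R(-, K)`. -/
theorem exists_extPull_connecting (hf : Function.Injective f) (hfg : Function.Exact f g)
    (hg : Function.Surjective g) (n : ℕ) (K : ModuleCat.{u} R) :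
    ∃ δ : extMod n A K →ₗ[R] extMod (n + 1) C K,
      Function.Exact (extPull n A B K f) δ ∧ Function.Exact δ (extPull (n + 1) B C K g) := by
  have S := shortExact_of_exact hf hfg hg
  refine ⟨S.extClass.precompOfLinear R K (add_comm 1 n), fun e => ⟨fun h => ?_, ?_⟩,
    fun e => ⟨fun h => ?_, ?_⟩⟩
  · exact Ext.contravariant_sequence_exact₁ S K e (add_comm 1 n) h
  · rintro ⟨e, rfl⟩
    change S.extClass.comp ((Ext.mk₀ (ModuleCat.ofHom f)).comp e (zero_add n)) (add_comm 1 n) = 0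
    rw [← Ext.comp_assoc_of_second_deg_zero]
    have := S.extClass_comp
    simp only at this
    rw [this, Ext.zero_comp]
  · exact Ext.contravariant_sequence_exact₃ S K e h (add_comm 1 n)
  · rintro ⟨e, rfl⟩
    change (Ext.mk₀ (ModuleCat.ofHom g)).comp (S.extClass.comp e (add_comm 1 n)) (zero_add (n + 1)) = 0
    rw [← Ext.comp_assoc (h₁₂ := zero_add 1) (h := by omega)]
    have := S.comp_extClass
    simp only at this
    rw [this, Ext.zero_comp]

/-- The long exact sequence of `Ext_R(X, -)` at the middle term. -/
theorem extPush_exact (hf : Function.Injective f) (hfg : Function.Exact f g)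
    (hg : Function.Surjective g) (n : ℕ) (X : ModuleCat.{u} R) :
    Function.Exact (extPush n X A B f) (extPush n X B C g) := by
  have S := shortExact_of_exact hf hfg hg
  intro e
  constructor
  · exact fun h => Ext.covariant_sequence_exact₂ X S e h
  · rintro ⟨e, rfl⟩
    rw [← extPush_comp, hfg.linearMap_comp_eq_zero]
    simp

/-- The connecting homomorphism of the long exact sequence of `Ext_R(X, -)`. -/
theorem exists_extPush_connecting (hf : Function.Injective f) (hfg : Function.Exact f g)
    (hg : Function.Surjective g) (n : ℕ) (X : ModuleCat.{u} R) :
    ∃ δ : extMod n X C →ₗ[R] extMod (n + 1) X A,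
      Function.Exact (extPush n X B C g) δ ∧ Function.Exact δ (extPush (n + 1) X A B f) := by
  have S := shortExact_of_exact hf hfg hg
  refine ⟨S.extClass.postcompOfLinear R X rfl, fun e => ⟨fun h => ?_, ?_⟩,
    fun e => ⟨fun h => ?_, ?_⟩⟩
  · exact Ext.covariant_sequence_exact₃ X S e rfl h
  · rintro ⟨e, rfl⟩
    change (Ext.comp e (Ext.mk₀ (ModuleCat.ofHom g)) (add_zero n)).comp S.extClass rfl = 0
    rw [Ext.comp_assoc_of_second_deg_zero]
    have := S.comp_extClass
    simp only at this
    rw [this, Ext.comp_zero]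
  · exact Ext.covariant_sequence_exact₁ X S e h rfl
  · rintro ⟨e, rfl⟩
    change (Ext.comp e S.extClass rfl).comp (Ext.mk₀ (ModuleCat.ofHom f)) (add_zero (n + 1)) = 0
    rw [Ext.comp_assoc_of_third_deg_zero]
    have := S.extClass_comp
    simp only at this
    rw [this, Ext.comp_zero]

theorem subsingleton_of_exact {M₁ M₂ M₃ : Type*} [AddCommGroup M₁] [AddCommGroup M₂]
    [AddCommGroup M₃] [Module R M₁] [Module R M₂] [Module R M₃] {a : M₁ →ₗ[R] M₂}
    {b : M₂ →ₗ[R] M₃} (h : Function.Exact a b) [Subsingleton M₁] [Subsingleton M₃] :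
    Subsingleton M₂ := by
  refine subsingleton_of_forall_eq 0 fun x => ?_
  obtain ⟨y, rfl⟩ := (h x).mp (Subsingleton.elim _ _)
  rw [Subsingleton.elim y 0, map_zero]

theorem injective_of_exact {M₁ M₂ M₃ : Type*} [AddCommGroup M₁] [AddCommGroup M₂]
    [AddCommGroup M₃] [Module R M₁] [Module R M₂] [Module R M₃] {a : M₁ →ₗ[R] M₂}
    {b : M₂ →ₗ[R] M₃} (h : Function.Exact a b) [Subsingleton M₁] : Function.Injective b := by
  refine (injective_iff_map_eq_zero b).mpr fun x hx => ?_
  obtain ⟨y, rfl⟩ := (h x).mp hx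
  rw [Subsingleton.elim y 0, map_zero]

theorem surjective_of_exact {M₁ M₂ M₃ : Type*} [AddCommGroup M₁] [AddCommGroup M₂]
    [AddCommGroup M₃] [Module R M₁] [Module R M₂] [Module R M₃] {a : M₁ →ₗ[R] M₂}
    {b : M₂ →ₗ[R] M₃} (h : Function.Exact a b) [Subsingleton M₃] : Function.Surjective a :=
  fun x => (h x).mp (Subsingleton.elim _ _)

/-- `Ext_R(-, K)` is left exact in the lowest degree in which it does not vanish. -/
theorem extPull_injective (hf : Function.Injective f) (hfg : Function.Exact f g)
    (hg : Function.Surjective g) (n : ℕ) (K : ModuleCat.{u} R)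
    (h : ∀ i < n, Subsingleton (extMod i A K)) : Function.Injective (extPull n B C K g) := by
  cases n with
  | zero =>
    intro a b hab
    apply (extZeroEquiv C K).injective
    have := congrArg (extZeroEquiv B K) hab
    rw [extZeroEquiv_extPull, extZeroEquiv_extPull] at this
    exact (LinearMap.cancel_right hg).mp this
  | succ n =>
    obtain ⟨δ, -, h2⟩ := exists_extPull_connecting hf hfg hg n K
    have := h n (Nat.lt_succ_self n)
    exact injective_of_exact h2

/-- `Ext_R(X, -)` is left exact in the lowest degree in which it does not vanish. -/
theorem extPush_injective (hf : Function.Injective f) (hfg : Function.Exact f g)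
    (hg : Function.Surjective g) (n : ℕ) (X : ModuleCat.{u} R)
    (h : ∀ i < n, Subsingleton (extMod i X C)) : Function.Injective (extPush n X A B f) := by
  cases n with
  | zero =>
    intro a b hab
    apply (extZeroEquiv X A).injective
    have := congrArg (extZeroEquiv X B) hab
    rw [extZeroEquiv_extPush, extZeroEquiv_extPush] at this
    exact (LinearMap.cancel_left hf).mp this
  | succ n =>
    obtain ⟨δ, -, h2⟩ := exists_extPush_connecting hf hfg hg n X
    have := h n (Nat.lt_succ_self n)
    exact injective_of_exact h2

end LongExactSequences

/-! ### Syzygies and exactness of Hom. -/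

section Syzygies

variable [IsNoetherianRing R]

instance finite_extMod (n : ℕ) (X K : ModuleCat.{u} R) [Module.Finite R X] [Module.Finite R K] :
    Module.Finite R (extMod n X K) :=
  ModuleCat.finite_ext R X K n

/-- Every finitely generated module has a finite free cover with a finitely generated kernel. -/
theorem exists_syzygy (M : ModuleCat.{u} R) [Module.Finite R M] :
    ∃ (a : ℕ) (Z : ModuleCat.{u} R) (i : Z →ₗ[R] ModuleCat.of R (Fin a → R))
      (p : ModuleCat.of R (Fin a → R) →ₗ[R] M), Module.Finite R Z ∧ Function.Injective i ∧
      Function.Exact i p ∧ Function.Surjective p := by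
  obtain ⟨a, p, hp⟩ := Module.Finite.exists_fin' R M
  exact ⟨a, ModuleCat.of R (LinearMap.ker p), (LinearMap.ker p).subtype, p,
    Module.IsNoetherian.finite R (LinearMap.ker p), Subtype.val_injective,
    LinearMap.exact_subtype_ker_map p, hp⟩

end Syzygies

section HomExactness

variable {A B C : ModuleCat.{u} R} {f : A →ₗ[R] B} {g : B →ₗ[R] C}

theorem exists_comp_eq_of_subsingleton_ext_one_left (hf : Function.Injective f)
    (hfg : Function.Exact f g) (hg : Function.Surjective g) (X : ModuleCat.{u} R)
    [Subsingleton (extMod 1 X A)] (h : X →ₗ[R] C) : ∃ h' : X →ₗ[R] B, g ∘ₗ h' = h := by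
  obtain ⟨δ, h1, -⟩ := exists_extPush_connecting hf hfg hg 0 X
  obtain ⟨e, he⟩ := (h1 ((extZeroEquiv X C).symm h)).mp (Subsingleton.elim _ _)
  refine ⟨extZeroEquiv X B e, ?_⟩
  rw [← extZeroEquiv_extPush, he, LinearEquiv.apply_symm_apply]

theorem exists_comp_eq_of_subsingleton_ext_one_right (hf : Function.Injective f)
    (hfg : Function.Exact f g) (hg : Function.Surjective g) (K : ModuleCat.{u} R)
    [Subsingleton (extMod 1 C K)] (h : A →ₗ[R] K) : ∃ h' : B →ₗ[R] K, h' ∘ₗ f = h := by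
  obtain ⟨δ, h1, -⟩ := exists_extPull_connecting hf hfg hg 0 K
  obtain ⟨e, he⟩ := (h1 ((extZeroEquiv A K).symm h)).mp (Subsingleton.elim _ _)
  refine ⟨extZeroEquiv B K e, ?_⟩
  rw [← extZeroEquiv_extPull, he, LinearEquiv.apply_symm_apply]

/-- `Hom(X, -)` applied to a linear map. -/
abbrev homPush (X : ModuleCat.{u} R) {A B : ModuleCat.{u} R} (f : A →ₗ[R] B) :
    homMod X A →ₗ[R] homMod X B :=
  LinearMap.llcomp R X A B f

/-- `Hom(-, K)` applied to a linear map. -/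
abbrev homPull (K : ModuleCat.{u} R) {A B : ModuleCat.{u} R} (f : A →ₗ[R] B) :
    homMod B K →ₗ[R] homMod A K :=
  LinearMap.lcomp R K f

theorem homPush_injective (hf : Function.Injective f) (X : ModuleCat.{u} R) :
    Function.Injective (homPush X f) :=
  fun _ _ h => (LinearMap.cancel_left hf).mp h

theorem homPush_exact (hf : Function.Injective f) (hfg : Function.Exact f g)
    (X : ModuleCat.{u} R) : Function.Exact (homPush X f) (homPush X g) := by
  intro h
  constructor
  · intro h0
    have hmem : ∀ x, ∃ a, f a = h x := fun x => (hfg (h x)).mp (LinearMap.congr_fun h0 x)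
    refine ⟨(LinearEquiv.ofInjective f hf).symm.toLinearMap ∘ₗ
      LinearMap.codRestrict (LinearMap.range f) h hmem, ?_⟩
    ext x
    exact congrArg Subtype.val ((LinearEquiv.ofInjective f hf).apply_symm_apply
      (LinearMap.codRestrict (LinearMap.range f) h hmem x))
  · rintro ⟨h, rfl⟩
    exact LinearMap.ext fun x => hfg.apply_apply_eq_zero (h x)

theorem homPush_surjective (hf : Function.Injective f) (hfg : Function.Exact f g)
    (hg : Function.Surjective g) (X : ModuleCat.{u} R) [Subsingleton (extMod 1 X A)] :
    Function.Surjective (homPush X g) :=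
  exists_comp_eq_of_subsingleton_ext_one_left hf hfg hg X

theorem homPull_injective (hg : Function.Surjective g) (K : ModuleCat.{u} R) :
    Function.Injective (homPull K g) :=
  fun _ _ h => (LinearMap.cancel_right hg).mp h

theorem homPull_exact (hfg : Function.Exact f g) (hg : Function.Surjective g)
    (K : ModuleCat.{u} R) : Function.Exact (homPull K g) (homPull K f) := by
  intro h
  constructor
  · intro h0
    have hle : LinearMap.ker g ≤ LinearMap.ker h := by
      intro x hx
      obtain ⟨a, rfl⟩ := (hfg x).mp hx
      exact LinearMap.congr_fun h0 a
    refine ⟨(LinearMap.ker g).liftQ h hle ∘ₗ (g.quotKerEquivOfSurjective hg).symm.toLinearMap,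
      LinearMap.ext fun x => ?_⟩
    have : (g.quotKerEquivOfSurjective hg).symm (g x) = (LinearMap.ker g).mkQ x := by
      rw [LinearEquiv.symm_apply_eq]; rfl
    change (LinearMap.ker g).liftQ h hle ((g.quotKerEquivOfSurjective hg).symm (g x)) = h x
    rw [this]; rfl
  · rintro ⟨h, rfl⟩
    refine LinearMap.ext fun x => ?_
    change h (g (f x)) = 0
    rw [hfg.apply_apply_eq_zero, map_zero]

theorem homPull_surjective (hf : Function.Injective f) (hfg : Function.Exact f g)
    (hg : Function.Surjective g) (K : ModuleCat.{u} R) [Subsingleton (extMod 1 C K)] :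
    Function.Surjective (homPull K f) :=
  exists_comp_eq_of_subsingleton_ext_one_right hf hfg hg K

end HomExactness

/-! ### Faithful modules, semidualizing modules and grade. -/

section Faithful

variable [IsNoetherianRing R] {K : Type u} [AddCommGroup K] [Module R K] [Module.Finite R K]

/-- Vanishing of `Hom(K, L)` provides an element of `ann K` that is regular on `L`. By faithfulness
this element is `0`, and `0` is regular only on the zero module. -/
theorem subsingleton_of_subsingleton_hom (hK : Module.annihilator R K = ⊥) {L : Type u}
    [AddCommGroup L] [Module R L] [Module.Finite R L] (h : Subsingleton (K →ₗ[R] L)) :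
    Subsingleton L := by
  obtain ⟨r, hr, hreg⟩ := IsSMulRegular.subsingleton_linearMap_iff.mp h
  rw [hK, Ideal.mem_bot] at hr
  subst hr
  exact ⟨fun x y => hreg (by simp)⟩

/-- By adjunction `Hom(K, End L) = Hom(K ⊗ L, L) = 0`, so `End L = 0` and the identity of `L`
vanishes. -/
theorem subsingleton_of_subsingleton_tensor (hK : Module.annihilator R K = ⊥) {L : Type u}
    [AddCommGroup L] [Module R L] [Module.Finite R L]
    (h : Subsingleton (TensorProduct R K L)) : Subsingleton L := by
  have h1 : Subsingleton (K →ₗ[R] (L →ₗ[R] L)) := by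
    refine subsingleton_of_forall_eq 0 fun f => LinearMap.ext₂ fun k l => ?_
    have : TensorProduct.lift f (k ⊗ₜ l) = 0 := by
      rw [Subsingleton.elim (k ⊗ₜ[R] l) 0, map_zero]
    rwa [TensorProduct.lift.tmul] at this
  have h2 := subsingleton_of_subsingleton_hom hK h1
  exact ⟨fun x y => by
    rw [← LinearMap.id_apply (R := R) x, ← LinearMap.id_apply (R := R) y,
      Subsingleton.elim (LinearMap.id : L →ₗ[R] L) 0]; rfl⟩

end Faithful

/-- A map from `K` into the `r`-torsion of `B` is an `r`-torsion element of `Hom(K, B)`, hence zero;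
faithfulness of `K` then kills the torsion submodule. -/
theorem isSMulRegular_of_hom [IsNoetherianRing R] {K : Type u} [AddCommGroup K] [Module R K]
    [Module.Finite R K] (hK : Module.annihilator R K = ⊥) {B : Type u} [AddCommGroup B]
    [Module R B] [Module.Finite R B] {r : R} (hr : IsSMulRegular (K →ₗ[R] B) r) :
    IsSMulRegular B r := by
  have h1 : Subsingleton (K →ₗ[R] LinearMap.ker (LinearMap.lsmul R B r)) := by
    refine subsingleton_of_forall_eq 0 fun f => ?_
    have h2 : (LinearMap.ker (LinearMap.lsmul R B r)).subtype ∘ₗ f = 0 := by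
      refine hr (LinearMap.ext fun k => ?_)
      change r • (f k : B) = r • 0
      rw [smul_zero]
      exact LinearMap.mem_ker.mp (f k).2
    ext k
    exact LinearMap.congr_fun h2 k
  have h3 := subsingleton_of_subsingleton_hom hK h1
  intro x y hxy
  have hmem : x - y ∈ LinearMap.ker (LinearMap.lsmul R B r) := by
    rw [LinearMap.mem_ker, LinearMap.lsmul_apply, smul_sub, sub_eq_zero]; exact hxy
  have := Subsingleton.elim (⟨x - y, hmem⟩ : LinearMap.ker (LinearMap.lsmul R B r)) 0
  exact sub_eq_zero.mp (congrArg Subtype.val this)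

open Pointwise in
/-- If `Ext^i_R(K, B) = 0` for `i > 0` and `Ext^i_R(M, Hom_R(K, B)) = 0` for `i < n`, then
`Ext^i_R(N, B) = 0` for `i < n` and all modules `N` annihilated by the annihilator of `M`. -/
theorem subsingleton_ext_of_annihilator_le [IsNoetherianRing R] {K : ModuleCat.{u} R}
    [Module.Finite R K] (hK : Module.annihilator R K = ⊥) (M : ModuleCat.{u} R)
    [Module.Finite R M] (N : ModuleCat.{u} R)
    (hMN : Module.annihilator R M ≤ Module.annihilator R N) (n : ℕ) (B : ModuleCat.{u} R)
    [Module.Finite R B] (hB : ∀ i, 0 < i → Subsingleton (extMod i K B))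
    (hM : ∀ i < n, Subsingleton (extMod i M (homMod K B))) :
    ∀ i < n, Subsingleton (extMod i N B) := by
  induction n generalizing B with
  | zero => exact fun i hi => absurd hi (Nat.not_lt_zero i)
  | succ n ih =>
    -- The element `r` of `ann M` is regular on `Hom(K, B)`, hence on `B`. Both hypotheses pass to
    -- `B / rB` with `n` lowered by one, because `Ext^1(K, B) = 0` identifies `Hom(K, B / rB)` with
    -- `Hom(K, B) / r Hom(K, B)`.
    obtain ⟨r, hr, hreg⟩ := IsSMulRegular.subsingleton_linearMap_iff.mp
      (subsingleton_ext_zero_iff.mp (hM 0 n.succ_pos))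
    have hrB : IsSMulRegular B r := isSMulRegular_of_hom hK hreg
    let B' : ModuleCat.{u} R := ModuleCat.of R (QuotSMulTop r B)
    let f : B →ₗ[R] B := LinearMap.lsmul R B r
    let g : B →ₗ[R] B' := (r • (⊤ : Submodule R B)).mkQ
    have hf : Function.Injective f := hrB
    have hfg : Function.Exact f g := LinearMap.exact_lsmul_mkQ_smul_top B r
    have hg : Function.Surjective g := Submodule.mkQ_surjective _
    have hB' : ∀ i, 0 < i → Subsingleton (extMod i K B') := by
      intro i hi
      obtain ⟨δ, h1, -⟩ := exists_extPush_connecting hf hfg hg i K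
      have := hB i hi
      have := hB (i + 1) i.succ_pos
      exact subsingleton_of_exact h1
    have := hB 1 one_pos
    have hM' : ∀ i < n, Subsingleton (extMod i M (homMod K B')) := by
      intro i hi
      obtain ⟨δ, h1, -⟩ := exists_extPush_connecting (homPush_injective hf K)
        (homPush_exact hf hfg K) (homPush_surjective hf hfg hg K) i M
      have := hM i (by omega)
      have := hM (i + 1) (by omega)
      exact subsingleton_of_exact h1
    have hN := ih B' hB' hM'
    rintro (_ | i) hi
    · exact subsingleton_ext_zero_iff.mpr
        (IsSMulRegular.linearMap_subsingleton_of_mem_annihilator hrB (hMN hr))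
    · obtain ⟨δ, -, h2⟩ := exists_extPush_connecting hf hfg hg i N
      have := hN i (by omega)
      -- Multiplication by `r` on `Ext^{i+1}(N, B)` is injective by the long exact sequence and zero
      -- because `r` annihilates `N`.
      refine subsingleton_of_forall_eq 0 fun e => injective_of_exact h2 ?_
      have hsmul : f = r • LinearMap.id := rfl
      rw [map_zero, hsmul, map_smul, LinearMap.smul_apply]
      exact Module.mem_annihilator.mp (annihilator_le_annihilator_ext (i + 1) B N (hMN hr)) _

section Semidualizing

variable {K : ModuleCat.{u} R}

theorem IsSemidualizing.annihilator_eq_bot (hK : IsSemidualizing K) :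
    Module.annihilator R K = ⊥ := by
  refine eq_bot_iff.mpr fun r hr => hK.homothety.1 ?_
  rw [map_zero]
  exact LinearMap.ext fun k => Module.mem_annihilator.mp hr k

/-- The homothety isomorphism `R ≅ Hom_R(K, K)`. -/
def IsSemidualizing.homothetyEquiv (hK : IsSemidualizing K) : ringMod R ≃ₗ[R] homMod K K :=
  LinearEquiv.ofBijective (LinearMap.lsmul R K : R →ₗ[R] (K →ₗ[R] K)) hK.homothety

theorem isSemidualizing_ringMod (R : Type u) [CommRing R] : IsSemidualizing (ringMod R) where
  finite := inferInstanceAs (Module.Finite R R)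
  homothety := by
    refine ⟨fun a b h => by simpa using LinearMap.congr_fun h (1 : R), fun f => ⟨f (1 : R), ?_⟩⟩
    refine LinearMap.ext_ring ?_
    change f (1 : R) * 1 = f (1 : R)
    rw [mul_one]
  ext_eq_zero i hi :=
    have : Module.Projective R (ringMod R) := inferInstanceAs (Module.Projective R R)
    subsingleton_ext_of_projective hi

/-- If `Ext^i_R(M, R) = 0` for `i < n`, then `Ext^i_R(N, K) = 0` for `i < n` and all modules `N`
annihilated by the annihilator of `M`, whenever `K` is semidualizing. -/
theorem IsSemidualizing.subsingleton_ext [IsNoetherianRing R] (hK : IsSemidualizing K)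
    {M N : ModuleCat.{u} R} [Module.Finite R M]
    (hMN : Module.annihilator R M ≤ Module.annihilator R N) {n : ℕ}
    (hM : ∀ i < n, Subsingleton (extMod i M (ringMod R))) :
    ∀ i < n, Subsingleton (extMod i N K) := by
  have := hK.finite
  refine subsingleton_ext_of_annihilator_le hK.annihilator_eq_bot M N hMN n K hK.ext_eq_zero
    fun i hi => ?_
  have := hM i hi
  exact (extPushEquiv i M hK.homothetyEquiv).symm.toEquiv.subsingleton

end Semidualizing

section Grade

variable {M N : ModuleCat.{u} R} {n : ℕ}

theorem natCast_le_grade_iff :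
    (n : ℕ∞) ≤ grade M ↔ ∀ i < n, Subsingleton (extMod i M (ringMod R)) := by
  rw [grade, le_iInf₂_iff]
  constructor
  · intro h i hi
    by_contra hns
    exact absurd (h i (not_subsingleton_iff_nontrivial.mp hns)) (by simpa using hi)
  · intro h i hi
    by_contra hlt
    exact (not_subsingleton_iff_nontrivial.mpr hi) (h i (by simpa using hlt))

theorem grade_eq_natCast_iff :
    grade M = n ↔ (∀ i < n, Subsingleton (extMod i M (ringMod R))) ∧
      Nontrivial (extMod n M (ringMod R)) := by
  rw [← natCast_le_grade_iff]
  constructor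
  · intro h
    refine ⟨h.ge, ?_⟩
    by_contra hns
    have : ((n + 1 : ℕ) : ℕ∞) ≤ grade M := by
      refine natCast_le_grade_iff.mpr fun i hi => ?_
      rcases Nat.lt_succ_iff_lt_or_eq.mp hi with hi | rfl
      · exact natCast_le_grade_iff.mp h.ge i hi
      · exact not_nontrivial_iff_subsingleton.mp hns
    rw [h, Nat.cast_le] at this
    omega
  · rintro ⟨h1, h2⟩
    exact le_antisymm (iInf₂_le n h2) h1

/-- This is the preceding vanishing theorem for the semidualizing module `R`: the grade depends only
on the annihilator, which is how grades are transported along `- ⊗ K` and `Hom(K, -)`. -/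
theorem grade_le_grade [IsNoetherianRing R] [Module.Finite R M]
    (h : Module.annihilator R M ≤ Module.annihilator R N) : grade M ≤ grade N := by
  refine ENat.forall_natCast_le_iff_le.mp fun n hn => ?_
  exact natCast_le_grade_iff.mpr ((isSemidualizing_ringMod R).subsingleton_ext h
    (natCast_le_grade_iff.mp hn))

theorem grade_eq_of_annihilator_eq [IsNoetherianRing R] [Module.Finite R M] [Module.Finite R N]
    (h : Module.annihilator R M = Module.annihilator R N) : grade M = grade N :=
  le_antisymm (grade_le_grade h.le) (grade_le_grade h.ge)

theorem nontrivial_of_grade_eq (h : grade M = n) : Nontrivial M := by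
  by_contra hns
  rw [not_nontrivial_iff_subsingleton] at hns
  have := subsingleton_ext_of_subsingleton_left (X := M) n (ringMod R)
  exact not_nontrivial_iff_subsingleton.mpr this (grade_eq_natCast_iff.mp h).2

end Grade

/-! ### Cogeneration and the module representing Ext in degree `n`. -/

section Cogenerated

/-- `M` embeds into a product of copies of `W`. -/
def IsCogeneratedBy (W M : ModuleCat.{u} R) : Prop :=
  ∀ m : M, (∀ f : M →ₗ[R] W, f m = 0) → m = 0

variable {W M N : ModuleCat.{u} R}

theorem IsCogeneratedBy.of_injective (h : IsCogeneratedBy W N) (i : M →ₗ[R] N)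
    (hi : Function.Injective i) : IsCogeneratedBy W M := fun m hm =>
  hi (by rw [map_zero]; exact h _ fun f => hm (f ∘ₗ i))

theorem IsCogeneratedBy.nontrivial_hom (h : IsCogeneratedBy W M) [Nontrivial M] :
    Nontrivial (M →ₗ[R] W) := by
  obtain ⟨m, hm⟩ := exists_ne (0 : M)
  by_contra hns
  rw [not_nontrivial_iff_subsingleton] at hns
  exact hm (h m fun f => by rw [Subsingleton.elim f 0, LinearMap.zero_apply])

end Cogenerated

section ExtToHom

variable {n : ℕ} {K : ModuleCat.{u} R} {I : Ideal R}

theorem extToHom_apply {X : ModuleCat.{u} R} (h : I ≤ Module.annihilator R X) (e : extMod n X K)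
    (x : X) : extToHom n K I X h e x = extPull n _ X K (cyclicMap I X h x) e := rfl

theorem cyclicMap_mk {X : ModuleCat.{u} R} (h : I ≤ Module.annihilator R X) (x : X) (r : R) :
    cyclicMap I X h x (Ideal.Quotient.mk I r) = r • x := rfl

theorem linearMap_quotient_ext {X : Type*} [AddCommGroup X] [Module R X]
    {f g : (R ⧸ I) →ₗ[R] X} (h : f (Ideal.Quotient.mk I 1) = g (Ideal.Quotient.mk I 1)) :
    f = g := by
  refine LinearMap.ext fun q => ?_
  obtain ⟨r, rfl⟩ := Ideal.Quotient.mk_surjective q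
  have hr : Ideal.Quotient.mk I r = r • Ideal.Quotient.mk I 1 := by
    rw [Algebra.smul_def, map_one, mul_one]; rfl
  rw [hr, map_smul, map_smul, h]

theorem comp_cyclicMap {X Y : ModuleCat.{u} R} (f : X →ₗ[R] Y)
    (hX : I ≤ Module.annihilator R X) (hY : I ≤ Module.annihilator R Y) (x : X) :
    f ∘ₗ cyclicMap I X hX x = cyclicMap I Y hY (f x) :=
  linearMap_quotient_ext (by
    rw [LinearMap.comp_apply, cyclicMap_mk, cyclicMap_mk, one_smul, one_smul])

/-- Naturality of the representation. It allows an element of `Ext^n` to be treated as a map into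
`extQuot` and its pull-back as a composition. -/
theorem extToHom_extPull {X Y : ModuleCat.{u} R} (f : X →ₗ[R] Y)
    (hX : I ≤ Module.annihilator R X) (hY : I ≤ Module.annihilator R Y) (e : extMod n Y K)
    (x : X) : extToHom n K I X hX (extPull n X Y K f e) x = extToHom n K I Y hY e (f x) := by
  rw [extToHom_apply, extToHom_apply, ← extPull_comp, comp_cyclicMap f hX hY]

/-- `Ext^i_R(N, K)` vanishes for `i < n` and all modules `N` annihilated by `I`. -/
def ExtVanishesBelow (n : ℕ) (K : ModuleCat.{u} R) (I : Ideal R) : Prop :=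
  ∀ N : ModuleCat.{u} R, I ≤ Module.annihilator R N → ∀ i < n, Subsingleton (extMod i N K)

theorem annihilator_le_of_injective {X Y : Type*} [AddCommGroup X] [Module R X] [AddCommGroup Y]
    [Module R Y] (h : I ≤ Module.annihilator R Y) (f : X →ₗ[R] Y) (hf : Function.Injective f) :
    I ≤ Module.annihilator R X :=
  h.trans (f.annihilator_le_of_injective hf)

theorem annihilator_le_of_surjective {X Y : Type*} [AddCommGroup X] [Module R X] [AddCommGroup Y]
    [Module R Y] (h : I ≤ Module.annihilator R X) (f : X →ₗ[R] Y) (hf : Function.Surjective f) :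
    I ≤ Module.annihilator R Y :=
  h.trans (f.annihilator_le_of_surjective hf)

theorem le_annihilator_hom {X Y : Type*} [AddCommGroup X] [Module R X] [AddCommGroup Y]
    [Module R Y] (h : I ≤ Module.annihilator R Y) : I ≤ Module.annihilator R (X →ₗ[R] Y) :=
  fun _ hr => Module.mem_annihilator.mpr fun _ => LinearMap.ext fun _ =>
    Module.mem_annihilator.mp (h hr) _

theorem le_annihilator_ext {X : ModuleCat.{u} R} (h : I ≤ Module.annihilator R X) (n : ℕ)
    (K : ModuleCat.{u} R) : I ≤ Module.annihilator R (extMod n X K) :=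
  h.trans (annihilator_le_annihilator_ext n K X)

section Presentation

theorem le_annihilator_pi (I : Ideal R) (a : ℕ) : I ≤ Module.annihilator R (Fin a → R ⧸ I) :=
  fun r hr => Module.mem_annihilator.mpr fun v => funext fun i => by
    obtain ⟨s, hs⟩ := Ideal.Quotient.mk_surjective (v i)
    rw [Pi.smul_apply, Pi.zero_apply, ← hs, Algebra.smul_def]
    exact (map_mul (Ideal.Quotient.mk I) r s).symm.trans
      (Ideal.Quotient.eq_zero_iff_mem.mpr (I.mul_mem_right s hr))

/-- A finitely generated module annihilated by `I` is a quotient of a free `R ⧸ I`-module. -/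
theorem exists_surjective_pi_quotient {X : ModuleCat.{u} R} [Module.Finite R X]
    (h : I ≤ Module.annihilator R X) :
    ∃ (a : ℕ) (p : (Fin a → R ⧸ I) →ₗ[R] X), Function.Surjective p := by
  obtain ⟨a, q, hq⟩ := Module.Finite.exists_fin' R X
  refine ⟨a, ∑ i, cyclicMap I X h (q (Pi.single i 1)) ∘ₗ LinearMap.proj i, fun x => ?_⟩
  obtain ⟨v, rfl⟩ := hq x
  refine ⟨fun i => Ideal.Quotient.mk I (v i), ?_⟩
  rw [LinearMap.sum_apply]
  conv_rhs => rw [← Finset.univ_sum_single v, map_sum]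
  refine Finset.sum_congr rfl fun i _ => ?_
  rw [LinearMap.comp_apply, LinearMap.proj_apply, cyclicMap_mk, ← map_smul, ← Pi.single_smul,
    smul_eq_mul, mul_one]

theorem sum_single_comp_proj (M : Type*) [AddCommGroup M] [Module R M] (a : ℕ) :
    ∑ i, LinearMap.single R (fun _ : Fin a => M) i ∘ₗ LinearMap.proj i =
      (LinearMap.id : (Fin a → M) →ₗ[R] (Fin a → M)) := by
  refine LinearMap.ext fun v => ?_
  rw [LinearMap.sum_apply]
  exact Finset.univ_sum_single v

end Presentation

variable {X : ModuleCat.{u} R}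

/-- Cover `X` by a free `R ⧸ I`-module `F`. As `Ext^{n-1}` of the kernel vanishes, `Ext^n(X, K)`
embeds in `Ext^n(F, K)`, where a class is determined by its restrictions to the summands `R ⧸ I`;
these are its values on generators of `X`. -/
theorem extToHom_injective (hI : ExtVanishesBelow n K I) [Module.Finite R X]
    (h : I ≤ Module.annihilator R X) : Function.Injective (extToHom n K I X h) := by
  refine (injective_iff_map_eq_zero _).mpr fun e he => ?_
  obtain ⟨a, p, hp⟩ := exists_surjective_pi_quotient h
  let F : ModuleCat.{u} R := ModuleCat.of R (Fin a → R ⧸ I)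
  have hker : I ≤ Module.annihilator R (LinearMap.ker p) :=
    annihilator_le_of_injective (le_annihilator_pi I a) (LinearMap.ker p).subtype
      Subtype.val_injective
  have hinj := extPull_injective (A := ModuleCat.of R (LinearMap.ker p)) (B := F)
    (f := (LinearMap.ker p).subtype) (g := p) Subtype.val_injective
    (LinearMap.exact_subtype_ker_map p) hp n K (hI _ hker)
  refine hinj ?_
  rw [map_zero, ← extPull_id (extPull n F X K p e), ← sum_single_comp_proj, map_sum,
    LinearMap.sum_apply]
  refine Finset.sum_eq_zero fun i _ => ?_
  rw [extPull_comp (Y := ModuleCat.of R (R ⧸ I)), ← extPull_comp (Y := F)]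
  have hc : p ∘ₗ LinearMap.single R (fun _ : Fin a => R ⧸ I) i
      = cyclicMap I X h (p (Pi.single i (Ideal.Quotient.mk I 1))) :=
    linearMap_quotient_ext (by rw [cyclicMap_mk, one_smul]; rfl)
  rw [hc, ← extToHom_apply, he, LinearMap.zero_apply, map_zero]

/-- `Ext^n_R(-, K)` is represented by `Ext^n_R(R ⧸ I, K)` on the finitely generated modules
annihilated by `I` if `Ext^i_R(-, K)` vanishes on all of them for `i < n`. -/
theorem extToHom_bijective [IsNoetherianRing R] (hI : ExtVanishesBelow n K I)
    [Module.Finite R X] (h : I ≤ Module.annihilator R X) :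
    Function.Bijective (extToHom n K I X h) := by
  refine ⟨extToHom_injective hI h, fun w => ?_⟩
  obtain ⟨a, p, hp⟩ := exists_surjective_pi_quotient h
  let F : ModuleCat.{u} R := ModuleCat.of R (Fin a → R ⧸ I)
  let S : ModuleCat.{u} R := ModuleCat.of R (R ⧸ I)
  let Z : ModuleCat.{u} R := ModuleCat.of R (LinearMap.ker p)
  let j : Z →ₗ[R] F := (LinearMap.ker p).subtype
  have : Module.Finite R Z := inferInstanceAs (Module.Finite R (LinearMap.ker p))
  have hF : I ≤ Module.annihilator R F := le_annihilator_pi I a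
  have hZ : I ≤ Module.annihilator R Z := annihilator_le_of_injective hF j Subtype.val_injective
  let b : Fin a → F := fun i => Pi.single i (Ideal.Quotient.mk I 1)
  -- The class on the free cover that represents `w ∘ p`. Its restriction to the kernel represents
  -- zero, hence is zero by injectivity, so the class descends to `X`.
  let e : extMod n F K := ∑ i, extPull n F S K (LinearMap.proj i) (w (p (b i)))
  have he : extToHom n K I F hF e = w ∘ₗ p := by
    refine LinearMap.pi_ext' fun i => linearMap_quotient_ext ?_
    change extToHom n K I F hF e (b i) = w (p (b i))
    rw [map_sum, LinearMap.sum_apply, Finset.sum_eq_single i]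
    · rw [extToHom_apply, ← extPull_comp]
      have : LinearMap.proj i ∘ₗ cyclicMap I F hF (b i) = (LinearMap.id : S →ₗ[R] S) := by
        refine linearMap_quotient_ext ?_
        rw [LinearMap.comp_apply, cyclicMap_mk, one_smul]
        exact Pi.single_eq_same i _
      rw [this, extPull_id]
    · intro k _ hk
      rw [extToHom_apply, ← extPull_comp]
      have : (LinearMap.proj k : F →ₗ[R] S) ∘ₗ cyclicMap I F hF (b i) = 0 := by
        refine linearMap_quotient_ext ?_
        rw [LinearMap.comp_apply, cyclicMap_mk, one_smul]
        exact Pi.single_eq_of_ne hk _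
      rw [this, map_zero, LinearMap.zero_apply]
    · exact fun hi => absurd (Finset.mem_univ i) hi
  have hj : extPull n Z F K j e = 0 := by
    refine extToHom_injective hI hZ (LinearMap.ext fun z => ?_)
    rw [extToHom_extPull j hZ hF, he, map_zero]
    change w (p z.1) = 0
    rw [LinearMap.mem_ker.mp z.2, map_zero]
  obtain ⟨e', he'⟩ := (extPull_exact (A := Z) (B := F) (C := X) (f := j) (g := p)
    Subtype.val_injective (LinearMap.exact_subtype_ker_map p) hp n K e).mp hj
  refine ⟨e', LinearMap.ext fun x => ?_⟩
  obtain ⟨v, rfl⟩ := hp x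
  exact (extToHom_extPull (X := F) p hF h e' v).symm.trans
    ((congrArg (fun t => extToHom n K I F hF t v) he').trans (LinearMap.congr_fun he v))

/-- The module representing `Ext^n_R(-, K)` on the modules annihilated by `I`. -/
abbrev extQuot (n : ℕ) (K : ModuleCat.{u} R) (I : Ideal R) : ModuleCat.{u} R :=
  extMod n (ModuleCat.of R (R ⧸ I)) K

theorem isCogeneratedBy_ext (hI : ExtVanishesBelow n K I) [Module.Finite R X]
    (h : I ≤ Module.annihilator R X) : IsCogeneratedBy (extQuot n K I) (extMod n X K) :=
  fun e he => extToHom_injective hI h (LinearMap.ext fun x => by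
    rw [map_zero, LinearMap.zero_apply]
    exact he ((extToHom n K I X h).flip x))

theorem ext_eq_zero_iff (hI : ExtVanishesBelow n K I) [Module.Finite R X]
    (h : I ≤ Module.annihilator R X) (e : extMod n X K) :
    e = 0 ↔ ∀ x, extToHom n K I X h e x = 0 := by
  refine ⟨fun he x => by rw [he, map_zero, LinearMap.zero_apply], fun he => ?_⟩
  exact extToHom_injective hI h (by rw [map_zero]; exact LinearMap.ext he)

theorem IsSemidualizing.extVanishesBelow [IsNoetherianRing R] (hK : IsSemidualizing K)
    [Module.Finite R X] (hX : n ≤ grade X) :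
    ExtVanishesBelow n K (Module.annihilator R X) :=
  fun _ h => hK.subsingleton_ext h (natCast_le_grade_iff.mp hX)

/-- A nonzero module that is cogenerated by `Ext^n_R(R ⧸ I, K)` for `K` semidualizing and an ideal
`I` of grade `n` has grade `n`. -/
theorem IsSemidualizing.grade_eq_of_isCogeneratedBy [IsNoetherianRing R]
    (hK : IsSemidualizing K) [Module.Finite R X] (hX : grade X = n) {N : ModuleCat.{u} R}
    [Module.Finite R N] [Nontrivial N]
    (hXN : Module.annihilator R X ≤ Module.annihilator R N)
    (hN : IsCogeneratedBy (extQuot n K (Module.annihilator R X)) N) : grade N = n := by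
  have hv := natCast_le_grade_iff.mp (hX.ge.trans (grade_le_grade hXN))
  refine grade_eq_natCast_iff.mpr ⟨hv, ?_⟩
  -- If `Ext^n(N, R)` also vanished, then `Ext^n(N, K) = 0`, whereas this module is `Hom(N, Ext^n(R
  -- ⧸ I, K))`, nonzero by cogeneration.
  by_contra hns
  have hv' : ∀ i < n + 1, Subsingleton (extMod i N (ringMod R)) := by
    intro i hi
    rcases Nat.lt_succ_iff_lt_or_eq.mp hi with hi | rfl
    · exact hv i hi
    · exact not_nontrivial_iff_subsingleton.mp hns
  have h1 := hK.subsingleton_ext le_rfl hv' n n.lt_succ_self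
  have h2 := hN.nontrivial_hom
  have h3 := (LinearEquiv.ofBijective _
    (extToHom_bijective (hK.extVanishesBelow hX.ge) hXN)).symm.toEquiv.subsingleton
  exact not_subsingleton _ h3

end ExtToHom

/-! ### The biduality maps. -/

section Biduality

variable {n : ℕ} {K M : ModuleCat.{u} R}

/-- The evaluation formula that determines `η`; later arguments use it instead of the definition by
cases. -/
theorem extToHom_eta (h : Function.Bijective (extToHom n K (Module.annihilator R M) (extMod n M K)
      (annihilator_le_annihilator_ext n K M))) (m : M) (e : extMod n M K) :
    extToHom n K (Module.annihilator R M) (extMod n M K)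
      (annihilator_le_annihilator_ext n K M) (eta n K M m) e =
    extToHom n K (Module.annihilator R M) M le_rfl e m := by
  rw [eta, dif_pos h]
  exact LinearMap.congr_fun ((LinearEquiv.ofBijective _ h).apply_symm_apply
    ((extToHom n K (Module.annihilator R M) M le_rfl).flip m)) e

theorem isCogeneratedBy_of_eta_injective (h : Function.Injective (eta n K M)) :
    IsCogeneratedBy (extQuot n K (Module.annihilator R M)) M := by
  by_cases hb : Function.Bijective (extToHom n K (Module.annihilator R M) (extMod n M K)
      (annihilator_le_annihilator_ext n K M))
  · intro m hm
    refine h (hb.1 (LinearMap.ext fun e => ?_))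
    rw [extToHom_eta hb, hm, map_zero, map_zero, LinearMap.zero_apply]
  -- Here `η` is the default value `0`, and its injectivity forces `M = 0`.
  · intro m _
    refine h ?_
    rw [eta, dif_neg hb]; rfl

theorem extToHomCodual_apply (e : extMod n M K) (k : K) :
    extToHomCodual n K M e k = extPull n (homMod K M) M K (LinearMap.applyₗ k) e := rfl

theorem extToHom_extToHomCodual {I : Ideal R} (h : I ≤ Module.annihilator R M)
    (e : extMod n M K) (k : K) (f : homMod K M) :
    extToHom n K I (homMod K M) (le_annihilator_hom h) (extToHomCodual n K M e k) f =
      extToHom n K I M h e (f k) := by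
  rw [extToHomCodual_apply, extToHom_extPull _ _ h]; rfl

theorem nu_tmul (k : K) (f : K →ₗ[R] M) : nu K M (k ⊗ₜ f) = f k := rfl

/-- The map `Ext^n_R(M, K) → Hom_R(K, Ext^n_R(Hom_R(K, M), K))` is bijective if `ν_M` is. -/
theorem extToHomCodual_bijective [IsNoetherianRing R] [Module.Finite R K] [Module.Finite R M]
    {I : Ideal R} (hI : ExtVanishesBelow n K I) (h : I ≤ Module.annihilator R M)
    (hnu : Function.Bijective (nu K M)) : Function.Bijective (extToHomCodual n K M) := by
  have hfin : Module.Finite R (homMod K M) := inferInstanceAs (Module.Finite R (K →ₗ[R] M))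
  constructor
  · refine (injective_iff_map_eq_zero _).mpr fun e he => (ext_eq_zero_iff hI h e).mpr fun m => ?_
    obtain ⟨t, rfl⟩ := hnu.2 m
    induction t with
    | zero => rw [map_zero, map_zero]
    | add s t hs ht => rw [map_add, map_add, hs, ht, add_zero]
    | tmul k f =>
      rw [nu_tmul, ← extToHom_extToHomCodual, he, LinearMap.zero_apply, map_zero,
        LinearMap.zero_apply]
  · intro g
    -- The preimage of `g` comes from tensor-hom adjunction: `g` is a map `K ⊗ Hom(K, M) → W`, and
    -- composing with the inverse of `ν` gives a map `M → W`, that is, a class in `Ext^n(M, K)`.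
    let t : TensorProduct R K (K →ₗ[R] M) →ₗ[R] extQuot n K I :=
      TensorProduct.lift ((extToHom n K I (homMod K M) (le_annihilator_hom h)) ∘ₗ g)
    obtain ⟨e, he⟩ := (extToHom_bijective hI h).2
      (t ∘ₗ (LinearEquiv.ofBijective _ hnu).symm.toLinearMap)
    refine ⟨e, LinearMap.ext fun k => extToHom_injective hI (le_annihilator_hom h)
      (LinearMap.ext fun f => ?_)⟩
    rw [extToHom_extToHomCodual h, he]
    have : (LinearEquiv.ofBijective _ hnu).symm (f k) = k ⊗ₜ[R] f := by
      rw [LinearEquiv.symm_apply_eq]; rfl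
    change t ((LinearEquiv.ofBijective _ hnu).symm (f k)) = _
    rw [this]; rfl

theorem xi_apply (h : Function.Bijective (extToHomCodual n K M)) (m : M) :
    xi n K M m = extPull n (homMod K (codual n K M)) (extMod n M K) K
      (LinearEquiv.ofBijective _ h).symm.toLinearMap (eta n K M m) := by
  rw [xi, dif_pos h]; rfl

theorem xi_bijective_iff (h : Function.Bijective (extToHomCodual n K M)) :
    Function.Bijective (xi n K M) ↔ Function.Bijective (eta n K M) := by
  have : (xi n K M : M → _) =
      extPullEquiv n K (LinearEquiv.ofBijective _ h).symm ∘ eta n K M :=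
    funext fun m => xi_apply h m
  rw [this]
  exact (extPullEquiv n K (LinearEquiv.ofBijective _ h).symm).bijective.of_comp_iff' _

end Biduality

/-! ### The intrinsic criterion for linkage. -/

section HomEquivalent

theorem homEquivalent_refl {X M : ModuleCat.{u} R} (φ : X ⟶ M) : HomEquivalent φ φ :=
  ⟨Iso.refl M, Iso.refl X, by simp⟩

/-- Surjections whose kernels correspond under an isomorphism of their sources are equivalent. -/
theorem homEquivalent_of_ker {X M Y N : ModuleCat.{u} R} (φ : X ⟶ M) (ψ : Y ⟶ N)
    (hφ : Function.Surjective φ.hom) (hψ : Function.Surjective ψ.hom) (β : X ≃ₗ[R] Y)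
    (h : ∀ x, φ.hom x = 0 ↔ ψ.hom (β x) = 0) : HomEquivalent φ ψ := by
  have hs : Function.Surjective (ψ.hom ∘ₗ β.toLinearMap) := hψ.comp β.surjective
  let α : M ≃ₗ[R] N := (φ.hom.quotKerEquivOfSurjective hφ).symm.trans
    ((Submodule.quotEquivOfEq _ _ (Submodule.ext h)).trans
      ((ψ.hom ∘ₗ β.toLinearMap).quotKerEquivOfSurjective hs))
  refine ⟨α.toModuleIso, β.toModuleIso, ModuleCat.hom_ext (LinearMap.ext fun x => ?_)⟩
  have h1 : (φ.hom.quotKerEquivOfSurjective hφ).symm (φ.hom x) =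
      (LinearMap.ker φ.hom).mkQ x := by
    rw [LinearEquiv.symm_apply_eq]; rfl
  change (ψ.hom ∘ₗ β.toLinearMap).quotKerEquivOfSurjective hs (Submodule.quotEquivOfEq _ _ _
    ((φ.hom.quotKerEquivOfSurjective hφ).symm (φ.hom x))) = ψ.hom (β x)
  rw [h1]; rfl

theorem grade_congr {M N : ModuleCat.{u} R} (e : M ≃ₗ[R] N) : grade M = grade N := by
  have h : ∀ i, Nontrivial (extMod i M (ringMod R)) ↔ Nontrivial (extMod i N (ringMod R)) :=
    fun i => (extPullEquiv i (ringMod R) e).toEquiv.nontrivial_congr.symm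
  simp only [grade, h]

end HomEquivalent

section Linked

variable [IsNoetherianRing R] {n : ℕ} {𝒳 : ObjectProperty (ModuleCat.{u} R)}

omit [IsNoetherianRing R] in
/-- The source of an epimorphism in a link annihilates the other source. -/
theorem annihilator_le_of_homEquivalent_linkMap {K X M Y N : ModuleCat.{u} R} {φ : X ⟶ M}
    {ψ : Y ⟶ N} (h : HomEquivalent ψ (linkMap n K φ)) :
    Module.annihilator R X ≤ Module.annihilator R Y := by
  obtain ⟨-, β, -⟩ := h
  exact annihilator_le_of_injective (annihilator_le_annihilator_ext n K X)
    β.toLinearEquiv.toLinearMap β.toLinearEquiv.injective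

/-- A linked module is a proper quotient of a module in `𝒳` and it is cogenerated by
`Ext^n_R(R ⧸ I, R)`. -/
theorem IsLinked.exists_isEpiFrom (h𝒳 : IsReflexiveSubcategory n (ringMod R) 𝒳)
    {M : ModuleCat.{u} R} (hM : IsLinked n (ringMod R) 𝒳 M) :
    ∃ (X : ModuleCat.{u} R) (φ : X ⟶ M), IsEpiFrom 𝒳 φ ∧ ¬ Function.Injective φ.hom ∧
      IsCogeneratedBy (extQuot n (ringMod R) (Module.annihilator R X)) M := by
  obtain ⟨N, X, Y, φ, ψ, hφ, hψ, h1, h2⟩ := hM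
  have := h𝒳.finite X hφ.source_mem
  have := h𝒳.finite Y hψ.source_mem
  refine ⟨X, φ, hφ, fun hinj => ?_, ?_⟩
  -- An injective `φ` has zero kernel, so its link, isomorphic to `N`, is zero; a module of finite
  -- grade is nonzero.
  · have hN : grade N = n := hψ.grade_eq.trans (h𝒳.grade_eq Y hψ.source_mem)
    have := nontrivial_of_grade_eq hN
    obtain ⟨α, -, -⟩ := h2
    have hsub : Subsingleton (LinearMap.ker φ.hom) := by
      rw [LinearMap.ker_eq_bot.mpr hinj]; infer_instance
    have := subsingleton_ext_of_subsingleton_left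
      (X := ModuleCat.of R (LinearMap.ker φ.hom)) n (ringMod R)
    obtain ⟨a, b, hab⟩ := α.toLinearEquiv.symm.toEquiv.nontrivial
    exact hab (Subtype.ext (Subsingleton.elim _ _))
  -- `M` is isomorphic to a submodule of `Ext^n(ker ψ, R)`, and `ann X` kills `ker ψ` because `Y` is
  -- isomorphic to `Ext^n(X, R)`.
  · have hann := annihilator_le_of_homEquivalent_linkMap h2
    obtain ⟨α, -, -⟩ := h1
    have hv := (isSemidualizing_ringMod R).extVanishesBelow (h𝒳.grade_eq X hφ.source_mem).ge
    have hker : Module.annihilator R X ≤ Module.annihilator R (LinearMap.ker ψ.hom) :=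
      annihilator_le_of_injective hann (LinearMap.ker ψ.hom).subtype Subtype.val_injective
    have : Module.Finite R (ModuleCat.of R (LinearMap.ker ψ.hom)) :=
      inferInstanceAs (Module.Finite R (LinearMap.ker ψ.hom))
    have hc := isCogeneratedBy_ext (X := ModuleCat.of R (LinearMap.ker ψ.hom)) hv hker
    exact hc.of_injective ((Submodule.subtype _) ∘ₗ α.toLinearEquiv.toLinearMap)
      (Subtype.val_injective.comp α.toLinearEquiv.injective)

/-- The partner of `φ` is its own link, so only the double link has to be compared with `φ`. By
`homEquivalent_of_ker` it suffices that `η_X` matches the two kernels, which is what cogeneration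
provides. -/
theorem isLinked_of_isEpiFrom (h𝒳 : IsReflexiveSubcategory n (ringMod R) 𝒳)
    {X M : ModuleCat.{u} R} {φ : X ⟶ M} (hφ : IsEpiFrom 𝒳 φ) (hinj : ¬ Function.Injective φ.hom)
    (hM : IsCogeneratedBy (extQuot n (ringMod R) (Module.annihilator R X)) M) :
    IsLinked n (ringMod R) 𝒳 M := by
  have hX := hφ.source_mem
  have := h𝒳.finite X hX
  have := h𝒳.finite _ (h𝒳.ext_mem X hX)
  have hgr := h𝒳.grade_eq X hX
  have hv := (isSemidualizing_ringMod R).extVanishesBelow hgr.ge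
  let U : ModuleCat.{u} R := ModuleCat.of R (LinearMap.ker φ.hom)
  let j : U →ₗ[R] X := (LinearMap.ker φ.hom).subtype
  have : Module.Finite R U := inferInstanceAs (Module.Finite R (LinearMap.ker φ.hom))
  have hU : Module.annihilator R X ≤ Module.annihilator R U :=
    annihilator_le_of_injective le_rfl j Subtype.val_injective
  let E : ModuleCat.{u} R := extMod n X (ringMod R)
  have hE : Module.annihilator R X ≤ Module.annihilator R E := le_annihilator_ext le_rfl n _
  let r : E →ₗ[R] extMod n U (ringMod R) := extPull n U X (ringMod R) j
  let N : ModuleCat.{u} R := ModuleCat.of R (LinearMap.range r)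
  have hfinN : Module.Finite R N := inferInstanceAs (Module.Finite R (LinearMap.range r))
  have hNann : Module.annihilator R X ≤ Module.annihilator R N :=
    annihilator_le_of_surjective hE r.rangeRestrict r.surjective_rangeRestrict
  have hNcog : IsCogeneratedBy (extQuot n (ringMod R) (Module.annihilator R X)) N :=
    (isCogeneratedBy_ext hv hU).of_injective (LinearMap.range r).subtype Subtype.val_injective
  have hXcog := isCogeneratedBy_of_eta_injective (h𝒳.eta_bijective X hX).1
  -- If the link had zero image, every map `X → W` would vanish on `ker φ`. Reflexivity makes `X`
  -- cogenerated by `W`, so `φ` would be injective.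
  have hNnt : Nontrivial N := by
    by_contra hns
    rw [not_nontrivial_iff_subsingleton] at hns
    refine hinj ((injective_iff_map_eq_zero _).mpr fun x hx => hXcog x fun f => ?_)
    obtain ⟨e, rfl⟩ := (extToHom_bijective hv le_rfl).2 f
    have h0 : r e = 0 := congrArg Subtype.val (Subsingleton.elim (r.rangeRestrict e) 0)
    have := extToHom_extPull (n := n) (K := ringMod R) j hU le_rfl e ⟨x, hx⟩
    rw [show extPull n U X (ringMod R) j e = 0 from h0, map_zero, LinearMap.zero_apply] at this
    exact this.symm
  have hψ : IsEpiFrom 𝒳 (linkMap n (ringMod R) φ) :=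
    { source_mem := h𝒳.ext_mem X hX
      finite := hfinN
      surjective := r.surjective_rangeRestrict
      grade_eq := ((isSemidualizing_ringMod R).grade_eq_of_isCogeneratedBy hgr hNann hNcog).trans
        (h𝒳.grade_eq _ (h𝒳.ext_mem X hX)).symm }
  refine ⟨N, X, E, φ, linkMap n (ringMod R) φ, hφ, hψ, ?_, homEquivalent_refl _⟩
  refine homEquivalent_of_ker φ _ hφ.surjective (LinearMap.surjective_rangeRestrict _)
    (LinearEquiv.ofBijective _ (h𝒳.eta_bijective X hX)) fun x => ?_
  let V : ModuleCat.{u} R := ModuleCat.of R (LinearMap.ker (linkMap n (ringMod R) φ).hom)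
  let j' : V →ₗ[R] E := (LinearMap.ker (linkMap n (ringMod R) φ).hom).subtype
  have : Module.Finite R V :=
    inferInstanceAs (Module.Finite R (LinearMap.ker (linkMap n (ringMod R) φ).hom))
  have hV : Module.annihilator R X ≤ Module.annihilator R V :=
    annihilator_le_of_injective hE j' Subtype.val_injective
  have hmemV : ∀ e, e ∈ LinearMap.ker (linkMap n (ringMod R) φ).hom ↔ r e = 0 :=
    fun e => Subtype.ext_iff
  have hbij := extToHom_bijective (X := E) hv hE
  -- `η_X(x)` dies in the double link if and only if `x` is killed by all `e : X → W` restricting to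
  -- zero on `ker φ`; these `e` are the maps that factor through `M`.
  have hkey : (linkMap n (ringMod R) (linkMap n (ringMod R) φ)).hom (eta n (ringMod R) X x) = 0 ↔
      ∀ e, r e = 0 → extToHom n (ringMod R) (Module.annihilator R X) X le_rfl e x = 0 := by
    refine Subtype.ext_iff.trans ((ext_eq_zero_iff hv hV _).trans ?_)
    have hval : ∀ v : V, extToHom n (ringMod R) (Module.annihilator R X) V hV
        (extPull n V E (ringMod R) j' (eta n (ringMod R) X x)) v =
        extToHom n (ringMod R) (Module.annihilator R X) X le_rfl v.1 x := fun v => by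
      rw [extToHom_extPull j' hV hE]
      exact extToHom_eta hbij x v.1
    exact ⟨fun h e he => (hval ⟨e, (hmemV e).mpr he⟩).symm.trans (h ⟨e, (hmemV e).mpr he⟩),
      fun h v => (hval v).trans (h v.1 ((hmemV v.1).mp v.2))⟩
  refine Iff.trans ?_ hkey.symm
  constructor
  · intro hx e he
    have := extToHom_extPull (n := n) (K := ringMod R) j hU le_rfl e ⟨x, hx⟩
    rw [show extPull n U X (ringMod R) j e = 0 from he, map_zero, LinearMap.zero_apply] at this
    exact this.symm
  · intro h
    refine hM _ fun f => ?_
    obtain ⟨e, he⟩ := (extToHom_bijective hv le_rfl).2 (f ∘ₗ φ.hom)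
    have := h e ((ext_eq_zero_iff hv hU _).mpr fun z => by
      rw [extToHom_extPull j hU le_rfl, he]
      change f (φ.hom z.1) = 0
      rw [LinearMap.mem_ker.mp z.2, map_zero])
    rwa [he] at this

end Linked

/-! ### The intrinsic criterion for colinkage. -/

section Colinked

variable [IsNoetherianRing R] {n : ℕ} {K : ModuleCat.{u} R} {𝒴 : ObjectProperty (ModuleCat.{u} R)}

omit [IsNoetherianRing R] in
/-- If `Y, N ∈ Δ_K(R)` and `φ : Y → N` induces a surjection `Hom_R(K, Y) → Hom_R(K, N)`, then the
kernel of `φ` is generated by the images of homomorphisms from `K`. -/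
theorem ker_le_span_range {Y N : ModuleCat.{u} R} (φ : Y →ₗ[R] N)
    (hY : Function.Bijective (nu K Y)) (hN : Function.Bijective (nu K N))
    (hφ : Function.Surjective (homPush K φ)) :
    LinearMap.ker φ ≤ Submodule.span R {y : Y | ∃ (u : K →ₗ[R] LinearMap.ker φ) (k : K), (u k).1 = y} := by
  intro y hy
  obtain ⟨t, rfl⟩ := hY.2 y
  let U : ModuleCat.{u} R := ModuleCat.of R (LinearMap.ker φ)
  let j : U →ₗ[R] Y := (LinearMap.ker φ).subtype
  have hex : Function.Exact (homPush K j) (homPush K φ) :=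
    homPush_exact Subtype.val_injective (LinearMap.exact_subtype_ker_map φ) K
  have hnat : nu K N ∘ₗ (homPush K φ).lTensor K = φ ∘ₗ nu K Y :=
    TensorProduct.ext' fun k f => rfl
  have ht : (homPush K φ).lTensor K t = 0 := hN.1 (by
    rw [map_zero]
    exact (LinearMap.congr_fun hnat t).trans hy)
  -- As `Hom(K, φ)` is surjective, right exactness of `K ⊗ -` shows that the kernel of `K ⊗ Hom(K,
  -- φ)` comes from `K ⊗ Hom(K, ker φ)`.
  obtain ⟨s, rfl⟩ := (lTensor_exact K hex hφ t).mp ht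
  induction s with
  | zero => rw [map_zero, map_zero]; exact Submodule.zero_mem _
  | add a b ha hb =>
    -- The induction carries the hypotheses on `s` along, so they must be supplied anew for each
    -- summand.
    have key : ∀ c, nu K Y ((homPush K j).lTensor K c) ∈ LinearMap.ker φ := fun c => by
      rw [LinearMap.mem_ker, ← LinearMap.comp_apply, ← hnat, LinearMap.comp_apply,
        (lTensor_exact K hex hφ).apply_apply_eq_zero, map_zero]
    rw [map_add, map_add]
    exact Submodule.add_mem _ (ha (key a) ((lTensor_exact K hex hφ).apply_apply_eq_zero a))
      (hb (key b) ((lTensor_exact K hex hφ).apply_apply_eq_zero b))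
  | tmul k u => exact Submodule.subset_span ⟨u, k, rfl⟩

omit [IsNoetherianRing R] in
-- The evaluation formula for `ξ`: the isomorphism in its definition is undone by indexing the
-- elements of `Hom(K, D(M))` by classes `e` in `Ext^n(M, K)`.
theorem extToHom_xi {M : ModuleCat.{u} R} (hθ : Function.Bijective (extToHomCodual n K M))
    (hη : Function.Bijective (extToHom n K (Module.annihilator R M) (extMod n M K)
      (annihilator_le_annihilator_ext n K M)))
    (h : Module.annihilator R M ≤ Module.annihilator R (homMod K (codual n K M))) (m : M)
    (e : extMod n M K) :
    extToHom n K (Module.annihilator R M) (homMod K (codual n K M)) h (xi n K M m)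
      (extToHomCodual n K M e) = extToHom n K (Module.annihilator R M) M le_rfl e m := by
  have h1 : (LinearEquiv.ofBijective _ hθ).symm.toLinearMap (extToHomCodual n K M e) = e :=
    (LinearEquiv.ofBijective _ hθ).symm_apply_apply e
  rw [xi_apply hθ, extToHom_extPull _ h (annihilator_le_annihilator_ext n K M), h1,
    extToHom_eta hη]

/-- Maps `K → S ⊆ D(Y)` correspond under `extToHomCodual` to the classes `e` whose associated map
has values in `S`, and `ξ(y)` pairs with such a map to give `e(y)`. With `S` the kernel of a colink
this describes the kernel of the double colink. -/
theorem extPull_xi_eq_zero_iff [Module.Finite R K] {Y : ModuleCat.{u} R} [Module.Finite R Y]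
    [Module.Finite R (codual n K Y)]
    (hv : ExtVanishesBelow n K (Module.annihilator R Y))
    (hθ : Function.Bijective (extToHomCodual n K Y)) (S : Submodule R (codual n K Y)) (y : Y) :
    extPull n (homMod K (ModuleCat.of R S)) (homMod K (codual n K Y)) K
      (LinearMap.llcomp R K _ _ S.subtype) (xi n K Y y) = 0 ↔
    ∀ e, (∀ k, extToHomCodual n K Y e k ∈ S) →
      extToHom n K (Module.annihilator R Y) Y le_rfl e y = 0 := by
  have hE : Module.annihilator R Y ≤ Module.annihilator R (codual n K Y) :=
    le_annihilator_ext (X := homMod K Y) (le_annihilator_hom le_rfl) n K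
  have hKE : Module.annihilator R Y ≤ Module.annihilator R (homMod K (codual n K Y)) :=
    le_annihilator_hom hE
  have hV : Module.annihilator R Y ≤ Module.annihilator R (homMod K (ModuleCat.of R S)) :=
    le_annihilator_hom (annihilator_le_of_injective hE S.subtype Subtype.val_injective)
  have : Module.Finite R (homMod K (ModuleCat.of R S)) :=
    inferInstanceAs (Module.Finite R (K →ₗ[R] S))
  have hη := extToHom_bijective (X := extMod n Y K) hv (annihilator_le_annihilator_ext n K Y)
  rw [ext_eq_zero_iff hv hV]
  have hval : ∀ (v : K →ₗ[R] S) (e : extMod n Y K),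
      extToHomCodual n K Y e = S.subtype ∘ₗ v →
      extToHom n K (Module.annihilator R Y) (homMod K (ModuleCat.of R S)) hV
        (extPull n (homMod K (ModuleCat.of R S)) (homMod K (codual n K Y)) K
          (LinearMap.llcomp R K _ _ S.subtype) (xi n K Y y)) v =
      extToHom n K (Module.annihilator R Y) Y le_rfl e y := fun v e hve => by
    rw [extToHom_extPull _ hV hKE, ← extToHom_xi hθ hη hKE, hve]
    rfl
  constructor
  · intro h e he
    rw [← hval (LinearMap.codRestrict S (extToHomCodual n K Y e) he) e rfl]
    exact h _
  · intro h v
    obtain ⟨e, he⟩ := hθ.2 (S.subtype ∘ₗ v)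
    have h0 := h e fun k => by
      rw [he]
      exact (v k).2
    exact (hval v e he).trans h0

/-- The argument is that for links with `Hom(K, ker φ)` in place of `ker φ`: `M` is isomorphic to a
submodule of `Ext^n(Hom(K, ker ψ), K)`, and an injective `φ` would have the zero module as its
colink. -/
theorem IsColinked.exists_isEpiFrom (hK : IsSemidualizing K)
    (h𝒴 : IsCoreflexiveSubcategory n K 𝒴) {M : ModuleCat.{u} R} (hM : IsColinked n K 𝒴 M) :
    ∃ (Y : ModuleCat.{u} R) (φ : Y ⟶ M), IsEpiFrom 𝒴 φ ∧ ¬ Function.Injective φ.hom ∧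
      IsCogeneratedBy (extQuot n K (Module.annihilator R Y)) M := by
  obtain ⟨N, X, Y, φ, ψ, hφ, hψ, h1, h2⟩ := hM
  have := hK.finite
  have := h𝒴.finite X hφ.source_mem
  have := h𝒴.finite Y hψ.source_mem
  refine ⟨X, φ, hφ, fun hinj => ?_, ?_⟩
  · have hN : grade N = n := hψ.grade_eq.trans (h𝒴.grade_eq Y hψ.source_mem)
    have := nontrivial_of_grade_eq hN
    obtain ⟨α, -, -⟩ := h2
    have hsub : Subsingleton (LinearMap.ker φ.hom) := by
      rw [LinearMap.ker_eq_bot.mpr hinj]; infer_instance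
    have hsub' : Subsingleton (homMod K (ModuleCat.of R (LinearMap.ker φ.hom))) :=
      ⟨fun f g => LinearMap.ext fun x => Subsingleton.elim (α := LinearMap.ker φ.hom) _ _⟩
    have := subsingleton_ext_of_subsingleton_left
      (X := homMod K (ModuleCat.of R (LinearMap.ker φ.hom))) n K
    obtain ⟨a, b, hab⟩ := α.toLinearEquiv.symm.toEquiv.nontrivial
    exact hab (Subtype.ext (Subsingleton.elim _ _))
  · have hann : Module.annihilator R X ≤ Module.annihilator R Y := by
      obtain ⟨-, β, -⟩ := h2
      exact annihilator_le_of_injective (le_annihilator_ext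
        (X := homMod K X) (le_annihilator_hom le_rfl) n K)
        β.toLinearEquiv.toLinearMap β.toLinearEquiv.injective
    obtain ⟨α, -, -⟩ := h1
    have hv := hK.extVanishesBelow (h𝒴.grade_eq X hφ.source_mem).ge
    have hker : Module.annihilator R X ≤ Module.annihilator R (LinearMap.ker ψ.hom) :=
      annihilator_le_of_injective hann (LinearMap.ker ψ.hom).subtype Subtype.val_injective
    have : Module.Finite R (homMod K (ModuleCat.of R (LinearMap.ker ψ.hom))) :=
      inferInstanceAs (Module.Finite R (K →ₗ[R] LinearMap.ker ψ.hom))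
    have hc := isCogeneratedBy_ext (X := homMod K (ModuleCat.of R (LinearMap.ker ψ.hom))) hv
      (le_annihilator_hom hker)
    exact hc.of_injective ((Submodule.subtype _) ∘ₗ α.toLinearEquiv.toLinearMap)
      (Subtype.val_injective.comp α.toLinearEquiv.injective)

/-- The colink retains only maps from `K` into `ker φ`. Bijectivity of `ν` and surjectivity of
`Hom(K, φ)` ensure that their images generate `ker φ`, so that a map `Y → W` killing these images
factors through `M`. -/
theorem isColinked_of_isEpiFrom (hK : IsSemidualizing K)
    (h𝒴 : IsCoreflexiveSubcategory n K 𝒴) {Y M : ModuleCat.{u} R} {φ : Y ⟶ M}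
    (hφ : IsEpiFrom 𝒴 φ) (hinj : ¬ Function.Injective φ.hom)
    (hnu : Function.Bijective (nu K M)) (hsurj : Function.Surjective (homPush K φ.hom))
    (hM : IsCogeneratedBy (extQuot n K (Module.annihilator R Y)) M) :
    IsColinked n K 𝒴 M := by
  have hY := hφ.source_mem
  have := hK.finite
  have := h𝒴.finite Y hY
  have hDY := h𝒴.codual_mem Y hY
  have := h𝒴.finite _ hDY
  have hgr := h𝒴.grade_eq Y hY
  have hv := hK.extVanishesBelow hgr.ge
  let X : ModuleCat.{u} R := homMod K Y
  have : Module.Finite R X := inferInstanceAs (Module.Finite R (K →ₗ[R] Y))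
  have hX : Module.annihilator R Y ≤ Module.annihilator R X := le_annihilator_hom le_rfl
  let U₀ : ModuleCat.{u} R := ModuleCat.of R (LinearMap.ker φ.hom)
  let U : ModuleCat.{u} R := homMod K U₀
  let j : U →ₗ[R] X := LinearMap.llcomp R K _ _ (LinearMap.ker φ.hom).subtype
  have : Module.Finite R U := inferInstanceAs (Module.Finite R (K →ₗ[R] LinearMap.ker φ.hom))
  have hjinj : Function.Injective j :=
    homPush_injective (A := U₀) (B := Y) (f := (LinearMap.ker φ.hom).subtype)
      Subtype.val_injective K
  have hU : Module.annihilator R Y ≤ Module.annihilator R U :=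
    annihilator_le_of_injective hX j hjinj
  let E : ModuleCat.{u} R := codual n K Y
  have hE : Module.annihilator R Y ≤ Module.annihilator R E := le_annihilator_ext hX n _
  let r : E →ₗ[R] extMod n U K := extPull n U X K j
  let N : ModuleCat.{u} R := ModuleCat.of R (LinearMap.range r)
  have hfinN : Module.Finite R N := inferInstanceAs (Module.Finite R (LinearMap.range r))
  have hNann : Module.annihilator R Y ≤ Module.annihilator R N :=
    annihilator_le_of_surjective hE r.rangeRestrict r.surjective_rangeRestrict
  have hNcog : IsCogeneratedBy (extQuot n K (Module.annihilator R Y)) N :=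
    (isCogeneratedBy_ext hv hU).of_injective (LinearMap.range r).subtype Subtype.val_injective
  have hθE := extToHomCodual_bijective (n := n) hv hE (h𝒴.nu_bijective _ hDY)
  -- `Hom(K, Y)` embeds through `ξ_Y` in `Hom(K, D(D(Y)))`, which is isomorphic to `Ext^n(D(Y), K)`
  -- and hence cogenerated.
  have hXcog : IsCogeneratedBy (extQuot n K (Module.annihilator R Y)) X := by
    let ι : X →ₗ[R] homMod K (codual n K E) :=
      LinearMap.llcomp R K _ _ (xi n K Y)
    have hι : Function.Injective ι := homPush_injective (h𝒴.xi_bijective Y hY).1 K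
    exact (isCogeneratedBy_ext hv hE).of_injective
      ((LinearEquiv.ofBijective _ hθE).symm.toLinearMap ∘ₗ ι)
      ((LinearEquiv.ofBijective _ hθE).symm.injective.comp hι)
  have hNnt : Nontrivial N := by
    by_contra hns
    rw [not_nontrivial_iff_subsingleton] at hns
    -- A zero colink means that no map from `Hom(K, Y)` to `W` detects `Hom(K, ker φ)`, so the
    -- latter vanishes; faithfulness of `K` then gives `ker φ = 0`.
    have hU0 : Subsingleton (K →ₗ[R] LinearMap.ker φ.hom) := by
      refine subsingleton_of_forall_eq 0 fun u => hjinj (hXcog _ fun f => ?_)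
      obtain ⟨e, rfl⟩ := (extToHom_bijective hv hX).2 f
      have h0 : r e = 0 := congrArg Subtype.val (Subsingleton.elim (r.rangeRestrict e) 0)
      have := extToHom_extPull (n := n) (K := K) j hU hX e u
      rw [show extPull n U X K j e = 0 from h0, map_zero, LinearMap.zero_apply] at this
      exact this.symm
    have := subsingleton_of_subsingleton_hom hK.annihilator_eq_bot hU0
    exact hinj (LinearMap.ker_eq_bot.mp (Submodule.subsingleton_iff_eq_bot.mp this))
  have hψ : IsEpiFrom 𝒴 (colinkMap n K φ) :=
    { source_mem := hDY
      finite := hfinN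
      surjective := r.surjective_rangeRestrict
      grade_eq := (hK.grade_eq_of_isCogeneratedBy hgr hNann hNcog).trans
        (h𝒴.grade_eq _ hDY).symm }
  refine ⟨N, Y, E, φ, colinkMap n K φ, hφ, hψ, ?_, homEquivalent_refl _⟩
  refine homEquivalent_of_ker φ _ hφ.surjective (LinearMap.surjective_rangeRestrict _)
    (LinearEquiv.ofBijective _ (h𝒴.xi_bijective Y hY)) fun y => ?_
  have hθ := extToHomCodual_bijective (n := n) hv le_rfl (h𝒴.nu_bijective _ hY)
  have hkey : (colinkMap n K (colinkMap n K φ)).hom (xi n K Y y) = 0 ↔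
      ∀ e, (∀ k, r (extToHomCodual n K Y e k) = 0) →
        extToHom n K (Module.annihilator R Y) Y le_rfl e y = 0 := by
    refine Subtype.ext_iff.trans ((extPull_xi_eq_zero_iff hv hθ _ y).trans ?_)
    exact forall_congr' fun e => imp_congr_left (forall_congr' fun k => Subtype.ext_iff)
  have hre : ∀ e, (∀ k, r (extToHomCodual n K Y e k) = 0) ↔
      ∀ (k : K) (u : K →ₗ[R] LinearMap.ker φ.hom),
        extToHom n K (Module.annihilator R Y) Y le_rfl e (u k).1 = 0 := by
    intro e
    refine forall_congr' fun k => (ext_eq_zero_iff hv hU _).trans (forall_congr' fun u => ?_)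
    rw [extToHom_extPull j hU hX, extToHom_extToHomCodual le_rfl]
    rfl
  refine Iff.trans ?_ hkey.symm
  constructor
  · intro hy e he
    have hle : Submodule.span R {y : Y | ∃ (u : K →ₗ[R] LinearMap.ker φ.hom) (k : K), (u k).1 = y} ≤
        LinearMap.ker (extToHom n K (Module.annihilator R Y) Y le_rfl e) := by
      refine Submodule.span_le.mpr ?_
      rintro _ ⟨u, k, rfl⟩
      exact (hre e).mp he k u
    exact hle (ker_le_span_range φ.hom (h𝒴.nu_bijective Y hY) hnu hsurj hy)
  · intro h
    refine hM _ fun f => ?_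
    obtain ⟨e, he⟩ := (extToHom_bijective hv le_rfl).2 (f ∘ₗ φ.hom)
    have := h e ((hre e).mpr fun k u => by
      rw [he]
      change f (φ.hom (u k).1) = 0
      rw [LinearMap.mem_ker.mp (u k).2, map_zero])
    rwa [he] at this

end Colinked

/-! ### Ext into a Hom module and transfer of cogeneration. -/

section ExtHom

/-- The natural map `Ext^n_R(N, Hom_R(L, B)) → Hom_R(L, Ext^n_R(N, B))`. -/
def extHomToHom (n : ℕ) (N L B : ModuleCat.{u} R) :
    extMod n N (homMod L B) →ₗ[R] (L →ₗ[R] extMod n N B) :=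
  (extPush n N (homMod L B) B ∘ₗ LinearMap.applyₗ).flip

variable {n : ℕ} {N L B : ModuleCat.{u} R}

theorem extHomToHom_apply (e : extMod n N (homMod L B)) (l : L) :
    extHomToHom n N L B e l = extPush n N (homMod L B) B (LinearMap.applyₗ l) e := rfl

theorem extHomToHom_extPush {L' : ModuleCat.{u} R} (f : L' →ₗ[R] L)
    (e : extMod n N (homMod L B)) :
    extHomToHom n N L' B (extPush n N _ _ (homPull B f) e) = extHomToHom n N L B e ∘ₗ f := by
  refine LinearMap.ext fun l => ?_
  rw [LinearMap.comp_apply, extHomToHom_apply, extHomToHom_apply, ← extPush_comp]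
  rfl

theorem extHomToHom_free_bijective (a : ℕ) :
    Function.Bijective (extHomToHom n N (ModuleCat.of R (Fin a → R)) B) := by
  let F : ModuleCat.{u} R := ModuleCat.of R (Fin a → R)
  let b : Fin a → F := fun i => Pi.single i (1 : R)
  -- The coordinate inclusions of `Hom(R^a, B) = B^a`; evaluations at the basis vectors are the
  -- matching projections.
  let σ : Fin a → (B →ₗ[R] homMod F B) := fun i =>
    LinearMap.smulRightₗ (LinearMap.proj i : F →ₗ[R] R)
  have hσ : ∀ i x (v : F), (σ i x : F →ₗ[R] B) v = (v i : R) • x := fun i x v => rfl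
  have hsum : ∑ i, σ i ∘ₗ LinearMap.applyₗ (b i) = (LinearMap.id : homMod F B →ₗ[R] homMod F B) := by
    refine LinearMap.ext fun f => LinearMap.ext fun v => ?_
    rw [LinearMap.sum_apply, LinearMap.id_apply]
    refine (LinearMap.sum_apply _ _ _).trans ?_
    conv_rhs => rw [← Finset.univ_sum_single (v : Fin a → R)]
    refine Eq.trans ?_ (map_sum f _ _).symm
    refine Finset.sum_congr rfl fun i _ => ?_
    refine (hσ i _ v).trans ((f.map_smul _ _).symm.trans (congrArg f ?_))
    change (v i : R) • Pi.single i (1 : R) = Pi.single i (v i)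
    rw [← Pi.single_smul, smul_eq_mul, mul_one]
  have hσb : ∀ i k, LinearMap.applyₗ (b k) ∘ₗ σ i =
      if i = k then (LinearMap.id : B →ₗ[R] B) else 0 := by
    intro i k
    refine LinearMap.ext fun x => ?_
    refine (hσ i x (b k)).trans ?_
    change (Pi.single k (1 : R) : Fin a → R) i • x = _
    split_ifs with h
    · subst h; rw [Pi.single_eq_same, one_smul]; rfl
    · rw [Pi.single_eq_of_ne h, zero_smul]; rfl
  constructor
  · refine (injective_iff_map_eq_zero _).mpr fun e he => ?_
    rw [← extPush_id e, ← hsum, map_sum, LinearMap.sum_apply]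
    refine Finset.sum_eq_zero fun i _ => ?_
    rw [extPush_comp, ← extHomToHom_apply, he, LinearMap.zero_apply, map_zero]
  · intro h
    refine ⟨∑ i, extPush n N B (homMod F B) (σ i) (h (b i)), ?_⟩
    refine LinearMap.pi_ext' fun k => LinearMap.ext_ring ?_
    change extHomToHom n N F B _ (b k) = h (b k)
    rw [extHomToHom_apply, map_sum, Finset.sum_eq_single k]
    · rw [← extPush_comp, hσb, if_pos rfl, extPush_id]
    · intro i _ hi
      rw [← extPush_comp, hσb, if_neg hi, map_zero, LinearMap.zero_apply]
    · exact fun hk => absurd (Finset.mem_univ k) hk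

theorem nonempty_ext_syzygy_equiv {F Z : ModuleCat.{u} R} [Module.Projective R F]
    {i : Z →ₗ[R] F} {p : F →ₗ[R] L} (hi : Function.Injective i) (hip : Function.Exact i p)
    (hp : Function.Surjective p) {k : ℕ} (hk : 0 < k) (B : ModuleCat.{u} R) :
    Nonempty (extMod k Z B ≃ₗ[R] extMod (k + 1) L B) := by
  obtain ⟨δ, h1, h2⟩ := exists_extPull_connecting hi hip hp k B
  have := subsingleton_ext_of_projective (X := F) (K := B) hk
  have := subsingleton_ext_of_projective (X := F) (K := B) k.succ_pos
  exact ⟨LinearEquiv.ofBijective δ ⟨injective_of_exact h1, surjective_of_exact h2⟩⟩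

theorem subsingleton_ext_syzygy {F Z : ModuleCat.{u} R} [Module.Projective R F]
    {i : Z →ₗ[R] F} {p : F →ₗ[R] L} (hi : Function.Injective i) (hip : Function.Exact i p)
    (hp : Function.Surjective p) {k : ℕ} (hk : 0 < k) :
    Subsingleton (extMod k Z B) ↔ Subsingleton (extMod (k + 1) L B) := by
  obtain ⟨e⟩ := nonempty_ext_syzygy_equiv hi hip hp hk B
  exact e.toEquiv.subsingleton_congr

variable [IsNoetherianRing R]

/-- Induction on the degree, for all `L` at once. A syzygy `Z` of `L` gives an exact sequence `0 →
Hom(L, B) → B^a → Hom(Z, B) → 0`, so `Ext^{i+1}(N, Hom(L, B))` lies between `Ext^i(N, Hom(Z, B))`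
and `Ext^{i+1}(N, B^a)`, both zero. -/
theorem subsingleton_ext_hom [Module.Finite R L] (hN : ∀ i < n, Subsingleton (extMod i N B))
    (hL : ∀ j, 0 < j → Subsingleton (extMod j L B)) :
    ∀ i < n, Subsingleton (extMod i N (homMod L B)) := by
  intro i
  induction i generalizing L with
  | zero =>
    intro h0
    have := hN 0 h0
    rw [subsingleton_ext_zero_iff] at this ⊢
    refine subsingleton_of_forall_eq 0 fun f => LinearMap.ext fun x => LinearMap.ext fun l => ?_
    exact LinearMap.congr_fun (Subsingleton.elim ((LinearMap.applyₗ l : homMod L B →ₗ[R] B) ∘ₗ f) 0) x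
  | succ i ih =>
    intro hi
    obtain ⟨a, Z, j, p, hfin, hj, hjp, hp⟩ := exists_syzygy L
    have : Module.Projective R (ModuleCat.of R (Fin a → R)) :=
      inferInstanceAs (Module.Projective R (Fin a → R))
    have hZ : ∀ k, 0 < k → Subsingleton (extMod k Z B) := fun k hk =>
      (subsingleton_ext_syzygy hj hjp hp hk).mpr (hL (k + 1) k.succ_pos)
    have := hL 1 one_pos
    obtain ⟨δ, -, h2⟩ := exists_extPush_connecting (homPull_injective hp B)
      (homPull_exact hjp hp B) (homPull_surjective hj hjp hp B) i N
    have := ih hZ (by omega)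
    have := hN (i + 1) hi
    have hF : Subsingleton (extMod (i + 1) N (homMod (ModuleCat.of R (Fin a → R)) B)) :=
      (extHomToHom_free_bijective a).1.subsingleton
    exact (injective_of_exact h2).subsingleton

/-- If `Ext^j_R(L, B) = 0` for `j > 0` and `Ext^i_R(N, B) = 0` for `i < n`, then
`Ext^n_R(N, Hom_R(L, B))` is isomorphic to `Hom_R(L, Ext^n_R(N, B))`. -/
theorem extHomToHom_bijective [Module.Finite R L] (hN : ∀ i < n, Subsingleton (extMod i N B))
    (hL : ∀ j, 0 < j → Subsingleton (extMod j L B)) :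
    Function.Bijective (extHomToHom n N L B) := by
  -- `Ext^n(N, Hom(-, B))` is left exact on such presentations. Injectivity is needed for the syzygy
  -- as well as for `L`, hence the quantification over all modules.
  have key : ∀ L : ModuleCat.{u} R, Module.Finite R L →
      (∀ j, 0 < j → Subsingleton (extMod j L B)) →
      ∃ (a : ℕ) (Z : ModuleCat.{u} R) (i : Z →ₗ[R] ModuleCat.of R (Fin a → R))
      (p : ModuleCat.of R (Fin a → R) →ₗ[R] L), Module.Finite R Z ∧
      (∀ j, 0 < j → Subsingleton (extMod j Z B)) ∧ Function.Injective i ∧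
      Function.Exact i p ∧ Function.Surjective p ∧
      Function.Injective (extPush n N _ _ (homPull B p)) ∧
      Function.Exact (extPush n N _ _ (homPull B p)) (extPush n N _ _ (homPull B i)) := by
    intro L _ hL
    obtain ⟨a, Z, j, p, hfin, hj, hjp, hp⟩ := exists_syzygy L
    have : Module.Projective R (ModuleCat.of R (Fin a → R)) :=
      inferInstanceAs (Module.Projective R (Fin a → R))
    have hZ : ∀ k, 0 < k → Subsingleton (extMod k Z B) := fun k hk =>
      (subsingleton_ext_syzygy hj hjp hp hk).mpr (hL (k + 1) k.succ_pos)
    have := hL 1 one_pos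
    exact ⟨a, Z, j, p, hfin, hZ, hj, hjp, hp,
      extPush_injective (homPull_injective hp B) (homPull_exact hjp hp B)
        (homPull_surjective hj hjp hp B) n N (subsingleton_ext_hom hN hZ),
      extPush_exact (homPull_injective hp B) (homPull_exact hjp hp B)
        (homPull_surjective hj hjp hp B) n N⟩
  have hinj : ∀ L : ModuleCat.{u} R, Module.Finite R L →
      (∀ j, 0 < j → Subsingleton (extMod j L B)) →
      Function.Injective (extHomToHom n N L B) := by
    intro L hfin hL
    obtain ⟨a, Z, i, p, -, -, -, -, -, h1, -⟩ := key L hfin hL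
    refine (injective_iff_map_eq_zero _).mpr fun e he => h1 ?_
    rw [map_zero]
    refine (extHomToHom_free_bijective a).1 ?_
    rw [extHomToHom_extPush, he, LinearMap.zero_comp, map_zero]
  refine ⟨hinj L inferInstance hL, fun h => ?_⟩
  obtain ⟨a, Z, i, p, hfin, hZ, -, hip, hp, h1, h2⟩ := key L inferInstance hL
  obtain ⟨e', he'⟩ := (extHomToHom_free_bijective a).2 (h ∘ₗ p)
  obtain ⟨e, rfl⟩ := (h2 e').mp (hinj Z hfin hZ (by
    rw [extHomToHom_extPush, he', map_zero, LinearMap.comp_assoc, hip.linearMap_comp_eq_zero,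
      LinearMap.comp_zero]))
  refine ⟨e, (LinearMap.cancel_right hp).mp ?_⟩
  rw [← extHomToHom_extPush, he']

/-- `Ext^n_R(R ⧸ I, R)` is isomorphic to `Hom_R(K, Ext^n_R(R ⧸ I, K))`. -/
theorem IsSemidualizing.nonempty_extQuot_equiv {K : ModuleCat.{u} R} (hK : IsSemidualizing K)
    {I : Ideal R} (hI : ExtVanishesBelow n K I) :
    Nonempty (extQuot n (ringMod R) I ≃ₗ[R] homMod K (extQuot n K I)) := by
  have := hK.finite
  refine ⟨(extPushEquiv n (ModuleCat.of R (R ⧸ I)) hK.homothetyEquiv).trans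
    (LinearEquiv.ofBijective _ (extHomToHom_bijective (hI _ ?_) hK.ext_eq_zero))⟩
  exact (Ideal.annihilator_quotient (I := I)).ge

end ExtHom

section Cogenerated

variable {K W N : ModuleCat.{u} R}

theorem IsCogeneratedBy.hom (h : IsCogeneratedBy W N) :
    IsCogeneratedBy (homMod K W) (homMod K N) := fun _ hm =>
  LinearMap.ext fun k => h _ fun g => LinearMap.congr_fun (hm (homPush K g)) k

/-- Let `N'` be the common kernel of all maps `N → W`. By adjunction and `ν`, every map `Hom(K, N) →
Hom(K, W)` comes from a map `N → W`, so it kills any `K → N'`. Hence `Hom(K, N') = 0`, and `N' = 0`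
by faithfulness. -/
theorem IsCogeneratedBy.of_hom [IsNoetherianRing R] [Module.Finite R K] [Module.Finite R N]
    (hK : Module.annihilator R K = ⊥) (hN : Function.Bijective (nu K N))
    (h : IsCogeneratedBy (homMod K W) (homMod K N)) : IsCogeneratedBy W N := by
  let N' : Submodule R N := ⨅ g : N →ₗ[R] W, LinearMap.ker g
  have hN' : ∀ y, y ∈ N' ↔ ∀ g : N →ₗ[R] W, g y = 0 := fun y => by
    rw [Submodule.mem_iInf]; rfl
  have h0 : Subsingleton (K →ₗ[R] N') := by
    refine subsingleton_of_forall_eq 0 fun u => ?_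
    have hm : N'.subtype ∘ₗ u = 0 := by
      refine h (N'.subtype ∘ₗ u) fun f => LinearMap.ext fun k => ?_
      let t : TensorProduct R K (K →ₗ[R] N) →ₗ[R] W := TensorProduct.lift (LinearMap.flip f)
      have ht : (LinearEquiv.ofBijective _ hN).symm (u k).1 = k ⊗ₜ[R] (N'.subtype ∘ₗ u) := by
        rw [LinearEquiv.symm_apply_eq]; rfl
      have := (hN' _).mp (u k).2 (t ∘ₗ (LinearEquiv.ofBijective _ hN).symm.toLinearMap)
      rw [LinearMap.comp_apply, LinearEquiv.coe_coe, ht] at this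
      exact this
    exact LinearMap.ext fun k => Subtype.ext (LinearMap.congr_fun hm k)
  have := subsingleton_of_subsingleton_hom hK h0
  intro y hy
  exact congrArg Subtype.val (Subsingleton.elim (⟨y, (hN' y).mpr hy⟩ : N') 0)

theorem IsCogeneratedBy.of_equiv {W' N' : ModuleCat.{u} R} (h : IsCogeneratedBy W N)
    (e : W ≃ₗ[R] W') (e' : N' ≃ₗ[R] N) : IsCogeneratedBy W' N' := fun m hm =>
  e'.injective (by
    rw [map_zero]
    refine h _ fun f => e.injective ?_
    rw [map_zero]
    exact hm (e.toLinearMap ∘ₗ f ∘ₗ e'.toLinearMap))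

end Cogenerated

/-! ### Unit, counit and the restricted adjoint equivalence. -/

section UnitCounit

variable {K M N : ModuleCat.{u} R}

/-- A triangle identity: composed with `K ⊗ μ_M`, this counit is the swap of the tensor factors. The
next lemma is the other triangle identity. -/
theorem nu_tensor_bijective (h : Function.Bijective (mu K M)) :
    Function.Bijective (nu K ((tensorFunctor K).obj M)) := by
  let e : M ≃ₗ[R] homMod K ((tensorFunctor K).obj M) := LinearEquiv.ofBijective _ h
  have : nu K ((tensorFunctor K).obj M) ∘ₗ (e.lTensor K).toLinearMap =
      (TensorProduct.comm R K M).toLinearMap :=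
    TensorProduct.ext' fun k m => rfl
  have h2 : Function.Bijective (nu K ((tensorFunctor K).obj M) ∘ e.lTensor K) := by
    have h3 := (TensorProduct.comm R K M).bijective
    rw [← LinearEquiv.coe_toLinearMap, ← this] at h3
    exact h3
  exact (Function.Bijective.of_comp_iff _ (e.lTensor K).bijective).mp h2

theorem mu_hom_bijective (h : Function.Bijective (nu K N)) :
    Function.Bijective (mu K (homMod K N)) := by
  let e : TensorProduct R (K →ₗ[R] N) K ≃ₗ[R] N :=
    (TensorProduct.comm R _ _).trans (LinearEquiv.ofBijective _ h)
  have : LinearMap.llcomp R K _ _ e.toLinearMap ∘ₗ mu K (homMod K N) = LinearMap.id :=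
    LinearMap.ext fun f => LinearMap.ext fun k => rfl
  have he : Function.Bijective (LinearMap.llcomp R K _ _ e.toLinearMap) :=
    e.congrRight.bijective
  refine (Function.Bijective.of_comp_iff' he _).mp ?_
  have h3 := (Function.bijective_id : Function.Bijective (id : (K →ₗ[R] N) → _))
  rw [← LinearMap.id_coe (R := R), ← this] at h3
  exact h3

theorem annihilator_tensor_eq (h : Function.Bijective (mu K M)) :
    Module.annihilator R ((tensorFunctor K).obj M) = Module.annihilator R M := by
  refine le_antisymm ?_ fun r hr => Module.mem_annihilator.mpr fun t => ?_
  · exact (le_annihilator_hom (X := K) le_rfl).trans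
      ((mu K M).annihilator_le_of_injective h.1)
  · induction t using TensorProduct.induction_on with
    | zero => rw [smul_zero]
    | add a b ha hb => rw [smul_add, ha, hb, add_zero]
    | tmul m k =>
      refine (TensorProduct.smul_tmul' r m k).trans ?_
      rw [ Module.mem_annihilator.mp hr, TensorProduct.zero_tmul]

theorem annihilator_hom_eq (h : Function.Bijective (nu K N)) :
    Module.annihilator R (homMod K N) = Module.annihilator R N := by
  refine le_antisymm (fun r hr => Module.mem_annihilator.mpr fun y => ?_)
    (le_annihilator_hom le_rfl)
  obtain ⟨t, rfl⟩ := h.2 y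
  induction t with
  | zero => rw [map_zero, smul_zero]
  | add a b ha hb => rw [map_add, smul_add, ha, hb, add_zero]
  | tmul k f =>
    rw [nu_tmul]
    exact LinearMap.congr_fun (Module.mem_annihilator.mp hr f) k

variable [IsNoetherianRing R] [Module.Finite R K]

/-- By naturality of `ν`, the map `K ⊗ Hom(K, φ)` is surjective along with `φ`. So the cokernel of
`Hom(K, φ)` vanishes after tensoring with `K`, hence vanishes. -/
theorem homPush_surjective_of_nu {Y : ModuleCat.{u} R} [Module.Finite R N]
    (hK : Module.annihilator R K = ⊥)
    (hY : Function.Bijective (nu K Y)) (hN : Function.Bijective (nu K N)) {φ : Y →ₗ[R] N}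
    (hφ : Function.Surjective φ) : Function.Surjective (homPush K φ) := by
  have hnat : nu K N ∘ₗ (homPush K φ).lTensor K = φ ∘ₗ nu K Y :=
    TensorProduct.ext' fun k f => rfl
  have hs : Function.Surjective ((homPush K φ).lTensor K) := by
    have h1 : Function.Surjective (nu K N ∘ₗ (homPush K φ).lTensor K) := by
      rw [hnat]; exact hφ.comp hY.2
    intro t
    obtain ⟨s, hs⟩ := h1 (nu K N t)
    exact ⟨s, hN.1 hs⟩
  let Q := (K →ₗ[R] N) ⧸ LinearMap.range (homPush K φ)
  have hq := LinearMap.lTensor_surjective K (Submodule.mkQ_surjective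
    (LinearMap.range (homPush K φ)))
  have hex := lTensor_exact K (LinearMap.exact_map_mkQ_range (homPush K φ))
    (Submodule.mkQ_surjective _)
  have : Subsingleton (TensorProduct R K Q) := by
    refine subsingleton_of_forall_eq 0 fun t => ?_
    obtain ⟨s, rfl⟩ := hq t
    exact (hex s).mpr (hs s)
  have : Module.Finite R Q := inferInstance
  have hQ : Subsingleton Q := subsingleton_of_subsingleton_tensor hK ‹_›
  exact LinearMap.range_eq_top.mp (Submodule.Quotient.subsingleton_iff.mp hQ)

end UnitCounit

section Packaging

/-- The functors `- ⊗_R K` and `Hom_R(K, -)` restrict to an adjoint equivalence between any full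
subcategories of `∇_K(R)` and `Δ_K(R)` that they exchange. -/
theorem restrictsToAdjointEquivalence_of_exchange (K : ModuleCat.{u} R)
    {P Q : ObjectProperty (ModuleCat.{u} R)}
    (hP : ∀ M, P M → Function.Bijective (mu K M)) (hQ : ∀ N, Q N → Function.Bijective (nu K N))
    (hF : ∀ M, P M → Q ((tensorFunctor K).obj M))
    (hG : ∀ N, Q N → P ((homFunctor K).obj N)) :
    RestrictsToAdjointEquivalence K P Q := by
  let F := Q.lift (P.ι ⋙ tensorFunctor K) fun M => hF M.obj M.property
  let G := P.lift (Q.ι ⋙ homFunctor K) fun N => hG N.obj N.property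
  let η : 𝟭 P.FullSubcategory ⟶ F ⋙ G :=
    { app := fun M => ⟨ModuleCat.ofHom (mu K M.obj)⟩
      naturality := fun M M' f => by
        refine ObjectProperty.hom_ext _ (ModuleCat.hom_ext (LinearMap.ext fun m => ?_))
        rfl }
  let ε : G ⋙ F ⟶ 𝟭 Q.FullSubcategory :=
    { app := fun N => ⟨ModuleCat.ofHom
        (nu K N.obj ∘ₗ (TensorProduct.comm R (K →ₗ[R] N.obj) K).toLinearMap)⟩
      naturality := fun N N' f => by
        refine ObjectProperty.hom_ext _ (ModuleCat.hom_ext (TensorProduct.ext' fun g k => ?_))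
        rfl }
  let adj : F ⊣ G := Adjunction.mkOfUnitCounit
    { unit := η
      counit := ε
      left_triangle := by
        refine NatTrans.ext (funext fun M => ?_)
        refine ObjectProperty.hom_ext _ (ModuleCat.hom_ext (TensorProduct.ext' fun m k => ?_))
        rfl
      right_triangle := by
        refine NatTrans.ext (funext fun N => ?_)
        refine ObjectProperty.hom_ext _ (ModuleCat.hom_ext (LinearMap.ext fun f => ?_))
        rfl }
  have hη : ∀ M, IsIso (adj.unit.app M) := fun M => by
    have h1 : IsIso (ModuleCat.ofHom (mu K M.obj)) :=
      (LinearEquiv.ofBijective _ (hP M.obj M.property)).toModuleIso.isIso_hom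
    have : IsIso (P.ι.map (adj.unit.app M)) := h1
    exact isIso_of_reflects_iso _ P.ι
  have hε : ∀ N, IsIso (adj.counit.app N) := fun N => by
    have h1 : IsIso (ModuleCat.ofHom
        (nu K N.obj ∘ₗ (TensorProduct.comm R (K →ₗ[R] N.obj) K).toLinearMap)) :=
      ((TensorProduct.comm R (K →ₗ[R] N.obj) K).trans
        (LinearEquiv.ofBijective _ (hQ N.obj N.property))).toModuleIso.isIso_hom
    have : IsIso (Q.ι.map (adj.counit.app N)) := h1
    exact isIso_of_reflects_iso _ Q.ι
  have hFe : F.IsEquivalence := adj.toEquivalence.isEquivalence_functor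
  have hGe : G.IsEquivalence := adj.toEquivalence.isEquivalence_inverse
  exact ⟨fun M => hF M.obj M.property, fun N => hG N.obj N.property, adj, hFe, hGe,
    fun _ => rfl, fun _ => rfl⟩

end Packaging

/-! ### Exchange of linked and colinked modules. -/

section AdjointPair

variable [IsNoetherianRing R] {K : ModuleCat.{u} R} {n : ℕ}
  {𝒳 𝒴 : ObjectProperty (ModuleCat.{u} R)}

omit [IsNoetherianRing R] in
instance finite_tensorFunctor_obj [Module.Finite R K] (M : ModuleCat.{u} R) [Module.Finite R M] :
    Module.Finite R ((tensorFunctor K).obj M) :=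
  inferInstanceAs (Module.Finite R (TensorProduct R M K))

instance finite_homMod [Module.Finite R K] (M : ModuleCat.{u} R) [Module.Finite R M] :
    Module.Finite R (homMod K M) :=
  inferInstanceAs (Module.Finite R (K →ₗ[R] M))

/-- The covering `φ ⊗ K` satisfies the colinkage criterion: through `μ`, the map `Hom(K, φ ⊗ K)` is
`φ` itself, and cogeneration of `M ≅ Hom(K, M ⊗ K)` by `Ext^n(R/I, R) ≅ Hom(K, Ext^n(R/I, K))` is
reflected to `M ⊗ K`. -/
theorem IsAdjointPair.isColinked_tensor (hK : IsSemidualizing K) (h : IsAdjointPair n K 𝒳 𝒴)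
    {M : ModuleCat.{u} R} (hM : Nabla K M) (hl : IsLinked n (ringMod R) 𝒳 M) :
    IsColinked n K 𝒴 ((tensorFunctor K).obj M) := by
  obtain ⟨X, φ, hφ, hinj, hcog⟩ := hl.exists_isEpiFrom h.reflexive
  have := hK.finite
  have := hM.1
  have hX := hφ.source_mem
  have := h.reflexive.finite X hX
  have hmuX := (h.le_auslander X hX).2.1
  have hann := annihilator_tensor_eq hmuX
  have hsurj : Function.Surjective ((tensorFunctor K).map φ).hom :=
    LinearMap.rTensor_surjective K hφ.surjective
  have hnat : homPush K ((tensorFunctor K).map φ).hom ∘ₗ mu K X = mu K M ∘ₗ φ.hom :=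
    LinearMap.ext fun x => rfl
  have hnat' : ∀ x, homPush K ((tensorFunctor K).map φ).hom (mu K X x) = mu K M (φ.hom x) :=
    LinearMap.congr_fun hnat
  have hepi : IsEpiFrom 𝒴 ((tensorFunctor K).map φ) :=
    { source_mem := h.tensor_mem X hX
      finite := inferInstance
      surjective := hsurj
      grade_eq := by
        rw [grade_eq_of_annihilator_eq hann, grade_eq_of_annihilator_eq
          (annihilator_tensor_eq hM.2), hφ.grade_eq] }
  refine isColinked_of_isEpiFrom hK h.coreflexive hepi (fun hi => hinj fun x y hxy => ?_)
    (nu_tensor_bijective hM.2) (fun g => ?_) ?_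
  · refine hmuX.1 (homPush_injective hi K ?_)
    rw [hnat', hnat', hxy]
  · obtain ⟨m, rfl⟩ := hM.2.2 g
    obtain ⟨x, rfl⟩ := hφ.surjective m
    exact ⟨mu K X x, hnat' x⟩
  · rw [hann]
    have hgr := h.reflexive.grade_eq X hX
    obtain ⟨e⟩ := hK.nonempty_extQuot_equiv (hK.extVanishesBelow hgr.ge)
    exact IsCogeneratedBy.of_hom hK.annihilator_eq_bot (nu_tensor_bijective hM.2)
      (hcog.of_equiv e (LinearEquiv.ofBijective _ hM.2).symm)

/-- The covering `Hom(K, φ)` satisfies the linkage criterion: it is surjective by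
`homPush_surjective_of_nu`, and `Hom(K, -)` carries cogeneration by `Ext^n(R/I, K)` to cogeneration
by `Ext^n(R/I, R)`. -/
theorem IsAdjointPair.isLinked_hom (hK : IsSemidualizing K) (h : IsAdjointPair n K 𝒳 𝒴)
    {N : ModuleCat.{u} R} (hN : Delta K N) (hl : IsColinked n K 𝒴 N) :
    IsLinked n (ringMod R) 𝒳 ((homFunctor K).obj N) := by
  obtain ⟨Y, φ, hφ, hinj, hcog⟩ := hl.exists_isEpiFrom hK h.coreflexive
  have := hK.finite
  have := hN.1
  have hY := hφ.source_mem
  have := h.coreflexive.finite Y hY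
  have hnuY := h.coreflexive.nu_bijective Y hY
  have hann := annihilator_hom_eq hnuY
  have hsurj : Function.Surjective (homPush K φ.hom) :=
    homPush_surjective_of_nu hK.annihilator_eq_bot hnuY hN.2 hφ.surjective
  have hfin : Module.Finite R ((homFunctor K).obj N) := finite_homMod N
  have hepi : IsEpiFrom 𝒳 ((homFunctor K).map φ) :=
    { source_mem := h.hom_mem Y hY
      finite := hfin
      surjective := hsurj
      grade_eq := by
        change grade (homMod K N) = grade (homMod K Y)
        rw [grade_eq_of_annihilator_eq hann, grade_eq_of_annihilator_eq
          (annihilator_hom_eq hN.2), hφ.grade_eq] }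
  refine isLinked_of_isEpiFrom h.reflexive hepi (fun hi => hinj ?_) ?_
  · have h0 : Subsingleton (K →ₗ[R] LinearMap.ker φ.hom) := by
      refine subsingleton_of_forall_eq 0 fun u => ?_
      have h1 : (LinearMap.ker φ.hom).subtype ∘ₗ u = 0 := hi (LinearMap.ext fun k =>
        (LinearMap.mem_ker.mp (u k).2).trans (map_zero φ.hom).symm)
      exact LinearMap.ext fun k => Subtype.ext (LinearMap.congr_fun h1 k)
    have := subsingleton_of_subsingleton_hom hK.annihilator_eq_bot h0
    exact LinearMap.ker_eq_bot.mp (Submodule.subsingleton_iff_eq_bot.mp this)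
  · change IsCogeneratedBy (extQuot n (ringMod R) (Module.annihilator R (homMod K Y))) (homMod K N)
    rw [hann]
    have hgr := h.coreflexive.grade_eq Y hY
    obtain ⟨e⟩ := hK.nonempty_extQuot_equiv (hK.extVanishesBelow hgr.ge)
    exact hcog.hom.of_equiv e.symm (LinearEquiv.refl R _)

omit [IsNoetherianRing R] in
theorem delta_tensor_of_nabla (hK : IsSemidualizing K) {M : ModuleCat.{u} R}
    (hM : Nabla K M) : Delta K ((tensorFunctor K).obj M) := by
  have := hK.finite
  have := hM.1
  exact ⟨inferInstance, nu_tensor_bijective hM.2⟩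

theorem nabla_hom_of_delta (hK : IsSemidualizing K) {N : ModuleCat.{u} R}
    (hN : Delta K N) : Nabla K ((homFunctor K).obj N) := by
  have := hK.finite
  have := hN.1
  exact ⟨finite_homMod N, mu_hom_bijective hN.2⟩

theorem IsAdjointPair.restrictsToAdjointEquivalence (hK : IsSemidualizing K)
    (h : IsAdjointPair n K 𝒳 𝒴) :
    RestrictsToAdjointEquivalence K (fun M => Nabla K M ∧ IsLinked n (ringMod R) 𝒳 M)
      (fun N => Delta K N ∧ IsColinked n K 𝒴 N) :=
  restrictsToAdjointEquivalence_of_exchange K (fun _ hM => hM.1.2) (fun _ hN => hN.1.2)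
    (fun _ hM => ⟨delta_tensor_of_nabla hK hM.1, h.isColinked_tensor hK hM.1 hM.2⟩)
    (fun _ hN => ⟨nabla_hom_of_delta hK hN.1, h.isLinked_hom hK hN.1 hN.2⟩)

end AdjointPair

/-! ### Vanishing of Tor. -/

section Tor

theorem lTensor_rTensor_comm {A B C D : Type*} [AddCommGroup A] [AddCommGroup B] [AddCommGroup C]
    [AddCommGroup D] [Module R A] [Module R B] [Module R C] [Module R D] (f : A →ₗ[R] B)
    (p : C →ₗ[R] D) (x : TensorProduct R A C) :
    p.lTensor B (f.rTensor C x) = f.rTensor D (p.lTensor A x) := by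
  rw [← LinearMap.comp_apply, ← LinearMap.comp_apply, LinearMap.lTensor_comp_rTensor,
    LinearMap.rTensor_comp_lTensor]

/-- Exactness of a complex after `M ⊗ -`, for the cokernel `M₃` of a map `M₁ → M₂`. -/
theorem lTensor_exact_of_exact {M₁ M₂ M₃ F₂ F₁ F₀ E : Type*} [AddCommGroup M₁]
    [AddCommGroup M₂] [AddCommGroup M₃] [AddCommGroup F₂] [AddCommGroup F₁] [AddCommGroup F₀]
    [AddCommGroup E] [Module R M₁] [Module R M₂] [Module R M₃] [Module R F₂] [Module R F₁]
    [Module R F₀] [Module R E] {f : M₁ →ₗ[R] M₂} {g : M₂ →ₗ[R] M₃} (hfg : Function.Exact f g)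
    (hg : Function.Surjective g) {d₃ : F₂ →ₗ[R] F₁} {d₂ : F₁ →ₗ[R] F₀} {d₁ : F₀ →ₗ[R] E}
    (hd₁ : d₁ ∘ₗ d₂ = 0) (hd₂ : d₂ ∘ₗ d₃ = 0) (hE : Function.Injective (f.rTensor E))
    (h₁ : Function.Exact (d₂.lTensor M₁) (d₁.lTensor M₁))
    (h₂ : Function.Exact (d₃.lTensor M₂) (d₂.lTensor M₂)) :
    Function.Exact (d₃.lTensor M₃) (d₂.lTensor M₃) := by
  intro z
  constructor
  · intro hz
    -- Lift the cycle to `y` over `M₂`. Its boundary comes from some `x` over `M₁`; `hE` makes `x` a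
    -- cycle, hence a boundary, and correcting `y` by it yields a cycle over `M₂`.
    obtain ⟨y, rfl⟩ := LinearMap.rTensor_surjective F₁ hg z
    rw [lTensor_rTensor_comm] at hz
    obtain ⟨x, hx⟩ := (rTensor_exact F₀ hfg hg _).mp hz
    have hx0 : d₁.lTensor M₁ x = 0 := by
      apply hE
      rw [map_zero, ← lTensor_rTensor_comm, hx, ← LinearMap.comp_apply, ← LinearMap.lTensor_comp,
        hd₁, LinearMap.lTensor_zero, LinearMap.zero_apply]
    obtain ⟨w, rfl⟩ := (h₁ x).mp hx0
    obtain ⟨v, hv⟩ := (h₂ (y - f.rTensor F₁ w)).mp (by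
      rw [map_sub, lTensor_rTensor_comm, hx, sub_self])
    refine ⟨g.rTensor F₂ v, ?_⟩
    rw [lTensor_rTensor_comm, hv, map_sub, (rTensor_exact F₁ hfg hg).apply_apply_eq_zero, sub_zero]
  · rintro ⟨v, rfl⟩
    rw [← LinearMap.comp_apply, ← LinearMap.lTensor_comp, hd₂, LinearMap.lTensor_zero,
      LinearMap.zero_apply]

variable {K M : ModuleCat.{u} R}

/-- `Tor` is computed by resolving its second argument, so the vanishing is exactness of `M ⊗ P` at
`j + 1`. -/
theorem torVanishes_succ_iff (P : ProjectiveResolution K) (M : ModuleCat.{u} R) (j : ℕ) :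
    TorVanishes (j + 1) M K ↔ Function.Exact ((P.complex.d (j + 2) (j + 1)).hom.lTensor M)
      ((P.complex.d (j + 1) j).hom.lTensor M) := by
  have h := P.isoLeftDerivedObj ((MonoidalCategory.tensoringLeft (ModuleCat.{u} R)).obj M) (j + 1)
  refine h.isZero_iff.trans ((HomologicalComplex.exactAt_iff_isZero_homology _ _).symm.trans ?_)
  rw [HomologicalComplex.exactAt_iff' _ (j + 2) (j + 1) j (by simp) (by simp),
    ShortComplex.ShortExact.moduleCat_exact_iff_function_exact]
  rfl

theorem exact_of_projectiveResolution (P : ProjectiveResolution K) (j : ℕ) :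
    Function.Exact (P.complex.d (j + 2) (j + 1)).hom (P.complex.d (j + 1) j).hom :=
  (ShortComplex.ShortExact.moduleCat_exact_iff_function_exact _).mp (P.exact_succ j)

theorem exists_augmentation (P : ProjectiveResolution K) :
    ∃ ε : P.complex.X 0 →ₗ[R] K,
      Function.Exact (P.complex.d 1 0).hom ε ∧ Function.Surjective ε :=
  ⟨(P.π.f 0).hom, (ShortComplex.ShortExact.moduleCat_exact_iff_function_exact _).mp P.exact₀,
    (ModuleCat.epi_iff_surjective (P.π.f 0)).mp inferInstance⟩

instance (P : ProjectiveResolution K) (j : ℕ) : Module.Projective R (P.complex.X j) :=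
  (IsProjective.iff_projective _).mpr (P.projective j)

/-- `Tor_i(M, K)` is caught between `Tor_i(X, K)` and `Tor_{i-1}(L, K)`. For `i = 1` the latter is
`L ⊗ K`, and injectivity of `f ⊗ K` replaces its vanishing; in the chase the augmentation `P₀ → K`
then serves as the last differential. -/
theorem torVanishes_of_exact {L X : ModuleCat.{u} R} {f : L →ₗ[R] X} {g : X →ₗ[R] M}
    (hf : Function.Injective f) (hfg : Function.Exact f g) (hg : Function.Surjective g)
    (hfK : Function.Injective (f.rTensor K)) (hL : ∀ i, 0 < i → TorVanishes i L K)
    (hX : ∀ i, 0 < i → TorVanishes i X K) {i : ℕ} (hi : 0 < i) : TorVanishes i M K := by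
  let P := projectiveResolution K
  have hd := fun j => (exact_of_projectiveResolution P j).linearMap_comp_eq_zero
  obtain ⟨j, rfl⟩ := Nat.exists_eq_succ_of_ne_zero hi.ne'
  refine (torVanishes_succ_iff P M j).mpr ?_
  have h₂ := (torVanishes_succ_iff P X j).mp (hX _ hi)
  cases j with
  | zero =>
    obtain ⟨ε, hε, hε'⟩ := exists_augmentation P
    exact lTensor_exact_of_exact hfg hg hε.linearMap_comp_eq_zero (hd 0) hfK
      (lTensor_exact L hε hε') h₂
  | succ j =>
    exact lTensor_exact_of_exact hfg hg (hd j) (hd (j + 1))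
      (Module.Flat.rTensor_preserves_injective_linearMap f hf)
      ((torVanishes_succ_iff P L j).mp (hL _ j.succ_pos)) h₂

theorem torVanishes_of_projective [Module.Projective R M] {i : ℕ} (hi : 0 < i) :
    TorVanishes i M K := by
  obtain ⟨j, rfl⟩ := Nat.exists_eq_succ_of_ne_zero hi.ne'
  let P := projectiveResolution K
  exact (torVanishes_succ_iff P M j).mpr
    (Module.Flat.lTensor_exact M (exact_of_projectiveResolution P j))

theorem torVanishes_congr {N : ModuleCat.{u} R} (e : M ≃ₗ[R] N) {i : ℕ} :
    TorVanishes i M K ↔ TorVanishes i N K :=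
  (((Tor (ModuleCat.{u} R) i).mapIso e.toModuleIso).app K).isZero_iff

end Tor

/-! ### The Auslander and Bass classes. -/

section DualBasis

/-- Writing the identity as a finite sum of maps through `R` lets statements about additive functors
spread from `R` to all finitely generated projectives. -/
theorem exists_dual_basis (P : Type*) [AddCommGroup P] [Module R P] [Module.Finite R P]
    [Module.Projective R P] :
    ∃ (a : ℕ) (p : Fin a → P →ₗ[R] R) (s : Fin a → R →ₗ[R] P),
      ∑ i, s i ∘ₗ p i = LinearMap.id := by
  obtain ⟨a, f, g, -, -, hfg⟩ := Module.Finite.exists_comp_eq_id_of_projective R P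
  refine ⟨a, fun i => LinearMap.proj i ∘ₗ g, fun i => f ∘ₗ LinearMap.single R (fun _ => R) i, ?_⟩
  have := congrArg (fun t => f ∘ₗ t ∘ₗ g) (sum_single_comp_proj R a)
  simp only [LinearMap.id_comp, hfg] at this
  refine Eq.trans (LinearMap.ext fun x => ?_) this
  simp only [LinearMap.sum_apply, LinearMap.comp_apply, map_sum]

end DualBasis

section Foxby

variable {K : ModuleCat.{u} R}

theorem mu_ringMod_bijective (hK : IsSemidualizing K) :
    Function.Bijective (mu K (ringMod R)) := by
  have h : (TensorProduct.lid R K).congrRight.toLinearMap ∘ₗ mu K (ringMod R) =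
      LinearMap.lsmul R K := LinearMap.ext fun r => LinearMap.ext fun k => rfl
  have h1 := hK.homothety
  rw [← h] at h1
  exact (Function.Bijective.of_comp_iff' (TensorProduct.lid R K).congrRight.bijective _).mp h1

theorem mu_naturality {M N : ModuleCat.{u} R} (f : M →ₗ[R] N) (x : M) :
    f.rTensor K ∘ₗ mu K M x = mu K N (f x) := rfl

theorem mu_bijective_of_projective (hK : IsSemidualizing K) (P : ModuleCat.{u} R)
    [Module.Finite R P] [Module.Projective R P] : Function.Bijective (mu K P) := by
  obtain ⟨a, p, s, hps⟩ := exists_dual_basis (R := R) P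
  constructor
  · refine (injective_iff_map_eq_zero _).mpr fun x hx => ?_
    have h : ∀ i, p i x = 0 := fun i => by
      apply (mu_ringMod_bijective hK).1
      rw [map_zero]
      refine (mu_naturality (N := ringMod R) (p i) x).symm.trans ?_
      rw [hx]
      exact LinearMap.comp_zero _
    rw [← LinearMap.id_apply (R := R) x, ← hps, LinearMap.sum_apply]
    exact Finset.sum_eq_zero fun i _ => by rw [LinearMap.comp_apply, h, map_zero]
  · intro φ
    choose r hr using fun i => (mu_ringMod_bijective hK).2 ((p i).rTensor K ∘ₗ φ)
    refine ⟨∑ i, s i (r i), ?_⟩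
    rw [map_sum]
    have h : ∀ i, mu K P (s i (r i)) = ((s i ∘ₗ p i).rTensor K) ∘ₗ φ := fun i => by
      refine (mu_naturality (M := ringMod R) (s i) (r i)).symm.trans ?_
      rw [hr, LinearMap.rTensor_comp]
      rfl
    rw [Finset.sum_congr rfl fun i _ => h i]
    refine LinearMap.ext fun k => ?_
    rw [LinearMap.sum_apply]
    have h2 : ∑ i, (s i ∘ₗ p i).rTensor K = LinearMap.id := by
      rw [← LinearMap.coe_rTensorHom, ← map_sum, hps, LinearMap.coe_rTensorHom,
        LinearMap.rTensor_id]
    have h3 := LinearMap.congr_fun h2 (φ k)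
    rw [LinearMap.sum_apply] at h3
    exact h3

theorem subsingleton_ext_tensor_of_projective (hK : IsSemidualizing K) (P : ModuleCat.{u} R)
    [Module.Finite R P] [Module.Projective R P] {i : ℕ} (hi : 0 < i) :
    Subsingleton (extMod i K ((tensorFunctor K).obj P)) := by
  obtain ⟨a, p, s, hps⟩ := exists_dual_basis (R := R) P
  have := hK.ext_eq_zero i hi
  have h0 : Subsingleton (extMod i K ((tensorFunctor K).obj (ringMod R))) :=
    (extPushEquiv i K (L := (tensorFunctor K).obj (ringMod R))
      (TensorProduct.lid R K).symm).symm.injective.subsingleton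
  refine subsingleton_of_forall_eq 0 fun e => ?_
  have h2 : ∑ i, (s i ∘ₗ p i).rTensor K = LinearMap.id := by
    rw [← LinearMap.coe_rTensorHom, ← map_sum, hps, LinearMap.coe_rTensorHom,
      LinearMap.rTensor_id]
  have h3 := extPush_id e
  refine h3.symm.trans ?_
  have h4 : (LinearMap.id : (tensorFunctor K).obj P →ₗ[R] (tensorFunctor K).obj P) =
    ∑ i, (s i ∘ₗ p i).rTensor K := h2.symm
  rw [h4, map_sum, LinearMap.sum_apply]
  refine Finset.sum_eq_zero fun j _ => ?_
  rw [LinearMap.rTensor_comp]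
  refine (extPush_comp (L := (tensorFunctor K).obj (ringMod R)) _ _ e).trans ?_
  rw [Subsingleton.elim (extPush i K _ ((tensorFunctor K).obj (ringMod R)) ((p j).rTensor K) e) 0,
    map_zero]

theorem auslander_of_projective (hK : IsSemidualizing K) (P : ModuleCat.{u} R)
    [Module.Finite R P] [Module.Projective R P] : Auslander K P :=
  ⟨inferInstance, mu_bijective_of_projective hK P, fun _ hi =>
    ⟨torVanishes_of_projective hi, subsingleton_ext_tensor_of_projective hK P hi⟩⟩

theorem bass_tensor_of_auslander (hK : IsSemidualizing K) {M : ModuleCat.{u} R}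
    (h : Auslander K M) : Bass K ((tensorFunctor K).obj M) := by
  have := hK.finite
  have := h.1
  exact ⟨finite_tensorFunctor_obj M, nu_tensor_bijective h.2.1, fun i hi =>
    ⟨(torVanishes_congr (LinearEquiv.ofBijective _ h.2.1)).mp (h.2.2 i hi).1, (h.2.2 i hi).2⟩⟩

variable [IsNoetherianRing R]

theorem auslander_hom_of_bass (hK : IsSemidualizing K) {N : ModuleCat.{u} R}
    (h : Bass K N) : Auslander K (homMod K N) := by
  have := hK.finite
  have := h.1
  refine ⟨finite_homMod N, mu_hom_bijective h.2.1, fun i hi => ⟨(h.2.2 i hi).1, ?_⟩⟩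
  have := (h.2.2 i hi).2
  exact (extPushEquiv i K (K := (tensorFunctor K).obj (homMod K N))
    ((TensorProduct.comm R _ _).trans (LinearEquiv.ofBijective _ h.2.1))).injective.subsingleton

variable {L X M : ModuleCat.{u} R} {f : L →ₗ[R] X} {g : X →ₗ[R] M}

/-- A map from `K` into `ker (f ⊗ K)` is `μ_L(l)` for some `l`, and naturality of `μ` gives `μ_X(f
l) = 0`, so `l = 0`. Faithfulness of `K` then kills the kernel. -/
theorem rTensor_injective_of_mu (hK : IsSemidualizing K) [Module.Finite R L]
    (hL : Function.Bijective (mu K L)) (hX : Function.Injective (mu K X))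
    (hf : Function.Injective f) : Function.Injective (f.rTensor K) := by
  have := hK.finite
  have : Module.Finite R (LinearMap.ker (f.rTensor K)) := Module.IsNoetherian.finite _ _
  have h : Subsingleton (K →ₗ[R] LinearMap.ker (f.rTensor K)) := by
    refine subsingleton_of_forall_eq 0 fun φ => ?_
    obtain ⟨l, hl⟩ := hL.2 ((LinearMap.ker (f.rTensor K)).subtype ∘ₗ φ)
    have h1 : l = 0 := by
      apply hf
      apply hX
      rw [map_zero, map_zero, ← mu_naturality, hl]
      exact LinearMap.ext fun k => (φ k).2
    rw [h1, map_zero] at hl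
    exact LinearMap.ext fun k => Subtype.ext (LinearMap.congr_fun hl.symm k)
  have h2 := subsingleton_of_subsingleton_hom hK.annihilator_eq_bot h
  exact LinearMap.ker_eq_bot.mp (Submodule.subsingleton_iff_eq_bot.mp h2)

/-- The sequence stays exact under `- ⊗ K`, by the preceding lemma, and then under `Hom(K, -)`,
since `Ext^1(K, L ⊗ K) = 0`. Comparison along `μ` and the long exact sequences give the claim. -/
theorem auslander_of_exact (hK : IsSemidualizing K) (hf : Function.Injective f)
    (hfg : Function.Exact f g) (hg : Function.Surjective g) (hL : Auslander K L)
    (hX : Auslander K X) : Auslander K M := by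
  have := hL.1
  have := hX.1
  have hinj := rTensor_injective_of_mu hK hL.2.1 hX.2.1.1 hf
  have hexa : Function.Exact (f.rTensor K) (g.rTensor K) := rTensor_exact K hfg hg
  have hsur := LinearMap.rTensor_surjective K hg
  let f' : (tensorFunctor K).obj L →ₗ[R] (tensorFunctor K).obj X := f.rTensor K
  let g' : (tensorFunctor K).obj X →ₗ[R] (tensorFunctor K).obj M := g.rTensor K
  have hf' : Function.Injective f' := hinj
  have hfg' : Function.Exact f' g' := hexa
  have hg' : Function.Surjective g' := hsur
  have hL1 := (hL.2.2 1 one_pos).2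
  refine ⟨Module.Finite.of_surjective g hg, ⟨?_, fun φ => ?_⟩, fun i hi =>
    ⟨torVanishes_of_exact hf hfg hg hinj (fun i hi => (hL.2.2 i hi).1)
      (fun i hi => (hX.2.2 i hi).1) hi, ?_⟩⟩
  · refine (injective_iff_map_eq_zero _).mpr fun m hm => ?_
    obtain ⟨x, rfl⟩ := hg m
    obtain ⟨ψ, hψ⟩ := (homPush_exact hf' hfg' K (mu K X x)).mp hm
    obtain ⟨l, rfl⟩ := hL.2.1.2 ψ
    rw [← hX.2.1.1 (show mu K X (f l) = mu K X x from hψ), hfg.apply_apply_eq_zero]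
  · obtain ⟨ψ, hψ⟩ := homPush_surjective hf' hfg' hg' K φ
    obtain ⟨x, rfl⟩ := hX.2.1.2 ψ
    exact ⟨g x, hψ⟩
  · obtain ⟨δ, h1, -⟩ := exists_extPush_connecting hf' hfg' hg' i K
    have := (hX.2.2 i hi).2
    have := (hL.2.2 (i + 1) i.succ_pos).2
    exact subsingleton_of_exact h1

omit [IsNoetherianRing R] in
theorem nu_naturality (f : L →ₗ[R] X) (t : TensorProduct R K (K →ₗ[R] L)) :
    nu K X ((homPush K f).lTensor K t) = f (nu K L t) :=
  LinearMap.congr_fun (show nu K X ∘ₗ (homPush K f).lTensor K = f ∘ₗ nu K L from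
    TensorProduct.ext' fun _ _ => rfl) t

omit [IsNoetherianRing R] in
-- Dual to the Auslander case: `Hom(K, -)` preserves exactness because `Ext^1(K, L) = 0`, and
-- tensoring the result with `K` keeps the left map injective by naturality of `ν`.
theorem bass_of_exact (hf : Function.Injective f)
    (hfg : Function.Exact f g) (hg : Function.Surjective g) (hL : Bass K L)
    (hX : Bass K X) : Bass K M := by
  have := hX.1
  have hL1 := (hL.2.2 1 one_pos).2
  have hinj := homPush_injective hf K
  have hexa := homPush_exact hf hfg K
  have hsur := homPush_surjective hf hfg hg K
  have hfK : Function.Injective ((homPush K f).lTensor K) := by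
    refine (injective_iff_map_eq_zero _).mpr fun t ht => hL.2.1.1 (hf ?_)
    rw [map_zero, map_zero, ← nu_naturality]
    exact (congrArg (nu K X) ht).trans (map_zero _)
  refine ⟨Module.Finite.of_surjective g hg, ⟨?_, fun m => ?_⟩, fun i hi => ⟨?_, ?_⟩⟩
  · refine (injective_iff_map_eq_zero _).mpr fun t ht => ?_
    obtain ⟨t, rfl⟩ := LinearMap.lTensor_surjective K hsur t
    obtain ⟨l, hl⟩ := (hfg _).mp ((nu_naturality g t).symm.trans ht)
    obtain ⟨s, rfl⟩ := hL.2.1.2 l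
    rw [← hX.2.1.1 ((nu_naturality f s).trans hl)]
    exact (lTensor_exact K hexa hsur).apply_apply_eq_zero s
  · obtain ⟨x, rfl⟩ := hg m
    obtain ⟨t, rfl⟩ := hX.2.1.2 x
    exact ⟨_, nu_naturality g t⟩
  · refine torVanishes_of_exact hinj hexa hsur ?_ (fun i hi => (hL.2.2 i hi).1)
      (fun i hi => (hX.2.2 i hi).1) hi
    exact (LinearMap.lTensor_inj_iff_rTensor_inj _ _).mp hfK
  · obtain ⟨δ, h1, -⟩ := exists_extPush_connecting hf hfg hg i K
    have := (hX.2.2 i hi).2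
    have := (hL.2.2 (i + 1) i.succ_pos).2
    exact subsingleton_of_exact h1

omit [IsNoetherianRing R] in
-- The case of zero kernel in `bass_of_exact`; the zero module lies in the Bass class as `0 ⊗ K`.
theorem bass_congr (hK : IsSemidualizing K) (e : L ≃ₗ[R] M) (h : Bass K L) : Bass K M := by
  have h0 := bass_tensor_of_auslander hK
    (auslander_of_projective hK (ModuleCat.of R PUnit.{u + 1}))
  have : Subsingleton ((tensorFunctor K).obj (ModuleCat.of R PUnit.{u + 1})) :=
    inferInstanceAs (Subsingleton (TensorProduct R PUnit.{u + 1} K))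
  refine bass_of_exact (f := (0 : (tensorFunctor K).obj (ModuleCat.of R PUnit.{u + 1}) →ₗ[R] L))
    (g := e.toLinearMap) (Function.injective_of_subsingleton _)
    (fun x => ⟨fun h => ⟨0, (e.map_eq_zero_iff.mp h).symm⟩, ?_⟩) e.surjective h0 h
  rintro ⟨y, rfl⟩
  exact map_zero e

end Foxby

/-! ### Resolutions by `P_K`-modules and perfect modules. -/

section KProjectiveResolutions

variable {K L X N : ModuleCat.{u} R}

theorem kProjective_tensor (K P : ModuleCat.{u} R) [Module.Finite R P] [Module.Projective R P] :
    KProjective K ((tensorFunctor K).obj P) :=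
  ⟨P, inferInstance, inferInstance, ⟨Iso.refl _⟩⟩

theorem kProjective_of_subsingleton [Subsingleton N] : KProjective K N :=
  have : Subsingleton ((tensorFunctor K).obj (ModuleCat.of R PUnit.{u + 1})) :=
    inferInstanceAs (Subsingleton (TensorProduct R PUnit.{u + 1} K))
  ⟨ModuleCat.of R PUnit.{u + 1}, inferInstance, inferInstance,
    ⟨(LinearEquiv.ofSubsingleton N ((tensorFunctor K).obj (ModuleCat.of R PUnit.{u + 1}))).toModuleIso⟩⟩

theorem hasKProjectiveResolution_zero (h : KProjective K N) : HasKProjectiveResolution K N 0 := by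
  refine ⟨fun i => Nat.casesOn i N fun _ => ModuleCat.of R PUnit.{u + 1}, fun i => 0,
    LinearMap.id, fun i => ?_, fun i hi => ?_, Function.surjective_id, fun x => ?_, fun i x => ?_⟩
  · cases i with
    | zero => exact h
    | succ i => exact kProjective_of_subsingleton (N := ModuleCat.of R PUnit.{u + 1})
  · cases i with
    | zero => exact absurd hi (lt_irrefl 0)
    | succ i => exact inferInstanceAs (Subsingleton PUnit.{u + 1})
  · exact ⟨fun hx => ⟨0, hx.symm⟩, fun ⟨y, hy⟩ => hy.symm⟩
  · exact ⟨fun _ => ⟨0, rfl⟩, fun _ => rfl⟩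

theorem HasKProjectiveResolution.kProjective (h : HasKProjectiveResolution K N 0) :
    KProjective K N := by
  obtain ⟨X, d, ε, hX, h0, hε, hd, -⟩ := h
  have := h0 1 one_pos
  obtain ⟨P, h1, h2, ⟨e⟩⟩ := hX 0
  exact ⟨P, h1, h2, ⟨(LinearEquiv.ofBijective ε ⟨injective_of_exact hd, hε⟩).toModuleIso.symm.trans e⟩⟩

theorem hasKProjectiveResolution_succ {f : L →ₗ[R] X} {g : X →ₗ[R] N}
    (hf : Function.Injective f) (hfg : Function.Exact f g) (hg : Function.Surjective g)
    (hX : KProjective K X) {t : ℕ} (h : HasKProjectiveResolution K L t) :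
    HasKProjectiveResolution K N (t + 1) := by
  obtain ⟨Y, d, ε, hY, h0, hε, hd, hds⟩ := h
  refine ⟨fun i => Nat.casesOn i X Y, fun i => match i with
    | 0 => f ∘ₗ ε
    | i + 1 => d i, g, fun i => ?_, fun i hi => ?_, hg, fun x => ?_, fun i => ?_⟩
  · cases i with
    | zero => exact hX
    | succ i => exact hY i
  · cases i with
    | zero => exact absurd hi (Nat.not_lt_zero _)
    | succ i => exact h0 i (Nat.lt_of_succ_lt_succ hi)
  · refine (hfg x).trans ⟨?_, ?_⟩
    · rintro ⟨l, rfl⟩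
      obtain ⟨y, rfl⟩ := hε l
      exact ⟨y, rfl⟩
    · rintro ⟨y, rfl⟩
      exact ⟨ε y, rfl⟩
  · cases i with
    | zero =>
      intro x
      refine Iff.trans ?_ (hd x)
      exact ⟨fun hx => hf (hx.trans (map_zero f).symm),
        fun hx => (congrArg f hx).trans (map_zero f)⟩
    | succ i => exact hds i

theorem HasKProjectiveResolution.exists_exact {t : ℕ} (h : HasKProjectiveResolution K N (t + 1)) :
    ∃ (L X : ModuleCat.{u} R) (f : L →ₗ[R] X) (g : X →ₗ[R] N), Function.Injective f ∧
      Function.Exact f g ∧ Function.Surjective g ∧ KProjective K X ∧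
      HasKProjectiveResolution K L t := by
  obtain ⟨X, d, ε, hX, h0, hε, hd, hds⟩ := h
  refine ⟨ModuleCat.of R (LinearMap.ker ε), X 0, (LinearMap.ker ε).subtype, ε,
    Subtype.val_injective, LinearMap.exact_subtype_ker_map ε, hε, hX 0, fun i => X (i + 1),
    fun i => d (i + 1), (d 0).codRestrict (LinearMap.ker ε) hd.apply_apply_eq_zero,
    fun i => hX _, fun i hi => h0 _ (Nat.succ_lt_succ hi), ?_, fun x => ?_, fun i => hds _⟩
  · rintro ⟨x, hx⟩
    obtain ⟨y, rfl⟩ := (hd x).mp hx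
    exact ⟨y, rfl⟩
  · refine Iff.trans ?_ (hds 0 x)
    exact Subtype.ext_iff

theorem hasKProjectiveResolution_congr {M : ModuleCat.{u} R} (e : M ≃ₗ[R] N) {t : ℕ}
    (h : HasKProjectiveResolution K M t) : HasKProjectiveResolution K N t := by
  obtain ⟨X, d, ε, hX, h0, hε, hd, hds⟩ := h
  refine ⟨X, d, e.toLinearMap ∘ₗ ε, hX, h0, e.surjective.comp hε, fun x => ?_, hds⟩
  exact (e.map_eq_zero_iff).trans (hd x)

theorem hasProjectiveDimensionLT_succ_of_exact {f : L →ₗ[R] X} {g : X →ₗ[R] N}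
    (hf : Function.Injective f) (hfg : Function.Exact f g) (hg : Function.Surjective g)
    [Module.Projective R X] (t : ℕ) :
    HasProjectiveDimensionLT N (t + 2) ↔ HasProjectiveDimensionLT L (t + 1) :=
  (shortExact_of_exact hf hfg hg).hasProjectiveDimensionLT_X₃_iff t
    X.projective_of_categoryTheory_projective

theorem hasProjectiveDimensionLT_one_iff :
    HasProjectiveDimensionLT N 1 ↔ Module.Projective R N :=
  projective_iff_hasProjectiveDimensionLT_one.symm.trans (IsProjective.iff_projective N).symm

theorem KProjective.exists_equiv_hom (hK : IsSemidualizing K) (h : KProjective K N) :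
    Bass K N ∧ Module.Projective R (homMod K N) := by
  obtain ⟨P, h1, h2, ⟨e⟩⟩ := h
  refine ⟨bass_congr hK e.symm.toLinearEquiv
    (bass_tensor_of_auslander hK (auslander_of_projective hK P)), ?_⟩
  exact Module.Projective.of_equiv ((LinearEquiv.ofBijective _ (mu_bijective_of_projective hK P)).trans
    (e.symm.toLinearEquiv.congrRight : homMod K ((tensorFunctor K).obj P) ≃ₗ[R] homMod K N))

/-- Peeling off one term at a time keeps the kernels in the Bass class, so `Hom(K, -)` turns the
`P_K`-resolution into a projective resolution of the same length. -/
theorem HasKProjectiveResolution.bass (hK : IsSemidualizing K) {t : ℕ}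
    (h : HasKProjectiveResolution K N t) :
    Bass K N ∧ HasProjectiveDimensionLT (homMod K N) (t + 1) := by
  induction t generalizing N with
  | zero =>
    obtain ⟨h1, h2⟩ := h.kProjective.exists_equiv_hom hK
    exact ⟨h1, hasProjectiveDimensionLT_one_iff.mpr h2⟩
  | succ t ih =>
    obtain ⟨L, X, f, g, hf, hfg, hg, hX, hL⟩ := h.exists_exact
    obtain ⟨h1, h2⟩ := hX.exists_equiv_hom hK
    obtain ⟨h3, h4⟩ := ih hL
    have := (h3.2.2 1 one_pos).2
    exact ⟨bass_of_exact hf hfg hg h3 h1, (hasProjectiveDimensionLT_succ_of_exact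
      (homPush_injective hf K) (homPush_exact hf hfg K) (homPush_surjective hf hfg hg K) t).mpr h4⟩

variable [IsNoetherianRing R]

/-- By induction the syzygy lies in the Auslander class, so tensoring its inclusion with `K` stays
injective and the projective resolution becomes a `P_K`-resolution. -/
theorem hasKProjectiveResolution_tensor (hK : IsSemidualizing K) {t : ℕ} {M : ModuleCat.{u} R}
    [Module.Finite R M] (h : HasProjectiveDimensionLT M (t + 1)) :
    Auslander K M ∧ HasKProjectiveResolution K ((tensorFunctor K).obj M) t := by
  induction t generalizing M with
  | zero =>
    have := hasProjectiveDimensionLT_one_iff.mp h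
    exact ⟨auslander_of_projective hK M, hasKProjectiveResolution_zero (kProjective_tensor K M)⟩
  | succ t ih =>
    obtain ⟨a, Z, i, p, hZ, hi, hip, hp⟩ := exists_syzygy M
    have : Module.Projective R (ModuleCat.of R (Fin a → R)) :=
      inferInstanceAs (Module.Projective R (Fin a → R))
    obtain ⟨h1, h2⟩ := ih ((hasProjectiveDimensionLT_succ_of_exact hi hip hp t).mp h)
    have h3 := auslander_of_projective hK (ModuleCat.of R (Fin a → R))
    refine ⟨auslander_of_exact hK hi hip hp h1 h3, ?_⟩
    exact hasKProjectiveResolution_succ (X := (tensorFunctor K).obj (ModuleCat.of R (Fin a → R)))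
      (f := i.rTensor K) (g := p.rTensor K)
      (rTensor_injective_of_mu hK h1.2.1 h3.2.1.1 hi) (rTensor_exact K hip hp)
      (LinearMap.rTensor_surjective K hp) (kProjective_tensor K _) h2

end KProjectiveResolutions

section Perfect

variable {K M N : ModuleCat.{u} R} {n : ℕ}

/-- The lower bound on the projective dimension is automatic: grade `n` means `Ext^n(M, R) ≠ 0`. -/
theorem perfectModules_iff : PerfectModules n M ↔
    Module.Finite R M ∧ grade M = n ∧ HasProjectiveDimensionLT M (n + 1) := by
  refine and_congr_right fun _ => and_congr_right fun hg => ?_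
  refine Iff.trans ?_ (projectiveDimension_le_iff M n)
  refine ⟨fun h => h.le, fun h => le_antisymm h ((projectiveDimension_ge_iff M n).mpr fun h0 => ?_)⟩
  have := (grade_eq_natCast_iff.mp hg).2
  have h1 : Subsingleton (extMod n M (ringMod R)) :=
    HasProjectiveDimensionLT.subsingleton M n n le_rfl (ringMod R)
  exact not_subsingleton _ h1

theorem kPerfectModules_iff [IsNoetherianRing R] (hK : IsSemidualizing K) :
    KPerfectModules n K N ↔
      Module.Finite R N ∧ grade N = n ∧ HasKProjectiveResolution K N n := by
  refine and_congr_right fun hN => and_congr_right fun hg => ⟨fun h => ?_, fun h => ?_⟩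
  · have h1 : ∃ t, HasKProjectiveResolution K N t := by
      by_contra! h0
      have : kProjectiveDimension K N = ⊤ := by simp [kProjectiveDimension, h0]
      rw [this] at h
      exact absurd h (ENat.top_ne_natCast n)
    classical
    have h2 := Nat.find_spec h1
    have h3 : kProjectiveDimension K N = Nat.find h1 :=
      le_antisymm (iInf₂_le _ h2)
        (le_iInf₂ fun t ht => Nat.cast_le.mpr (Nat.find_min' h1 ht))
    rw [h] at h3
    rwa [← Nat.cast_injective h3] at h2
  · refine le_antisymm (iInf₂_le n h) (le_iInf₂ fun t ht => Nat.cast_le.mpr ?_)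
    -- A resolution shorter than `n` would make the projective dimension of `Hom(K, N)` less than
    -- `n`, while its grade is still `n`.
    by_contra! hlt
    have := hK.finite
    obtain ⟨h1, h2⟩ := ht.bass hK
    have h3 : grade (homMod K N) = n := by
      have := finite_homMod (K := K) N
      rw [grade_eq_of_annihilator_eq (annihilator_hom_eq h1.2.1), hg]
    have := (grade_eq_natCast_iff.mp h3).2
    have h4 : Subsingleton (extMod n (homMod K N) (ringMod R)) :=
      HasProjectiveDimensionLT.subsingleton (homMod K N) (t + 1) n hlt (ringMod R)
    exact not_subsingleton _ h4

variable [IsNoetherianRing R]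

theorem PerfectModules.tensor (hK : IsSemidualizing K) (h : PerfectModules n M) :
    Auslander K M ∧ KPerfectModules n K ((tensorFunctor K).obj M) := by
  obtain ⟨h1, h2, h3⟩ := perfectModules_iff.mp h
  have := hK.finite
  obtain ⟨h4, h5⟩ := hasKProjectiveResolution_tensor hK h3
  refine ⟨h4, (kPerfectModules_iff hK).mpr ⟨finite_tensorFunctor_obj M, ?_, h5⟩⟩
  rw [grade_eq_of_annihilator_eq (annihilator_tensor_eq h4.2.1), h2]

theorem KPerfectModules.hom (hK : IsSemidualizing K) (h : KPerfectModules n K N) :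
    Bass K N ∧ PerfectModules n (homMod K N) := by
  obtain ⟨h1, h2, h3⟩ := (kPerfectModules_iff hK).mp h
  have := hK.finite
  have := finite_homMod (K := K) N
  obtain ⟨h4, h5⟩ := h3.bass hK
  refine ⟨h4, perfectModules_iff.mpr ⟨finite_homMod N, ?_, h5⟩⟩
  rw [grade_eq_of_annihilator_eq (annihilator_hom_eq h4.2.1), h2]

omit [IsNoetherianRing R] in
theorem PerfectModules.congr (e : M ≃ₗ[R] N) (h : PerfectModules n M) : PerfectModules n N := by
  obtain ⟨h1, h2, h3⟩ := h
  exact ⟨Module.Finite.equiv e, (grade_congr e).symm.trans h2,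
    (projectiveDimension_eq_of_iso e.toModuleIso).symm.trans h3⟩

theorem KPerfectModules.congr (hK : IsSemidualizing K) (e : M ≃ₗ[R] N)
    (h : KPerfectModules n K M) : KPerfectModules n K N := by
  obtain ⟨h1, h2, h3⟩ := (kPerfectModules_iff hK).mp h
  exact (kPerfectModules_iff hK).mpr ⟨Module.Finite.equiv e, (grade_congr e).symm.trans h2,
    hasKProjectiveResolution_congr e h3⟩

end Perfect

/-! ### Dualizing a resolution of a perfect module. -/

section Cokernels

theorem nonempty_equiv_of_ker_iff {B C B' C' : Type*} [AddCommGroup B] [AddCommGroup C]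
    [AddCommGroup B'] [AddCommGroup C'] [Module R B] [Module R C] [Module R B'] [Module R C']
    {g : B →ₗ[R] C} {g' : B' →ₗ[R] C'} (hg : Function.Surjective g) (hg' : Function.Surjective g')
    (b : B ≃ₗ[R] B') (h : ∀ x, g x = 0 ↔ g' (b x) = 0) : Nonempty (C ≃ₗ[R] C') := by
  refine ⟨(g.quotKerEquivOfSurjective hg).symm.trans ((Submodule.Quotient.equiv _ _ b ?_).trans
    (g'.quotKerEquivOfSurjective hg'))⟩
  ext y
  refine ⟨?_, fun hy => ⟨b.symm y, (h _).mpr ?_, b.apply_symm_apply y⟩⟩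
  · rintro ⟨x, hx, rfl⟩
    exact (h x).mp hx
  · rw [b.apply_symm_apply]
    exact hy

variable {A B C : ModuleCat.{u} R} {f : A →ₗ[R] B} {g : B →ₗ[R] C}

theorem exists_homPull_connecting (hf : Function.Injective f) (hfg : Function.Exact f g)
    (hg : Function.Surjective g) (K : ModuleCat.{u} R) :
    ∃ δ : homMod A K →ₗ[R] extMod 1 C K,
      Function.Exact (homPull K f) δ ∧ Function.Exact δ (extPull 1 B C K g) := by
  obtain ⟨δ, h1, h2⟩ := exists_extPull_connecting hf hfg hg 0 K
  refine ⟨δ ∘ₗ (extZeroEquiv A K).symm.toLinearMap, fun x => ?_, fun x => (h2 x).trans ?_⟩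
  · refine (h1 _).trans ⟨?_, ?_⟩
    · rintro ⟨y, hy⟩
      refine ⟨extZeroEquiv B K y, ?_⟩
      have := extZeroEquiv_extPull f y
      rw [hy] at this
      exact this.symm.trans ((extZeroEquiv A K).apply_symm_apply x)
    · rintro ⟨y, rfl⟩
      refine ⟨(extZeroEquiv B K).symm y, (extZeroEquiv A K).injective ?_⟩
      rw [extZeroEquiv_extPull, LinearEquiv.apply_symm_apply]
      exact ((extZeroEquiv A K).apply_symm_apply _).symm
  · exact ((extZeroEquiv A K).symm.surjective.range_comp δ).symm ▸ Iff.rfl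

end Cokernels

section DualSyzygies

variable {M B B' : ModuleCat.{u} R}

instance finite_pi_of (a : ℕ) : Module.Finite R (ModuleCat.of R (Fin a → R)) :=
  inferInstanceAs (Module.Finite R (Fin a → R))

instance projective_pi_of (a : ℕ) : Module.Projective R (ModuleCat.of R (Fin a → R)) :=
  inferInstanceAs (Module.Projective R (Fin a → R))

instance projective_homMod_ringMod (P : ModuleCat.{u} R) [Module.Finite R P]
    [Module.Projective R P] : Module.Projective R (homMod P (ringMod R)) :=
  inferInstanceAs (Module.Projective R (Module.Dual R P))

/-- `B` is the `k`-th cosyzygy in a sequence `0 → P₀* → P₁* → Q₂ → ⋯ → Q_{k+1} → B → 0` of finitely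
generated projective modules, where `P₁ → P₀ → M → 0` is a presentation of `M`. -/
def IsDualSyzygy (M : ModuleCat.{u} R) : ℕ → ModuleCat.{u} R → Prop
  | 0, B => ∃ (P₀ P₁ : ModuleCat.{u} R) (f : P₁ →ₗ[R] P₀) (g : P₀ →ₗ[R] M)
      (h : homMod P₁ (ringMod R) →ₗ[R] B), Module.Finite R P₀ ∧ Module.Finite R P₁ ∧
      Module.Projective R P₀ ∧ Module.Projective R P₁ ∧ Function.Exact f g ∧
      Function.Surjective g ∧ Function.Injective (homPull (ringMod R) f) ∧
      Function.Exact (homPull (ringMod R) f) h ∧ Function.Surjective h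
  | k + 1, B => ∃ (B' Q : ModuleCat.{u} R) (f : B' →ₗ[R] Q) (g : Q →ₗ[R] B), Module.Finite R Q ∧
      Module.Projective R Q ∧ Function.Injective f ∧ Function.Exact f g ∧
      Function.Surjective g ∧ IsDualSyzygy M k B'

theorem IsDualSyzygy.congr (e : B ≃ₗ[R] B') {k : ℕ} (h : IsDualSyzygy M k B) :
    IsDualSyzygy M k B' := by
  cases k with
  | zero =>
    obtain ⟨P₀, P₁, f, g, h, h1, h2, h3, h4, h5, h6, h7, h8, h9⟩ := h
    exact ⟨P₀, P₁, f, g, e.toLinearMap ∘ₗ h, h1, h2, h3, h4, h5, h6, h7,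
      fun x => (e.map_eq_zero_iff).trans (h8 x), e.surjective.comp h9⟩
  | succ k =>
    obtain ⟨B₁, Q, f, g, h1, h2, h3, h4, h5, h6⟩ := h
    exact ⟨B₁, Q, f, e.toLinearMap ∘ₗ g, h1, h2, h3,
      fun x => (e.map_eq_zero_iff).trans (h4 x), e.surjective.comp h5, h6⟩

variable [IsNoetherianRing R]

omit [IsNoetherianRing R] in
-- For `k = 0`, dualizing `0 → P₀* → P₁* → B → 0` returns the presentation `P₁ → P₀`, whose cokernel
-- `M` is therefore `Ext^1(B, R)`. Each further cosyzygy raises the degree by one.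
theorem IsDualSyzygy.ext_equiv {k : ℕ} (h : IsDualSyzygy M k B) :
    Nonempty (extMod (k + 1) B (ringMod R) ≃ₗ[R] M) ∧ HasProjectiveDimensionLT B (k + 2) := by
  induction k generalizing B with
  | zero =>
    obtain ⟨P₀, P₁, f, g, h, h1, h2, h3, h4, h5, h6, h7, h8, h9⟩ := h
    refine ⟨?_, (hasProjectiveDimensionLT_succ_of_exact h7 h8 h9 0).mpr
      (hasProjectiveDimensionLT_one_iff.mpr inferInstance)⟩
    obtain ⟨δ, h10, h11⟩ := exists_homPull_connecting h7 h8 h9 (ringMod R)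
    have := subsingleton_ext_of_projective (X := homMod P₁ (ringMod R)) (K := ringMod R) one_pos
    let e₀ : P₀ ≃ₗ[R] homMod (homMod P₀ (ringMod R)) (ringMod R) := Module.evalEquiv R P₀
    let e₁ : P₁ ≃ₗ[R] homMod (homMod P₁ (ringMod R)) (ringMod R) := Module.evalEquiv R P₁
    obtain ⟨e⟩ := nonempty_equiv_of_ker_iff h6 (surjective_of_exact h11) e₀ fun x => by
      refine (h5 x).trans (Iff.trans ⟨?_, ?_⟩ (h10 _).symm)
      · rintro ⟨y, rfl⟩
        exact ⟨e₁ y, rfl⟩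
      · rintro ⟨z, hz⟩
        obtain ⟨y, rfl⟩ := e₁.surjective z
        exact ⟨y, e₀.injective hz⟩
    exact ⟨e.symm⟩
  | succ k ih =>
    obtain ⟨B₁, Q, f, g, h1, h2, h3, h4, h5, h6⟩ := h
    obtain ⟨⟨e⟩, h7⟩ := ih h6
    obtain ⟨e'⟩ := nonempty_ext_syzygy_equiv h3 h4 h5 k.succ_pos (ringMod R)
    exact ⟨⟨e'.symm.trans e⟩, (hasProjectiveDimensionLT_succ_of_exact h3 h4 h5 (k + 1)).mpr h7⟩

omit [IsNoetherianRing R] in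
theorem exists_injective_comp_eq {A P C : ModuleCat.{u} R} {a : A →ₗ[R] P} {h : P →ₗ[R] B}
    {c : P →ₗ[R] C} (hah : Function.Exact a h) (hh : Function.Surjective h)
    (hac : Function.Exact a c) : ∃ v : B →ₗ[R] C, v ∘ₗ h = c ∧ Function.Injective v := by
  obtain ⟨v, hv⟩ := (homPull_exact hah hh C c).mp hac.linearMap_comp_eq_zero
  refine ⟨v, hv, (injective_iff_map_eq_zero v).mpr fun b hb => ?_⟩
  obtain ⟨y, rfl⟩ := hh b
  obtain ⟨z, rfl⟩ := (hac y).mp ((LinearMap.congr_fun hv y).symm.trans hb)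
  exact hah.apply_apply_eq_zero z

/-- `B` is the cokernel of `Z* → P*`, so it embeds in `Z'*` for the kernel `Z'` of `P → Z`, with
cokernel `Ext^1(Z, R)`. For `j = 0`, `Z'` is projective and this is the last cosyzygy. Otherwise
`Ext^1(Z, R) = 0` makes `B ≅ Z'*`, and the argument repeats with a free cover of `Z'`, raising `k`
and lowering `j`. -/
theorem isDualSyzygy_ext {j k : ℕ} {Z P : ModuleCat.{u} R} [Module.Finite R Z] [Module.Finite R P]
    [Module.Projective R P] {p : P →ₗ[R] Z} {h : homMod P (ringMod R) →ₗ[R] B}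
    (hp : Function.Surjective p) (hph : Function.Exact (homPull (ringMod R) p) h)
    (hh : Function.Surjective h) (hB : IsDualSyzygy M k B) (hZ : HasProjectiveDimensionLT Z (j + 2))
    (hext : ∀ i, 0 < i → i ≤ j → Subsingleton (extMod i Z (ringMod R))) :
    IsDualSyzygy M (k + j + 1) (extMod (j + 1) Z (ringMod R)) := by
  induction j generalizing k Z P B with
  | zero =>
    let Z' : ModuleCat.{u} R := ModuleCat.of R (LinearMap.ker p)
    let i : Z' →ₗ[R] P := (LinearMap.ker p).subtype
    have hi : Function.Injective i := Subtype.val_injective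
    have hip : Function.Exact i p := LinearMap.exact_subtype_ker_map p
    have : Module.Finite R Z' := inferInstanceAs (Module.Finite R (LinearMap.ker p))
    obtain ⟨v, hv, hvi⟩ := exists_injective_comp_eq hph hh (homPull_exact hip hp (ringMod R))
    obtain ⟨δ, h1, h2⟩ := exists_homPull_connecting hi hip hp (ringMod R)
    have := subsingleton_ext_of_projective (X := P) (K := ringMod R) one_pos
    have hZ' : Module.Projective R Z' := hasProjectiveDimensionLT_one_iff.mp
      ((hasProjectiveDimensionLT_succ_of_exact hi hip hp 0).mp hZ)
    refine ⟨B, homMod Z' (ringMod R), v, δ, finite_homMod _, inferInstance, hvi, fun x => ?_,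
      surjective_of_exact h2, hB⟩
    rw [h1 x, ← hv]
    exact (hh.range_comp v).symm ▸ Iff.rfl
  | succ j ih =>
    let Z' : ModuleCat.{u} R := ModuleCat.of R (LinearMap.ker p)
    let i : Z' →ₗ[R] P := (LinearMap.ker p).subtype
    have hi : Function.Injective i := Subtype.val_injective
    have hip : Function.Exact i p := LinearMap.exact_subtype_ker_map p
    have : Module.Finite R Z' := inferInstanceAs (Module.Finite R (LinearMap.ker p))
    obtain ⟨v, hv, hvi⟩ := exists_injective_comp_eq hph hh (homPull_exact hip hp (ringMod R))
    have := hext 1 one_pos (by omega)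
    have hsurj : Function.Surjective (homPull (ringMod R) i) :=
      homPull_surjective hi hip hp (ringMod R)
    have hvs : Function.Surjective v := fun y => by
      obtain ⟨x, rfl⟩ := hsurj y
      exact ⟨h x, LinearMap.congr_fun hv x⟩
    obtain ⟨a, -, -, p', -, -, -, hp'⟩ := exists_syzygy Z'
    let w := homPull (ringMod R) p'
    have hw : Function.Injective w := homPull_injective hp' _
    have h3 : IsDualSyzygy M (k + 1) (ModuleCat.of R
        (homMod (ModuleCat.of R (Fin a → R)) (ringMod R) ⧸ LinearMap.range w)) :=
      ⟨B, homMod (ModuleCat.of R (Fin a → R)) (ringMod R), w ∘ₗ v, (LinearMap.range w).mkQ,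
        finite_homMod _, inferInstance, hw.comp hvi, fun x => by
          refine ((LinearMap.exact_map_mkQ_range w) x).trans ?_
          exact (hvs.range_comp w).symm ▸ Iff.rfl,
        Submodule.mkQ_surjective _, hB⟩
    have h4 := ih hp' (LinearMap.exact_map_mkQ_range w) (Submodule.mkQ_surjective _) h3
      ((hasProjectiveDimensionLT_succ_of_exact hi hip hp (j + 1)).mp hZ)
      fun m hm hmj => (subsingleton_ext_syzygy hi hip hp hm).mpr
        (hext (m + 1) m.succ_pos (by omega))
    obtain ⟨e⟩ := nonempty_ext_syzygy_equiv hi hip hp j.succ_pos (ringMod R)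
    rw [show k + (j + 1) + 1 = k + 1 + j + 1 by omega]
    exact h4.congr e

/-- If `Ext^i_R(M, R) = 0` for `i < n` and `M` has projective dimension at most `n`, then
`Ext^n_R(M, R)` has projective dimension at most `n` and its dual `Ext^n_R(-, R)` is `M`. -/
theorem nonempty_ext_ext_equiv {n : ℕ} [Module.Finite R M]
    (hM : HasProjectiveDimensionLT M (n + 1))
    (hext : ∀ i < n, Subsingleton (extMod i M (ringMod R))) :
    Nonempty (extMod n (extMod n M (ringMod R)) (ringMod R) ≃ₗ[R] M) ∧
      HasProjectiveDimensionLT (extMod n M (ringMod R)) (n + 1) := by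
  cases n with
  | zero =>
    have := hasProjectiveDimensionLT_one_iff.mp hM
    let e := extZeroEquiv M (ringMod R)
    have e' : M ≃ₗ[R] homMod (homMod M (ringMod R)) (ringMod R) := Module.evalEquiv R M
    exact ⟨⟨(extPullEquiv 0 (ringMod R) (X := homMod M (ringMod R)) e.symm).trans
      ((extZeroEquiv _ _).trans e'.symm)⟩, hasProjectiveDimensionLT_one_iff.mpr
        (Module.Projective.of_equiv (M := homMod M (ringMod R)) e.symm)⟩
  | succ n =>
    obtain ⟨a, Z, i, p, hZ, hi, hip, hp⟩ := exists_syzygy M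
    have h0 := subsingleton_ext_zero_iff.mp (hext 0 n.succ_pos)
    have hinj : Function.Injective (homPull (ringMod R) i) := by
      have : Subsingleton (homMod M (ringMod R)) := h0
      exact injective_of_exact (homPull_exact hip hp (ringMod R))
    have hpdZ := (hasProjectiveDimensionLT_succ_of_exact hi hip hp n).mp hM
    suffices h : IsDualSyzygy M n (extMod (n + 1) M (ringMod R)) from h.ext_equiv
    cases n with
    | zero =>
      have hZp := hasProjectiveDimensionLT_one_iff.mp hpdZ
      obtain ⟨δ, h1, h2⟩ := exists_homPull_connecting hi hip hp (ringMod R)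
      have := subsingleton_ext_of_projective (X := ModuleCat.of R (Fin a → R)) (K := ringMod R)
        one_pos
      exact ⟨_, Z, i, p, δ, inferInstance, hZ, inferInstance, hZp, hip, hp, hinj, h1,
        surjective_of_exact h2⟩
    | succ n =>
      obtain ⟨b, Z', i', q, hZ', hi', hiq, hq⟩ := exists_syzygy Z
      have := hext 1 (by omega)
      have hsurj : Function.Surjective (homPull (ringMod R) i) :=
        homPull_surjective hi hip hp (ringMod R)
      let w := homPull (ringMod R) q
      have hw : Function.Injective w := homPull_injective hq _
      -- Since `Hom(M, R) = Ext^1(M, R) = 0`, dualizing identifies `Z*` with the dual of the first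
      -- free cover, so the cokernel of `Z* → (R^b)*` is a cosyzygy of index `0`.
      have h3 : IsDualSyzygy M 0 (ModuleCat.of R
          (homMod (ModuleCat.of R (Fin b → R)) (ringMod R) ⧸ LinearMap.range w)) := by
        refine ⟨_, _, i ∘ₗ q, p, (LinearMap.range w).mkQ, inferInstance, inferInstance,
          inferInstance, inferInstance, fun x => (hip x).trans ?_, hp, hw.comp hinj,
          fun x => ((LinearMap.exact_map_mkQ_range w) x).trans ?_, Submodule.mkQ_surjective _⟩
        · exact (hq.range_comp i).symm ▸ Iff.rfl
        · exact (hsurj.range_comp w).symm ▸ Iff.rfl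
      have h4 := isDualSyzygy_ext hq (LinearMap.exact_map_mkQ_range w)
        (Submodule.mkQ_surjective _) h3 hpdZ fun m hm hmj =>
          (subsingleton_ext_syzygy hi hip hp hm).mpr (hext (m + 1) (by omega))
      obtain ⟨e⟩ := nonempty_ext_syzygy_equiv hi hip hp n.succ_pos (ringMod R)
      rw [Nat.zero_add] at h4
      exact h4.congr e

end DualSyzygies

/-! ### From abstract isomorphisms to biduality. -/

section Evaluation

/-- A Noetherian module that is isomorphic to its double `W`-dual in any way is `W`-reflexive. -/
theorem applyₗ_bijective_of_equiv {M W : Type*} [AddCommGroup M] [AddCommGroup W] [Module R M]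
    [Module R W] [IsNoetherian R M] (θ : M ≃ₗ[R] ((M →ₗ[R] W) →ₗ[R] W)) :
    Function.Bijective (LinearMap.applyₗ : M →ₗ[R] (M →ₗ[R] W) →ₗ[R] W) := by
  let ev : M →ₗ[R] (M →ₗ[R] W) →ₗ[R] W := LinearMap.applyₗ
  -- The retraction `θ⁻¹ ∘ (ev_{M*})* ∘ θ**` of evaluation. Composed with `θ` it is a surjective
  -- endomorphism of `M`, hence injective, so `r` is a two-sided inverse.
  let r : ((M →ₗ[R] W) →ₗ[R] W) →ₗ[R] M := θ.symm.toLinearMap ∘ₗ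
    LinearMap.lcomp R W (LinearMap.applyₗ : (M →ₗ[R] W) →ₗ[R] ((M →ₗ[R] W) →ₗ[R] W) →ₗ[R] W) ∘ₗ
    LinearMap.lcomp R W (LinearMap.lcomp R W θ.toLinearMap)
  have hr : ∀ m, r (ev m) = m := fun m => by
    change θ.symm _ = m
    rw [LinearEquiv.symm_apply_eq]
    rfl
  have hs : Function.Surjective (r ∘ₗ θ.toLinearMap) := fun m => by
    refine ⟨θ.symm (ev m), ?_⟩
    rw [LinearMap.comp_apply, LinearEquiv.coe_coe, LinearEquiv.apply_symm_apply, hr]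
  have hi := IsNoetherian.injective_of_surjective_endomorphism _ hs
  have hri : Function.Injective r := fun x y hxy => by
    obtain ⟨x, rfl⟩ := θ.surjective x
    obtain ⟨y, rfl⟩ := θ.surjective y
    exact congrArg θ (hi hxy)
  exact ⟨Function.LeftInverse.injective hr, fun x => ⟨r x, hri (hr (r x))⟩⟩

/-- Representing both `Ext` functors by `W` turns `η` into evaluation to the double `W`-dual and `θ`
into an abstract isomorphism with it. -/
theorem eta_bijective_of_equiv [IsNoetherianRing R] {K M : ModuleCat.{u} R} {n : ℕ}
    [Module.Finite R K] [Module.Finite R M] (hI : ExtVanishesBelow n K (Module.annihilator R M))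
    (θ : extMod n (extMod n M K) K ≃ₗ[R] M) : Function.Bijective (eta n K M) := by
  have h1 := extToHom_bijective hI (X := M) le_rfl
  have h2 := extToHom_bijective hI (X := extMod n M K) (annihilator_le_annihilator_ext n K M)
  let W : ModuleCat.{u} R := extQuot n K (Module.annihilator R M)
  let e₁ : extMod n M K ≃ₗ[R] (M →ₗ[R] W) := LinearEquiv.ofBijective _ h1
  let e₂ : extMod n (extMod n M K) K ≃ₗ[R] (extMod n M K →ₗ[R] W) := LinearEquiv.ofBijective _ h2
  let e₃ : (extMod n M K →ₗ[R] W) ≃ₗ[R] ((M →ₗ[R] W) →ₗ[R] W) :=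
    LinearEquiv.congrLeft W R e₁
  have h3 := applyₗ_bijective_of_equiv (θ.symm.trans (e₂.trans e₃))
  have h4 : (LinearMap.applyₗ : M →ₗ[R] (M →ₗ[R] W) →ₗ[R] W) =
      (e₂.trans e₃).toLinearMap ∘ₗ eta n K M := by
    refine LinearMap.ext fun m => LinearMap.ext fun w => ?_
    obtain ⟨e, rfl⟩ := e₁.surjective w
    have h5 := extToHom_eta h2 m e
    refine h5.symm.trans ?_
    change e₂ (eta n K M m) e = e₂ (eta n K M m) (e₁.symm (e₁ e))
    rw [e₁.symm_apply_apply]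
  rw [h4] at h3
  exact (Function.Bijective.of_comp_iff' (e₂.trans e₃).bijective _).mp h3

end Evaluation

section ExtTensor

variable {X C D : ModuleCat.{u} R} {n : ℕ}

/-- The natural map `Ext^n_R(X, R) ⊗ C → Ext^n_R(X, C)`. -/
def extTensor (n : ℕ) (X C : ModuleCat.{u} R) :
    (tensorFunctor C).obj (extMod n X (ringMod R)) →ₗ[R] extMod n X C :=
  TensorProduct.lift
    ((extPush n X (ringMod R) C ∘ₗ (LinearMap.ringLmapEquivSelf R R C).symm.toLinearMap).flip)

theorem extTensor_tmul (e : extMod n X (ringMod R)) (c : C) :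
    extTensor n X C (e ⊗ₜ c) = extPush n X (ringMod R) C (LinearMap.toSpanSingleton R C c) e := by
  rfl

theorem extTensor_lTensor (f : C →ₗ[R] D) (t : (tensorFunctor C).obj (extMod n X (ringMod R))) :
    extTensor n X D (f.lTensor (extMod n X (ringMod R)) t) =
      extPush n X C D f (extTensor n X C t) := by
  refine LinearMap.congr_fun (show extTensor n X D ∘ₗ f.lTensor (extMod n X (ringMod R)) =
    extPush n X C D f ∘ₗ extTensor n X C from TensorProduct.ext' fun e c => ?_) t
  change extTensor n X D (e ⊗ₜ f c) = extPush n X C D f (extTensor n X C (e ⊗ₜ c))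
  rw [extTensor_tmul, extTensor_tmul, ← extPush_comp]
  congr 2
  exact LinearMap.ext_ring (by simp)

theorem extTensor_ringMod_bijective : Function.Bijective (extTensor n X (ringMod R)) := by
  have : extTensor n X (ringMod R) =
      (TensorProduct.rid R (extMod n X (ringMod R))).toLinearMap := by
    refine TensorProduct.ext' fun e r => ?_
    rw [extTensor_tmul]
    have h : LinearMap.toSpanSingleton R (ringMod R) r = r • LinearMap.id :=
      LinearMap.ext_ring (by simp)
    rw [h, map_smul, LinearMap.smul_apply, extPush_id]
    rfl
  rw [this]
  exact (TensorProduct.rid R (extMod n X (ringMod R))).bijective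

theorem extTensor_bijective_of_projective [Module.Finite R C] [Module.Projective R C] :
    Function.Bijective (extTensor n X C) := by
  obtain ⟨a, p, s, hps⟩ := exists_dual_basis (R := R) C
  have hb := extTensor_ringMod_bijective (n := n) (X := X)
  constructor
  · refine (injective_iff_map_eq_zero _).mpr fun t ht => ?_
    have h : ∀ i, (p i).lTensor (extMod n X (ringMod R)) t = 0 := fun i => by
      apply hb.1
      rw [map_zero]
      refine (extTensor_lTensor (D := ringMod R) (p i) t).trans ?_
      rw [ht, map_zero]
    have h2 : ∑ i, (s i ∘ₗ p i).lTensor (extMod n X (ringMod R)) = LinearMap.id := by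
      rw [← LinearMap.coe_lTensorHom, ← map_sum, hps, LinearMap.coe_lTensorHom,
        LinearMap.lTensor_id]
    refine (LinearMap.congr_fun h2 t).symm.trans ((LinearMap.sum_apply _ _ _).trans ?_)
    exact Finset.sum_eq_zero fun i _ => by
      rw [LinearMap.lTensor_comp, LinearMap.comp_apply, h, map_zero]
  · intro e
    choose r hr using fun i => hb.2 (extPush n X C (ringMod R) (p i) e)
    refine ⟨∑ i, (s i).lTensor (extMod n X (ringMod R)) (r i), ?_⟩
    rw [map_sum]
    have h : ∀ i, extTensor n X C ((s i).lTensor (extMod n X (ringMod R)) (r i)) =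
        extPush n X C C (s i ∘ₗ p i) e := fun i => by
      refine (extTensor_lTensor (C := ringMod R) (s i) (r i)).trans ?_
      rw [hr]
      exact (extPush_comp (L := ringMod R) _ _ _).symm
    rw [Finset.sum_congr rfl fun i _ => h i, ← LinearMap.sum_apply, ← map_sum, hps, extPush_id]

variable [IsNoetherianRing R]

/-- Since `Ext^{n+1}(X, -) = 0`, both sides are right exact in `C`, and they agree on finite free
modules. -/
theorem extTensor_bijective (hX : HasProjectiveDimensionLT X (n + 1)) [Module.Finite R C] :
    Function.Bijective (extTensor n X C) := by
  have hsurj : ∀ {A B C : ModuleCat.{u} R} {i : A →ₗ[R] B} {p : B →ₗ[R] C},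
      Function.Injective i → Function.Exact i p → Function.Surjective p →
      Function.Surjective (extPush n X B C p) := fun {A B C i p} hi hip hp => by
    obtain ⟨δ, h1, -⟩ := exists_extPush_connecting hi hip hp n X
    have : Subsingleton (extMod (n + 1) X A) :=
      HasProjectiveDimensionLT.subsingleton X (n + 1) (n + 1) le_rfl A
    exact surjective_of_exact h1
  have hs : ∀ C : ModuleCat.{u} R, Module.Finite R C → Function.Surjective (extTensor n X C) := by
    intro C _ e
    obtain ⟨a, Z, i, p, -, hi, hip, hp⟩ := exists_syzygy C
    obtain ⟨e, rfl⟩ := hsurj hi hip hp e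
    obtain ⟨t, rfl⟩ := extTensor_bijective_of_projective.2 e
    exact ⟨_, extTensor_lTensor p t⟩
  refine ⟨(injective_iff_map_eq_zero _).mpr fun t ht => ?_, hs C inferInstance⟩
  obtain ⟨a, Z, i, p, hZ, hi, hip, hp⟩ := exists_syzygy C
  obtain ⟨t, rfl⟩ := LinearMap.lTensor_surjective (extMod n X (ringMod R)) hp t
  obtain ⟨e, he⟩ := (extPush_exact hi hip hp n X _).mp ((extTensor_lTensor p t).symm.trans ht)
  obtain ⟨s, rfl⟩ := hs Z hZ e
  rw [← extTensor_bijective_of_projective.1 ((extTensor_lTensor i s).trans he)]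
  exact (lTensor_exact (extMod n X (ringMod R)) hip hp).apply_apply_eq_zero s

end ExtTensor

/-! ### The perfect modules form an adjoint pair. -/

section PerfectPair

variable [IsNoetherianRing R] {K M N : ModuleCat.{u} R} {n : ℕ}

theorem PerfectModules.ext (h : PerfectModules n M) :
    Nonempty (extMod n (extMod n M (ringMod R)) (ringMod R) ≃ₗ[R] M) ∧
      PerfectModules n (extMod n M (ringMod R)) := by
  obtain ⟨h1, h2, h3⟩ := perfectModules_iff.mp h
  obtain ⟨⟨e⟩, h4⟩ := nonempty_ext_ext_equiv h3 (natCast_le_grade_iff.mp h2.ge)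
  refine ⟨⟨e⟩, perfectModules_iff.mpr ⟨inferInstance, ?_, h4⟩⟩
  rw [← h2]
  -- `M` and `Ext^n(M, R)` are each the dual of the other, so their annihilators agree.
  refine grade_eq_of_annihilator_eq (le_antisymm ?_ (annihilator_le_annihilator_ext n _ M))
  exact (annihilator_le_annihilator_ext n _ _).trans_eq e.annihilator_eq

theorem PerfectModules.nonempty_codual_equiv [Module.Finite R K] (h : PerfectModules n M) :
    Nonempty ((tensorFunctor K).obj (extMod n M (ringMod R)) ≃ₗ[R] extMod n M K) :=
  ⟨LinearEquiv.ofBijective _ (extTensor_bijective (perfectModules_iff.mp h).2.2)⟩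

theorem isReflexiveSubcategory_perfectModules (n : ℕ) :
    IsReflexiveSubcategory n (ringMod R) (PerfectModules n) where
  closedUnderIso := ⟨fun e h => h.congr e.toLinearEquiv⟩
  finite _ h := h.1
  grade_eq _ h := h.2.1
  eta_bijective M h := by
    have := h.1
    obtain ⟨⟨e⟩, -⟩ := h.ext
    exact eta_bijective_of_equiv
      ((isSemidualizing_ringMod R).extVanishesBelow h.2.1.ge) e
  ext_mem _ h := h.ext.2

theorem KPerfectModules.codual (hK : IsSemidualizing K) (h : KPerfectModules n K N) :
    KPerfectModules n K (codual n K N) := by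
  have := hK.finite
  have h2 := (h.hom hK).2
  obtain ⟨e⟩ := h2.nonempty_codual_equiv (K := K)
  exact (h2.ext.2.tensor hK).2.congr hK e

theorem KPerfectModules.xi_bijective (hK : IsSemidualizing K) (h : KPerfectModules n K N) :
    Function.Bijective (xi n K N) := by
  have := hK.finite
  have := h.1
  have hv := hK.extVanishesBelow h.2.1.ge
  obtain ⟨hB, hX⟩ := h.hom hK
  have h1 := extToHomCodual_bijective hv le_rfl hB.2.1
  obtain ⟨⟨e₁⟩, hT⟩ := hX.ext
  obtain ⟨e₂⟩ := hX.nonempty_codual_equiv (K := K)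
  obtain ⟨e₄⟩ := hT.nonempty_codual_equiv (K := K)
  refine (xi_bijective_iff h1).mpr (eta_bijective_of_equiv hv ?_)
  let T : ModuleCat.{u} R := extMod n (homMod K N) (ringMod R)
  -- The required isomorphism is assembled from `Ext^n(N, K) ≅ Hom(K, D(N)) ≅ Hom(K, T ⊗ K) ≅ T` and
  -- `Ext^n(T, K) ≅ Ext^n(T, R) ⊗ K ≅ Hom(K, N) ⊗ K ≅ N`.
  let e₃ : T ≃ₗ[R] extMod n N K :=
    (LinearEquiv.ofBijective _ (hT.tensor hK).1.2.1).trans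
      ((e₂.congrRight : homMod K ((tensorFunctor K).obj T) ≃ₗ[R] homMod K (Linkage.codual n K N)).trans
        (LinearEquiv.ofBijective _ h1).symm)
  exact (extPullEquiv n K e₃).trans (e₄.symm.trans ((e₁.rTensor K).trans
    ((TensorProduct.comm R _ _).trans (LinearEquiv.ofBijective _ hB.2.1))))

theorem isAdjointPair_perfectModules (hK : IsSemidualizing K) (n : ℕ) :
    IsAdjointPair n K (PerfectModules n) (KPerfectModules n K) where
  reflexive := isReflexiveSubcategory_perfectModules n
  coreflexive :=
    { closedUnderIso := ⟨fun e h => h.congr hK e.toLinearEquiv⟩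
      finite := fun _ h => h.1
      grade_eq := fun _ h => h.2.1
      nu_bijective := fun _ h => (h.hom hK).1.2.1
      xi_bijective := fun _ h => h.xi_bijective hK
      codual_mem := fun _ h => h.codual hK }
  tensor_mem _ h := (h.tensor hK).2
  le_bass _ h := (h.hom hK).1
  hom_mem _ h := (h.hom hK).2
  le_auslander _ h := (h.tensor hK).1

theorem IsAdjointPair.restrictsToAdjointEquivalence_auslander (hK : IsSemidualizing K)
    {𝒳 𝒴 : ObjectProperty (ModuleCat.{u} R)} (h : IsAdjointPair n K 𝒳 𝒴) :
    RestrictsToAdjointEquivalence K (fun M => Auslander K M ∧ IsLinked n (ringMod R) 𝒳 M)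
      (fun N => Bass K N ∧ IsColinked n K 𝒴 N) :=
  restrictsToAdjointEquivalence_of_exchange K (fun _ hM => hM.1.2.1) (fun _ hN => hN.1.2.1)
    (fun _ hM => ⟨bass_tensor_of_auslander hK hM.1,
      h.isColinked_tensor hK ⟨hM.1.1, hM.1.2.1⟩ hM.2⟩)
    (fun _ hN => ⟨auslander_hom_of_bass hK hN.1, h.isLinked_hom hK ⟨hN.1.1, hN.1.2.1⟩ hN.2⟩)

end PerfectPair

end

end Linkage

theorem theorem1p3 {R : Type u} [CommRing R] [IsNoetherianRing R]
    (K : ModuleCat.{u} R) (hK : IsSemidualizing K) (n : ℕ) :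
    (∀ 𝒳 𝒴 : ObjectProperty (ModuleCat.{u} R), IsAdjointPair n K 𝒳 𝒴 →
      RestrictsToAdjointEquivalence K
        (fun M => Nabla K M ∧ IsLinked n (ringMod R) 𝒳 M)
        (fun N => Delta K N ∧ IsColinked n K 𝒴 N)) ∧
    RestrictsToAdjointEquivalence K
      (fun M => Auslander K M ∧ IsLinked n (ringMod R) (PerfectModules n) M)
      (fun N => Bass K N ∧ IsColinked n K (KPerfectModules n K) N) := by
  exact ⟨fun _ _ h => h.restrictsToAdjointEquivalence hK,
    (isAdjointPair_perfectModules hK n).restrictsToAdjointEquivalence_auslander hK⟩
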